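/- **Setting.** Let $Z$ be a complex manifold and let $M\subset Z$ be a real-analytic submanifold that is generic, i.e. $T_pM+iT_pM=T_pZ$ for all $p\in M$, with the induced CR-structure given by $H_pM=T_pM\cap iT_pM$ and $Jv=iv$. Fix $a\in M$ and put $n=\dim_{\mathbb C}Z$. Let $\mathrm{Aut}(M,a)$ be the group of germs at $a$ of bianalytic CR-isomorphisms $(M,a)\to(M,a)$. Let $\mathfrak g=\mathfrak{hol}(M,a)$ be the real Lie algebra of germs at $a$ of real-analytic vector fields on $M$ whose local flows consist of CR-maps; it is regarded as a real subalgebra of the complex Lie algebra $\mathfrak{hol}(Z,a)$ of germs of holomorphic vector fields on $Z$. An *involution of $(M,a)$* is a germ $\tau:(M,a)\to(M,a)$ of a real-analytic anti-CR map with $\tau^2=\mathrm{id}$ and $\tau(a)=a$. Let $M^\tau$ be the germ of its fixed point set and let $\mathfrak g^{-\tau}$, $T_a^{-\tau}M$ be the $(-1)$-eigenspaces of $\tau$ on $\mathfrak g$ and $T_aM$. A *tube realization* of $(M,a)$ is a bianalytic CR-isomorphism of germs $\varphi:(M,a)\to(T,c)$, where $T=\mathbb R^r+iB\subset\mathbb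 C^r$ is the tube over a connected real-analytic submanifold $B\subset\mathbb R^r$, for some $r$. Two tube realizations $(M,a)\to(T,c)$ and $(M,a)\to(T',c')$ are *affinely equivalent* if some complex affine isomorphism of the ambient spaces maps the germ $(T,c)$ onto the germ $(T',c')$. Two subsets $\mathfrak v,\mathfrak v'\subset\mathfrak g$ are *conjugate* if $\mathfrak v'=g_*\mathfrak v$ for some $g\in\mathrm{Aut}(M,a)$. For an abelian Lie subalgebra $\mathfrak v\subset\mathfrak g$ consider the following conditions. * (i) $\mathfrak v$ is totally real in $\mathfrak{hol}(Z,a)$, i.e. $\mathfrak v\cap i\mathfrak v=0$. * (i') There is an involution $\tau$ of $(M,a)$ with $\mathfrak v\subset\mathfrak g^{-\tau}$. * (ii) The values at $a$ of the elements of $\mathfrak v+i\mathfrak v\subset\mathfrak{hol}(Z,a)$ form the full tangent space $T_aZ$. **Proposition.** 1. The assignment $\varphi\mapsto\{\varphi^*(v\,\partial/\partial z):v\in\mathbb R^r\}$ induces a bijection from the affine equivalence classes of tube realizations of $(M,a)$ onto the $\mathrm{Aut}(M,a)$-conjugacy classes of abelian Lie subalgebras $\mathfrak v\subset\mathfrak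 g$ satisfying (i') and (ii). Moreover, for every abelian Lie subalgebra $\mathfrak v\subset\mathfrak g$ satisfying (ii), the conditions (i) and (i') are equivalent. 2. Let $\mathfrak v\subset\mathfrak g$ be an abelian Lie subalgebra satisfying (i') and (ii). Then the involution $\tau$ in (i') is uniquely determined by $\mathfrak v$. The germ at $a$ of $M^\tau$ is a real-analytic submanifold with $\dim_aM^\tau=\mathrm{CR}\text{-}\dim M$, and $\dim_{\mathbb R}T_a^{-\tau}M=n$. 3. For $\mathfrak v$ and $\tau$ as in 2 and every $g\in\mathrm{Aut}(M,a)$, the abelian Lie subalgebra $g_*\mathfrak v$ satisfies (i') and (ii), and its unique involution is $g\circ\tau\circ g^{-1}$. -/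

import Mathlib

open Set Filter Topology
open scoped Manifold ContDiff

noncomputable section

namespace CRTube

universe uE uZ uF uM

/-! ### Generically embedded CR-manifolds

`Z` is a complex manifold modelled on `E`, `M` is a real-analytic manifold modelled on `F`, and
`ι : M → Z` is the inclusion map. The tangent space of `Z` at any point is the complex vector space
`E` (in the preferred chart at that point). -/

section CRManifold

variable {E : Type uE} [NormedAddCommGroup E] [NormedSpace ℂ E]
  {Z : Type uZ} [TopologicalSpace Z] [ChartedSpace E Z]
  {F : Type uF} [NormedAddCommGroup F] [NormedSpace ℝ F]
  {M : Type uM} [TopologicalSpace M] [ChartedSpace F M]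

/-- The (real) differential of `ι : M → Z` at `p`, with values in the complex vector space
`T_{ι p} Z = E`. -/
def dEmb (E : Type uE) [NormedAddCommGroup E] [NormedSpace ℂ E] {Z : Type uZ} [TopologicalSpace Z]
    [ChartedSpace E Z] (F : Type uF) [NormedAddCommGroup F] [NormedSpace ℝ F]
    {M : Type uM} [TopologicalSpace M] [ChartedSpace F M] (ι : M → Z) (p : M) :
    TangentSpace 𝓘(ℝ, F) p →L[ℝ] E :=
  mfderiv 𝓘(ℝ, F) 𝓘(ℝ, E) ι p

variable (E Z F M) in
/-- A realization `ι` of `M` as a real-analytic generic submanifold of the complex manifold `Z`: a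
real-analytic embedding with `T_p M + i T_p M = T_p Z` for all `p`. -/
structure GenericEmbedding where
  toFun : M → Z
  analytic : ContMDiff 𝓘(ℝ, F) 𝓘(ℝ, E) ω toFun
  isEmbedding : IsEmbedding toFun
  injective_dEmb : ∀ p, Function.Injective (dEmb E F toFun p)
  generic : ∀ p, Submodule.span ℂ (range (dEmb E F toFun p)) = ⊤

/-- The (real) differential of the inclusion `M → Z` at `p`. -/
def GenericEmbedding.d (ι : GenericEmbedding E Z F M) (p : M) : TangentSpace 𝓘(ℝ, F) p →L[ℝ] E :=
  dEmb E F ι.toFun p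

/-- For tangent vectors `v`, `w` of `M` at `p`: `v` lies in the holomorphic tangent space
`H_p M = T_p M ∩ i T_p M`, and `w = J v`. -/
def IsJ (ι : GenericEmbedding E Z F M) (p : M) (v w : TangentSpace 𝓘(ℝ, F) p) : Prop :=
  ι.d p w = Complex.I • ι.d p v

/-- The holomorphic tangent space `H_p M = T_p M ∩ i T_p M` as a complex subspace of `T_p Z`. -/
def holTangent (ι : GenericEmbedding E Z F M) (p : M) : Submodule ℂ E where
  carrier := {x | x ∈ range (ι.d p) ∧ Complex.I • x ∈ range (ι.d p)}
  zero_mem' := ⟨⟨0, by simp⟩, ⟨0, by simp⟩⟩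
  add_mem' := by
    rintro x y ⟨⟨v, rfl⟩, ⟨v', hv'⟩⟩ ⟨⟨w, rfl⟩, ⟨w', hw'⟩⟩
    exact ⟨⟨v + w, by simp⟩, ⟨v' + w', by simp [hv', hw']⟩⟩
  smul_mem' := by
    rintro c x ⟨⟨v, rfl⟩, ⟨w, hw⟩⟩
    have key : ∀ y : E, c • y = c.re • y + c.im • (Complex.I • y) := by
      intro y
      conv_lhs => rw [← Complex.re_add_im c, add_smul, mul_smul]
      simp only [Complex.coe_smul]
    refine ⟨⟨c.re • v + c.im • w, ?_⟩, ⟨c.re • w - c.im • v, ?_⟩⟩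
    · rw [map_add, map_smul, map_smul, hw, key]
    · rw [map_sub, map_smul, map_smul, hw, key (ι.d p v), smul_add,
        smul_comm Complex.I c.re, smul_comm Complex.I c.im, smul_smul Complex.I Complex.I,
        Complex.I_mul_I, neg_one_smul, smul_neg, sub_eq_add_neg]

/-- The CR-dimension of `M` (at `p`): the complex dimension of `H_p M`. -/
def crDim (ι : GenericEmbedding E Z F M) (p : M) : ℕ := Module.finrank ℂ (holTangent ι p)

/-! ### CR-maps and anti-CR-maps, automorphisms and involutions of the germ `(M, a)` -/

/-- The differential of `f : M → M` at `p` maps `H_p M` complex linearly into `H_{f p} M`. -/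
def IsCRAt (ι : GenericEmbedding E Z F M) (f : M → M) (p : M) : Prop :=
  ∀ v w : TangentSpace 𝓘(ℝ, F) p, IsJ ι p v w →
    IsJ ι (f p) (mfderiv 𝓘(ℝ, F) 𝓘(ℝ, F) f p v) (mfderiv 𝓘(ℝ, F) 𝓘(ℝ, F) f p w)

/-- The differential of `f : M → M` at `p` maps `H_p M` antilinearly into `H_{f p} M`. -/
def IsAntiCRAt (ι : GenericEmbedding E Z F M) (f : M → M) (p : M) : Prop :=
  ∀ v w : TangentSpace 𝓘(ℝ, F) p, IsJ ι p v w →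
    IsJ ι (f p) (mfderiv 𝓘(ℝ, F) 𝓘(ℝ, F) f p v) (-(mfderiv 𝓘(ℝ, F) 𝓘(ℝ, F) f p w))

/-- `f` represents a germ of a real-analytic CR-map `(M, a) → (M, a)`. -/
structure IsCRGerm (ι : GenericEmbedding E Z F M) (a : M) (f : M → M) : Prop where
  map_base : f a = a
  analytic : ContMDiffAt 𝓘(ℝ, F) 𝓘(ℝ, F) ω f a
  cr : ∀ᶠ p in 𝓝 a, IsCRAt ι f p

/-- `g` and `h` represent mutually inverse elements of the stability group `Aut(M, a)`. -/
structure IsAutPair (ι : GenericEmbedding E Z F M) (a : M) (g h : M → M) : Prop where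
  left : IsCRGerm ι a g
  right : IsCRGerm ι a h
  left_inv : ∀ᶠ p in 𝓝 a, h (g p) = p
  right_inv : ∀ᶠ p in 𝓝 a, g (h p) = p

/-- `g` represents an element of the stability group `Aut(M, a)`. -/
def IsAut (ι : GenericEmbedding E Z F M) (a : M) (g : M → M) : Prop := ∃ h, IsAutPair ι a g h

/-- `τ` represents an involution of the CR-manifold germ `(M, a)`. -/
structure IsInvolution (ι : GenericEmbedding E Z F M) (a : M) (τ : M → M) : Prop where
  map_base : τ a = a
  analytic : ContMDiffAt 𝓘(ℝ, F) 𝓘(ℝ, F) ω τ a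
  antiCR : ∀ᶠ p in 𝓝 a, IsAntiCRAt ι τ p
  involutive : ∀ᶠ p in 𝓝 a, τ (τ p) = p

/-- The `-1`-eigenspace of `τ` on `T_a M` (for `τ a = a`, the space `T_{τ a} M` is `T_a M`). -/
def negTangent (F : Type uF) [NormedAddCommGroup F] [NormedSpace ℝ F]
    {M : Type uM} [TopologicalSpace M] [ChartedSpace F M] (a : M) (τ : M → M) : Submodule ℝ F :=
  let A : F →L[ℝ] F := mfderiv 𝓘(ℝ, F) 𝓘(ℝ, F) τ a
  Module.End.eigenspace (A : Module.End ℝ F) (-1)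

/-- Near its point `a`, the subset `S` of the real-analytic manifold `M` is a real-analytic
submanifold of dimension `d`. -/
def IsAnalyticSubmanifoldAt (F : Type uF) [NormedAddCommGroup F] [NormedSpace ℝ F]
    {M : Type uM} [TopologicalSpace M] [ChartedSpace F M] (S : Set M) (d : ℕ) (a : M) : Prop :=
  a ∈ S ∧ ∃ e ∈ IsManifold.maximalAtlas 𝓘(ℝ, F) ω M, a ∈ e.source ∧
    ∃ L : Submodule ℝ F, Module.finrank ℝ L = d ∧ ∀ p ∈ e.source, p ∈ S ↔ e p ∈ L

/-! ### Germs of vector fields and `hol(M, a)` -/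

variable (F) in
/-- The vector fields on `M` that vanish in a neighbourhood of `a`. -/
def nullFields (a : M) : Submodule ℝ (∀ p : M, TangentSpace 𝓘(ℝ, F) p) where
  carrier := {X | ∀ᶠ p in 𝓝 a, X p = 0}
  zero_mem' := Eventually.of_forall fun _ => rfl
  add_mem' := by
    intro X Y hX hY
    filter_upwards [hX, hY] with p h1 h2
    simp [h1, h2]
  smul_mem' := by
    intro c X hX
    filter_upwards [hX] with p h
    simp [h]

variable (F) in
/-- Germs at `a` of (arbitrary) vector fields on `M`. -/
abbrev VFGerm (a : M) : Type (max uF uM) :=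
  (∀ p : M, TangentSpace 𝓘(ℝ, F) p) ⧸ nullFields F a

/-- The germ at `a` of a vector field. -/
abbrev germ (a : M) (X : ∀ p : M, TangentSpace 𝓘(ℝ, F) p) : VFGerm F a :=
  (nullFields F a).mkQ X

section Hol

variable [IsManifold 𝓘(ℝ, F) ω M]

/-- Near `a`, the vector field `X` is a real-analytic infinitesimal CR-transformation: it is
real-analytic and its local flow `Φ` consists of CR-transformations. -/
structure IsInfinitesimalCR (ι : GenericEmbedding E Z F M) (a : M) (X : ∀ p : M, TangentSpace 𝓘(ℝ, F) p) : Prop where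
  analytic : ContMDiffAt 𝓘(ℝ, F) (𝓘(ℝ, F)).tangent ω
    (fun p => (⟨p, X p⟩ : TangentBundle 𝓘(ℝ, F) M)) a
  flow : ∃ (Φ : ℝ → M → M) (U : Set M) (ε : ℝ), IsOpen U ∧ a ∈ U ∧ 0 < ε ∧
    (∀ p ∈ U, Φ 0 p = p) ∧
    (∀ p ∈ U, IsMIntegralCurveOn (I := 𝓘(ℝ, F)) (fun t => Φ t p) X (Ioo (-ε) ε)) ∧
    ContMDiffOn (𝓘(ℝ, ℝ).prod 𝓘(ℝ, F)) 𝓘(ℝ, F) ω (fun q : ℝ × M => Φ q.1 q.2)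
      (Ioo (-ε) ε ×ˢ U) ∧
    ∀ t ∈ Ioo (-ε) ε, ∀ p ∈ U, IsCRAt ι (Φ t) p

/-- `hol(M, a)`: the germs at `a` of real-analytic infinitesimal CR-transformations. -/
def hol (ι : GenericEmbedding E Z F M) (a : M) : Set (VFGerm F a) :=
  {ξ | ∃ X, germ a X = ξ ∧ IsInfinitesimalCR ι a X}

/-- `𝔳` is an abelian Lie subalgebra of `hol(M, a)`: a real linear subspace on which the bracket
vanishes identically. -/
structure IsAbelianSubalgebra (ι : GenericEmbedding E Z F M) (a : M) (𝔳 : Submodule ℝ (VFGerm F a)) : Prop where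
  subset_hol : (𝔳 : Set (VFGerm F a)) ⊆ hol ι a
  abelian : ∀ X Y : (∀ p : M, TangentSpace 𝓘(ℝ, F) p), germ a X ∈ 𝔳 → germ a Y ∈ 𝔳 →
    ∀ᶠ p in 𝓝 a, VectorField.mlieBracket 𝓘(ℝ, F) X Y p = 0

/-- `𝔳` is totally real, `𝔳 ∩ i𝔳 = 0`. Here the multiplication by `i` is that of the complex Lie
algebra `hol(Z, a)` of germs of holomorphic vector fields on `Z`, which contains `hol(M, a)`; as `M`
is generic in `Z`, such germs are determined by their restrictions to `M`, so that `Y = i X` there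
says that `Y p = i X p` in `T_p Z` for all `p` in `M` near `a`. -/
def IsTotallyReal (ι : GenericEmbedding E Z F M) (a : M) (𝔳 : Submodule ℝ (VFGerm F a)) : Prop :=
  ∀ X Y : (∀ p : M, TangentSpace 𝓘(ℝ, F) p), germ a X ∈ 𝔳 → germ a Y ∈ 𝔳 →
    (∀ᶠ p in 𝓝 a, ι.d p (Y p) = Complex.I • ι.d p (X p)) → germ a X = 0

/-- The values at `a` of the fields in `𝔢 = 𝔳 + i𝔳` form the full tangent space `T_a Z`. -/
def SpansTangent (ι : GenericEmbedding E Z F M) (a : M) (𝔳 : Submodule ℝ (VFGerm F a)) : Prop :=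
  Submodule.span ℂ {x : E | ∃ X : (∀ p : M, TangentSpace 𝓘(ℝ, F) p),
    germ a X ∈ 𝔳 ∧ x = ι.d a (X a)} = ⊤

/-- `𝔳` lies in the `-1`-eigenspace of `τ`, i.e. `τ_* X = -X` for all `X` in `𝔳`. -/
def InNegEigenspace (a : M) (τ : M → M) (𝔳 : Submodule ℝ (VFGerm F a)) : Prop :=
  ∀ X : (∀ p : M, TangentSpace 𝓘(ℝ, F) p), germ a X ∈ 𝔳 →
    ∀ᶠ p in 𝓝 a, mfderiv 𝓘(ℝ, F) 𝓘(ℝ, F) τ p (X p) = -X (τ p)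

/-- `τ` is an involution of the germ `(M, a)` with `𝔳 ⊆ hol(M, a)^{-τ}`. -/
def IsInvolutionFor (ι : GenericEmbedding E Z F M) (a : M) (𝔳 : Submodule ℝ (VFGerm F a)) (τ : M → M) : Prop :=
  IsInvolution ι a τ ∧ InNegEigenspace a τ 𝔳

/-- `𝔳` is an abelian Lie subalgebra of `hol(M, a)` such that (i') some involution of `(M, a)` has
`𝔳` in its `-1`-eigenspace, and (ii) `𝔳 + i𝔳` spans `T_a Z`. -/
structure IsTubeSubalgebra (ι : GenericEmbedding E Z F M) (a : M) (𝔳 : Submodule ℝ (VFGerm F a)) : Prop where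
  isAbelianSubalgebra : IsAbelianSubalgebra ι a 𝔳
  exists_involution : ∃ τ, IsInvolutionFor ι a 𝔳 τ
  spans : SpansTangent ι a 𝔳

/-- `𝔳' = g_* 𝔳`, where `Y = g_* X` means that `dg_p (X p) = Y (g p)` for all `p` near `a`. -/
def IsPushforward (a : M) (g : M → M) (𝔳 𝔳' : Submodule ℝ (VFGerm F a)) : Prop :=
  ∀ Y : (∀ p : M, TangentSpace 𝓘(ℝ, F) p), germ a Y ∈ 𝔳' ↔
    ∃ X : (∀ p : M, TangentSpace 𝓘(ℝ, F) p), germ a X ∈ 𝔳 ∧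
      ∀ᶠ p in 𝓝 a, mfderiv 𝓘(ℝ, F) 𝓘(ℝ, F) g p (X p) = Y (g p)

/-- The abelian Lie subalgebras of `hol(M, a)` with (i') and (ii). -/
def TubeSubalgebra (ι : GenericEmbedding E Z F M) (a : M) : Type (max uF uM) :=
  {𝔳 : Submodule ℝ (VFGerm F a) // IsTubeSubalgebra ι a 𝔳}

/-- Conjugacy with respect to `Aut(M, a)`. -/
def TubeSubalgebra.Conjugate {ι : GenericEmbedding E Z F M} {a : M} (𝔳 𝔳' : TubeSubalgebra ι a) : Prop :=
  ∃ g, IsAut ι a g ∧ IsPushforward a g 𝔳.1 𝔳'.1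

end Hol

/-! ### Tube realizations -/

/-- The tube `ℝ^r + iB` in `ℂ^r` over the base `B` in `ℝ^r`. -/
def tube {r : ℕ} (B : Set (Fin r → ℝ)) : Set (Fin r → ℂ) := {z | (fun j => (z j).im) ∈ B}

/-- `φ` represents a CR-isomorphism of germs `(M, a) → (T, φ a)`, for `T` a submanifold of `ℂ^r`:
it is bianalytic onto `T`, and CR in both directions. As `dφ` is an isomorphism of `T_p M` onto
`T_{φ p} T`, the latter says that `w = J v` in `H_p M` exactly if `dφ w = i dφ v`. -/
structure IsCRIsoOnto (ι : GenericEmbedding E Z F M) (a : M) {r : ℕ} (φ : M → Fin r → ℂ) (T : Set (Fin r → ℂ)) :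
    Prop where
  analytic : ContMDiffAt 𝓘(ℝ, F) 𝓘(ℝ, Fin r → ℂ) ω φ a
  mapsTo : ∀ᶠ p in 𝓝 a, φ p ∈ T
  inverse : ∃ ψ : (Fin r → ℂ) → M, ContMDiffAt 𝓘(ℝ, Fin r → ℂ) 𝓘(ℝ, F) ω ψ (φ a) ∧
    (∀ᶠ p in 𝓝 a, ψ (φ p) = p) ∧ ∀ᶠ z in 𝓝[T] (φ a), φ (ψ z) = z
  cr : ∀ᶠ p in 𝓝 a, ∀ v w : TangentSpace 𝓘(ℝ, F) p, 
    IsJ ι p v w ↔ dEmb (Fin r → ℂ) F φ p w = Complex.I • dEmb (Fin r → ℂ) F φ p v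

/-- A tube realization of the germ `(M, a)`: a CR-isomorphism of germs onto a germ of a tube
`ℝ^r + iB` over a connected real-analytic submanifold `B` of `ℝ^r`. -/
structure TubeRealization (ι : GenericEmbedding E Z F M) (a : M) where
  r : ℕ
  base : Set (Fin r → ℝ)
  isConnected_base : IsConnected base
  submanifold_base : ∃ d, ∀ y ∈ base, IsAnalyticSubmanifoldAt (Fin r → ℝ) base d y
  toFun : M → Fin r → ℂ
  isCRIsoOnto : IsCRIsoOnto ι a toFun (tube base)

namespace TubeRealization

variable {ι : GenericEmbedding E Z F M} {a : M}

/-- Two tube realizations are affinely equivalent if some complex affine isomorphism of the ambient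
spaces maps one tube germ onto the other. -/
def AffinelyEquivalent (R R' : TubeRealization ι a) : Prop :=
  ∃ l : (Fin R.r → ℂ) ≃ᵃ[ℂ] (Fin R'.r → ℂ), l (R.toFun a) = R'.toFun a ∧
    ∀ᶠ z in 𝓝 (R.toFun a), z ∈ tube R.base ↔ l z ∈ tube R'.base

/-- The space of germs `φ^*(v ∂/∂z)`, `v ∈ ℝ^r`, for a tube realization `φ`. -/
def translationAlgebra (R : TubeRealization ι a) : Submodule ℝ (VFGerm F a) where
  carrier := {ξ | ∃ X : (∀ p : M, TangentSpace 𝓘(ℝ, F) p), germ a X = ξ ∧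
    ∃ v : Fin R.r → ℝ, ∀ᶠ p in 𝓝 a, dEmb (Fin R.r → ℂ) F R.toFun p (X p) = fun j => (v j : ℂ)}
  zero_mem' := ⟨0, by simp, 0, Eventually.of_forall fun p => by ext j; simp⟩
  add_mem' := by
    rintro _ _ ⟨X, rfl, v, hv⟩ ⟨Y, rfl, w, hw⟩
    refine ⟨X + Y, by simp, v + w, ?_⟩
    filter_upwards [hv, hw] with p h1 h2
    ext j
    simp [h1, h2]
  smul_mem' := by
    rintro c _ ⟨X, rfl, v, hv⟩
    refine ⟨c • X, by simp, c • v, ?_⟩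
    filter_upwards [hv] with p h1
    ext j
    simp [h1]

end TubeRealization

end CRManifold

end CRTube

end

/-! A subalgebra `𝔳` satisfying (i) and (ii) is integrated to coordinates in which it consists of
the real translations; everything else is then read off in `ℂ^r`. Choose fields `X k` in `𝔳` whose
values at `a` form a complex basis, and write the differential of the embedding, in charts, as `dj =
∑ θ_k f_k` with `f_k = dj (X k)`. The fields commute, and each `f_k` is a CR function because the
flow of `X k` is CR (`cr_of_flow`). Differentiating the identity for `dj` therefore shows that `θ`
is closed, and a primitive `φ` of `θ` is an immersion with `dφ (X k) = e_k` that respects the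
CR-structure in both directions (`exists_straightening`). An image tangent to all real translations
is locally a tube (`exists_tube_of_immersion`). Any other field of `𝔳` has constant coefficients `c`
in these coordinates (`eventually_const_of_commute`), and total reality forces `c` to be real. So
`𝔳` is exactly the translation algebra of `φ` (`IsAbelianSubalgebra.exists_tubeRealization`).

In tube coordinates the involution is the reflection `x + iy ↦ 2c - x + iy`, where `c` is the real
part of the base point. It preserves every tube. It is the only possibility: a tangent vector of a
tube splits as `x + J y` with `x`, `y` real translations, so an anti-CR map is determined to first
order by its effect on translations (`IsCRIsoOnto.eq_reflect`). Its fixed points form the level set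
`Re φ = c` of a submersion, and its `-1`-eigenspace at `a` is `{Im dφ = 0}`. Conversely, an
involution reversing `𝔳` makes `𝔳` totally real, since `Y = iX` would be mapped to `Y = -iX`
(`isTotallyReal_of_isInvolutionFor`).

For the classes: an automorphism conjugating two translation algebras has constant derivative on
translations, hence is complex affine in the two coordinate systems
(`TubeRealization.exists_affine_of_isPushforward`). In the other direction an affine isomorphism of
tube germs may have a linear part `P` that is not real and need not respect translations. Tubes are
invariant under real translations, so `P` can be replaced by `Re P + s Im P` with a real `s` making
it invertible (`exists_real_affine`); this real map lifts to a conjugating automorphism. -/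

noncomputable section

namespace CRTube

universe uE uZ uF uM

/-! ### Primitives of analytic maps are analytic. -/

section Flat
variable {F : Type*} [NormedAddCommGroup F] [NormedSpace ℝ F]
  {V : Type*} [NormedAddCommGroup V] [NormedSpace ℝ V]

/-- The power series of a primitive, before being paired with the increment. -/
def primitiveSeries (p : FormalMultilinearSeries ℝ F (F →L[ℝ] V)) :
    FormalMultilinearSeries ℝ F (F →L[ℝ] V) := fun n => ((n : ℝ) + 1)⁻¹ • p n

theorem radius_le_primitiveSeries (p : FormalMultilinearSeries ℝ F (F →L[ℝ] V)) :
    p.radius ≤ (primitiveSeries p).radius := by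
  refine FormalMultilinearSeries.radius_le_of_le fun n => ?_
  have h1 : (1 : ℝ) ≤ (n : ℝ) + 1 := by simp
  have h2 : ‖((n : ℝ) + 1)⁻¹‖ ≤ 1 := by
    rw [norm_inv, Real.norm_of_nonneg (by positivity)]
    exact inv_le_one_of_one_le₀ h1
  refine ContinuousMultilinearMap.opNorm_le_bound (norm_nonneg _) fun m => ?_
  rw [primitiveSeries, smul_apply]
  calc ‖((n : ℝ) + 1)⁻¹ • p n m‖ ≤ ‖((n : ℝ) + 1)⁻¹‖ * ‖p n m‖ :=
        ContinuousLinearMap.opNorm_smul_le _ _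
    _ ≤ 1 * ‖p n m‖ := by gcongr
    _ ≤ _ := by rw [one_mul]; exact (p n).le_opNorm m

/-- Integration along rays divides the term of degree `n` by `n + 1`, and differentiation on the
diagonal multiplies it by `n + 1` again. Only the radial derivative is compared, so no closedness of
`θ` enters. -/
theorem fderiv_unshift_primitiveSeries_apply [CompleteSpace V] {θ : F → F →L[ℝ] V}
    {p : FormalMultilinearSeries ℝ F (F →L[ℝ] V)} {x : F} {r : ENNReal}
    (hp : HasFPowerSeriesOnBall θ p x r) {G : F → V} {z : V}
    (hG : HasFPowerSeriesOnBall G ((primitiveSeries p).unshift z) x r) {u : F}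
    (hu : u ∈ Metric.eball (0 : F) r) : fderiv ℝ G (x + u) u = θ (x + u) u := by
  have h1 := (hG.fderiv.hasSum hu).mapL (ContinuousLinearMap.apply ℝ V u)
  have h2 := (hp.hasSum hu).mapL (ContinuousLinearMap.apply ℝ V u)
  refine h1.unique ?_
  convert h2 using 2 with n
  simp only [ContinuousLinearMap.apply_apply]
  rw [FormalMultilinearSeries.derivSeries_apply_diag]
  have hn : (n : ℝ) + 1 ≠ 0 := by positivity
  simp only [FormalMultilinearSeries.unshift,
            primitiveSeries]
  change (n + 1) • ((((n : ℝ) + 1)⁻¹ • p n) (Fin.init fun _ => u) : F →L[ℝ] V) u = _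
  rw [smul_apply, FunLike.coe_smul, Pi.smul_apply, ← Nat.cast_smul_eq_nsmul ℝ, smul_smul]
  push_cast
  rw [mul_inv_cancel₀ hn, one_smul]
  · rfl
  · rfl

/-- A function whose derivative is analytic is analytic. -/
theorem contDiffAt_omega_of_hasFDerivAt [CompleteSpace V] {φ : F → V} {θ : F → F →L[ℝ] V}
    {x : F} (hθ : ContDiffAt ℝ ω θ x) (hφ : ∀ᶠ y in 𝓝 x, HasFDerivAt φ (θ y) y) :
    ContDiffAt ℝ ω φ x := by
  obtain ⟨p, r, hp⟩ := hθ.analyticAt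
  have hqr := radius_le_primitiveSeries p
  have hq : HasFPowerSeriesOnBall (fun y => (primitiveSeries p).sum (y - x))
      (primitiveSeries p) x r := by
    have := ((primitiveSeries p).hasFPowerSeriesOnBall
      (lt_of_lt_of_le hp.r_pos (hp.r_le.trans hqr))).comp_sub x
    rw [zero_add] at this
    exact this.mono hp.r_pos (hp.r_le.trans hqr)
  have hG := hq.unshift (z := φ x)
  set G : F → V := fun y => φ x + (primitiveSeries p).sum (y - x) (y - x) with hGdef
  obtain ⟨ε, hε, hball⟩ := Metric.eventually_nhds_iff_ball.1
    ((hφ.and (hG.analyticAt.eventually_analyticAt)).and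
      (Metric.eball_mem_nhds x hp.r_pos))
  -- `φ` and `G` have the same radial derivative, so `φ - G` is constant on each segment issuing
  -- from `x`.
  have hconst : ∀ y ∈ Metric.ball x ε, φ y = G y := by
    intro y hy
    set u := y - x with hu
    have hseg : ∀ t ∈ Icc (0 : ℝ) 1, x + t • u ∈ Metric.ball x ε := fun t ht => by
      rw [mem_ball_iff_norm] at hy ⊢
      rw [add_sub_cancel_left, norm_smul, Real.norm_of_nonneg ht.1]
      exact lt_of_le_of_lt (mul_le_of_le_one_left (norm_nonneg _) ht.2) hy
    have hline : ∀ t : ℝ, HasDerivAt (fun t : ℝ => x + t • u) u t := fun t => by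
      simpa using ((hasDerivAt_id t).smul_const u).const_add x
    have hd : ∀ t ∈ Icc (0 : ℝ) 1, HasDerivAt (fun t : ℝ => (φ - G) (x + t • u)) 0 t := by
      intro t ht
      obtain ⟨⟨h1, h2⟩, h3⟩ := hball _ (hseg t ht)
      have hGd : fderiv ℝ G (x + t • u) u = θ (x + t • u) u := by
        -- The radial identity at `x + t • u` carries a factor `t` on both sides; it can be
        -- cancelled only for `t ≠ 0`, and at the centre the first coefficients of the series are
        -- compared instead.
        rcases eq_or_ne t 0 with rfl | h0
        · have e1 := hG.hasFPowerSeriesAt.hasFDerivAt.fderiv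
          have e2 : θ x = p 0 0 := by
            rw [← hp.coeff_zero 0]
          rw [zero_smul, add_zero, e1, e2]
          simp only [continuousMultilinearCurryFin1_apply, FormalMultilinearSeries.unshift,
            primitiveSeries]
          simp [Subsingleton.elim (Fin.init ![u]) ![]]
        · have h4 : t • u ∈ Metric.eball (0 : F) r := by
            simpa [Metric.mem_eball, edist_eq_enorm_sub] using h3
          have := fderiv_unshift_primitiveSeries_apply hp hG h4
          rw [map_smul, map_smul] at this
          exact smul_right_injective _ h0 this
      have h5 := (h1.sub h2.differentiableAt.hasFDerivAt).comp_hasDerivAt t (hline t)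
      rw [FunLike.coe_sub, Pi.sub_apply, hGd, sub_self] at h5
      exact h5
    have := constant_of_has_deriv_right_zero (f := fun t : ℝ => (φ - G) (x + t • u)) (a := 0)
      (b := 1) (fun t ht => (hd t ht).continuousAt.continuousWithinAt)
      (fun t ht => (hd t ⟨ht.1, ht.2.le⟩).hasDerivWithinAt) 1 (by simp)
    simp only [one_smul, zero_smul, add_zero, hu, add_sub_cancel, Pi.sub_apply] at this
    have hx : G x = φ x := by simp [hGdef]
    rw [hx, sub_self, sub_eq_zero] at this
    exact this
  refine (hG.analyticAt.contDiffAt (n := ω)).congr_of_eventuallyEq ?_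
  filter_upwards [Metric.ball_mem_nhds x hε] with y hy using hconst y hy
end Flat

/-! ### Linear algebra of partially defined complex structures. -/

section CRLinear

theorem complex_smul_eq {W : Type*} [AddCommGroup W] [Module ℂ W] (z : ℂ) (y : W) :
    z • y = z.re • y + Complex.I • (z.im • y) := by
  conv_lhs => rw [← Complex.re_add_im z, add_smul, mul_comm, mul_smul]
  simp only [Complex.coe_smul]

variable {F : Type*} [AddCommGroup F] [Module ℝ F]
  {E : Type*} [AddCommGroup E] [Module ℂ E] {V : Type*} [AddCommGroup V] [Module ℂ V]

/-- A real linear map that respects the partially defined complex structure induced by `L` is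
complex linear with respect to `L`. -/
theorem cr_linear_expansion {κ : Type*} [Fintype κ] (L : F →ₗ[ℝ] E) (Q : F →ₗ[ℝ] V)
    (hQ : ∀ v w, L w = Complex.I • L v → Q w = Complex.I • Q v) (x : κ → F) (c : κ → ℂ) (u : F)
    (hu : L u = ∑ k, c k • L (x k)) : Q u = ∑ k, c k • Q (x k) := by
  -- The combination with coefficients `Im c k` has its `J`-image in the source, namely `u` minus
  -- the combination with coefficients `Re c k`; this pair alone is needed.
  have h := hQ (∑ k, (c k).im • x k) (u - ∑ k, (c k).re • x k) (by
    rw [map_sub, hu, map_sum, map_sum, Finset.smul_sum, ← Finset.sum_sub_distrib]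
    refine Finset.sum_congr rfl fun k _ => ?_
    rw [map_smul, map_smul, complex_smul_eq (c k), add_sub_cancel_left])
  rw [map_sub, map_sum, map_sum, Finset.smul_sum, sub_eq_iff_eq_add, ← Finset.sum_add_distrib] at h
  rw [h]
  refine Finset.sum_congr rfl fun k _ => ?_
  rw [map_smul, map_smul, complex_smul_eq (c k), add_comm]

end CRLinear

/-! ### Complex frames as real linear maps. -/

section FrameMap
variable {F : Type*} [NormedAddCommGroup F] [NormedSpace ℝ F]
  {E : Type*} [NormedAddCommGroup E] [NormedSpace ℂ E] {n : ℕ}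

/-- The map `c ↦ ∑ c k • f k` as a real linear map. -/
def frameMap (f : Fin n → E) : (Fin n → ℂ) →L[ℝ] E :=
  ∑ k, ((ContinuousLinearMap.lsmul ℝ ℂ : ℂ →L[ℝ] E →L[ℝ] E).flip (f k)).comp
    (ContinuousLinearMap.proj k : (Fin n → ℂ) →L[ℝ] ℂ)

@[simp] theorem frameMap_apply (f : Fin n → E) (c : Fin n → ℂ) :
    frameMap f c = ∑ k, c k • f k := by
  simp [frameMap]

theorem contDiffAt_frameMap {f : Fin n → F → E} {x : F} (hf : ∀ k, ContDiffAt ℝ ω (f k) x) :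
    ContDiffAt ℝ ω (fun u => frameMap fun k => f k u) x := by
  unfold frameMap
  refine ContDiffAt.sum fun k _ => ?_
  exact ((ContinuousLinearMap.lsmul ℝ ℂ : ℂ →L[ℝ] E →L[ℝ] E).flip.contDiff.contDiffAt.comp x
    (hf k)).clm_comp contDiffAt_const

theorem fderiv_frameMap_apply {f : Fin n → F → E} {x : F}
    (hf : ∀ k, DifferentiableAt ℝ (f k) x) (v : F) (c : Fin n → ℂ)
    (hd : DifferentiableAt ℝ (fun u => frameMap fun k => f k u) x) :
    fderiv ℝ (fun u => frameMap fun k => f k u) x v c = ∑ k, c k • fderiv ℝ (f k) x v := by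
  have h1 := (ContinuousLinearMap.apply ℝ E c).hasFDerivAt.comp x hd.hasFDerivAt
  have h2 : HasFDerivAt (fun u => ∑ k, c k • f k u) (∑ k, c k • fderiv ℝ (f k) x) x :=
    HasFDerivAt.fun_sum fun k _ => (hf k).hasFDerivAt.const_smul (c k)
  have h3 : HasFDerivAt (fun u => ∑ k, c k • f k u)
      ((ContinuousLinearMap.apply ℝ E c).comp
        (fderiv ℝ (fun u => frameMap fun k => f k u) x)) x := by
    refine h1.congr_of_eventuallyEq (Eventually.of_forall fun u => ?_)
    simp
  have := congrArg (fun A : F →L[ℝ] E => A v) (h3.unique h2)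
  simpa using this

theorem frameMap_injective {f : Fin n → E} (hf : LinearIndependent ℂ f) :
    Function.Injective (frameMap f) := by
  refine (injective_iff_map_eq_zero _).2 fun c hc => ?_
  rw [frameMap_apply] at hc
  exact funext fun k => Fintype.linearIndependent_iff.1 hf c hc k

end FrameMap

/-! ### Straightening commuting CR fields. -/

section Straightening
variable {F : Type*} [NormedAddCommGroup F] [NormedSpace ℝ F]
  {E : Type*} [NormedAddCommGroup E] [NormedSpace ℂ E] {n : ℕ}

/-- The frame of a basis of `E` as a real linear equivalence. -/
def frameEquiv (b : Module.Basis (Fin n) ℂ E) : (Fin n → ℂ) ≃L[ℝ] E :=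
  (b.equivFun.symm.restrictScalars ℝ).toContinuousLinearEquiv

theorem frameEquiv_coe (b : Module.Basis (Fin n) ℂ E) :
    (frameEquiv b : (Fin n → ℂ) →L[ℝ] E) = frameMap fun k => b k := by
  ext1 c
  rw [frameMap_apply]
  exact b.equivFun_symm_apply c

/-- Commuting vector fields `X k` whose images `f k` under `dj` are CR functions and form a complex
frame are simultaneously straightened by a map to `ℂ^n`. -/
theorem exists_straightening {j : F → E} {X : Fin n → F → F} {f : Fin n → F → E} {x₀ : F}
    (hj : ContDiffAt ℝ ω j x₀) (hf : ∀ k, ContDiffAt ℝ ω (f k) x₀)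
    (hfX : ∀ᶠ u in 𝓝 x₀, ∀ k, f k u = fderiv ℝ j u (X k u))
    (b : Module.Basis (Fin n) ℂ E) (hb : ∀ k, f k x₀ = b k)
    (hcr : ∀ k, ∀ᶠ u in 𝓝 x₀, ∀ v w, fderiv ℝ j u w = Complex.I • fderiv ℝ j u v →
      fderiv ℝ (f k) u w = Complex.I • fderiv ℝ (f k) u v)
    (hcomm : ∀ k l, ∀ᶠ u in 𝓝 x₀, fderiv ℝ (f k) u (X l u) = fderiv ℝ (f l) u (X k u)) :
    ∃ φ : F → Fin n → ℂ, ContDiffAt ℝ ω φ x₀ ∧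
      ∀ᶠ u in 𝓝 x₀, LinearIndependent ℂ (fun k => f k u) ∧
        ∀ v, fderiv ℝ j u v = ∑ k, fderiv ℝ φ u v k • f k u := by
  set T : F → (Fin n → ℂ) →L[ℝ] E := fun u => frameMap fun k => f k u with hT
  have hTd : ContDiffAt ℝ ω T x₀ := contDiffAt_frameMap hf
  have hT0 : T x₀ = frameEquiv b := by
    rw [frameEquiv_coe]; simp only [hT, hb]
  set θ : F → F →L[ℝ] (Fin n → ℂ) := fun u => (T u).inverse.comp (fderiv ℝ j u) with hθ
  have hθd : ContDiffAt ℝ ω θ x₀ := by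
    refine ContDiffAt.clm_comp ?_ (hj.fderiv_right (m := ω) le_rfl)
    have : ContDiffAt ℝ ω ContinuousLinearMap.inverse (T x₀) := by
      rw [hT0]; exact contDiffAt_map_inverse _
    exact this.comp x₀ hTd
  have hinv : ∀ᶠ u in 𝓝 x₀, (T u).IsInvertible := by
    have h0 : range ((↑) : ((Fin n → ℂ) ≃L[ℝ] E) → (Fin n → ℂ) →L[ℝ] E) ∈ 𝓝 (T x₀) := by
      rw [hT0]; exact ContinuousLinearEquiv.nhds _
    exact hTd.continuousAt.eventually h0
  have hTθ : ∀ᶠ u in 𝓝 x₀, (T u).comp (θ u) = fderiv ℝ j u := by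
    filter_upwards [hinv] with u hu
    rw [hθ, ← ContinuousLinearMap.comp_assoc, hu.self_comp_inverse,
      ContinuousLinearMap.id_comp]
  -- Differentiating `T θ = dj` gives `T (dθ(v) w) = D²j(v, w) - dT(v)(θ w)`. The second derivative
  -- is symmetric, and the last term is `∑ θ_k(w) θ_l(v) df_k(X_l)`, symmetric because the fields
  -- commute. Injectivity of `T` finishes.
  have hclosed : ∀ᶠ u in 𝓝 x₀, ∀ v w, fderiv ℝ θ u v w = fderiv ℝ θ u w v := by
    filter_upwards [hinv, hTθ.eventually_nhds, hj.eventually (by simp), hTd.eventually (by simp),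
      hθd.eventually (by simp), eventually_all.2 fun k => (hf k).eventually (by simp), hfX,
      eventually_all.2 hcr, eventually_all.2 fun k => eventually_all.2 (hcomm k)]
      with u hu hTθu hju hTu hθu hfu hfXu hcru hcommu v w
    have hθexp : ∀ v, fderiv ℝ j u v = ∑ k, θ u v k • fderiv ℝ j u (X k u) := fun v => by
      rw [← hTθu.self_of_nhds, ContinuousLinearMap.comp_apply, frameMap_apply]
      refine Finset.sum_congr rfl fun k _ => ?_
      rw [hfXu k, hTθu.self_of_nhds]
    have hS : ∀ v w, fderiv ℝ T u v (θ u w) =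
        ∑ k, ∑ l, (θ u w k * θ u v l) • fderiv ℝ (f k) u (X l u) := fun v w => by
      rw [fderiv_frameMap_apply (fun k => (hfu k).differentiableAt (by simp)) _ _
        (hTu.differentiableAt (by simp))]
      refine Finset.sum_congr rfl fun k _ => ?_
      have hfv : fderiv ℝ (f k) u v = ∑ l, θ u v l • fderiv ℝ (f k) u (X l u) :=
        cr_linear_expansion (fderiv ℝ j u : F →ₗ[ℝ] E) (fderiv ℝ (f k) u : F →ₗ[ℝ] E)
          (hcru k) (fun l => X l u) (θ u v) v (hθexp v)
      rw [hfv, Finset.smul_sum]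
      simp only [smul_smul]
    have hSsymm : fderiv ℝ T u v (θ u w) = fderiv ℝ T u w (θ u v) := by
      rw [hS, hS, Finset.sum_comm]
      refine Finset.sum_congr rfl fun k _ => Finset.sum_congr rfl fun l _ => ?_
      rw [hcommu, mul_comm]
    have hprod : ∀ v w, fderiv ℝ T u v (θ u w) + T u (fderiv ℝ θ u v w) =
        fderiv ℝ (fderiv ℝ j) u v w := fun v w => by
      have h1 := ((hTu.differentiableAt (by simp)).hasFDerivAt.clm_comp
        (hθu.differentiableAt (by simp)).hasFDerivAt).congr_of_eventuallyEq
        (f₁ := fderiv ℝ j) (hTθu.mono fun y hy => hy.symm)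
      rw [h1.fderiv]
      simp [add_comm]
    have hsym : fderiv ℝ (fderiv ℝ j) u v w = fderiv ℝ (fderiv ℝ j) u w v :=
      hju.isSymmSndFDerivAt_of_omega v w
    rw [← hprod, ← hprod, hSsymm, add_right_inj] at hsym
    exact hu.injective hsym
  obtain ⟨ε, hε, hball⟩ := Metric.eventually_nhds_iff_ball.1
    ((hθd.eventually (by simp)).and hclosed)
  obtain ⟨φ, hφ⟩ := (convex_ball x₀ ε).exists_forall_hasFDerivAt_of_fderiv_symmetric
    Metric.isOpen_ball
    (fun u hu => ((hball u hu).1.differentiableAt (by simp)).differentiableWithinAt)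
    (fun u hu => (hball u hu).2)
  have hφ' : ∀ᶠ u in 𝓝 x₀, HasFDerivAt φ (θ u) u := by
    filter_upwards [Metric.ball_mem_nhds x₀ hε] with u hu using hφ u hu
  refine ⟨φ, contDiffAt_omega_of_hasFDerivAt hθd hφ', ?_⟩
  filter_upwards [hφ', hTθ, hinv] with u h1 h2 h3
  refine ⟨Fintype.linearIndependent_iff.2 fun c hc => ?_, fun v => ?_⟩
  · have : T u c = T u 0 := by rw [map_zero, frameMap_apply, hc]
    exact congrFun (h3.injective this)
  · rw [h1.fderiv, ← h2, ContinuousLinearMap.comp_apply, frameMap_apply]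

/-- A vector field commuting with the frame `X` has constant coefficients in the straightening
coordinates. -/
theorem eventually_const_of_commute {j : F → E} {X : Fin n → F → F} {f : Fin n → F → E} {x₀ : F}
    (hf : ∀ k, ContDiffAt ℝ ω (f k) x₀)
    (hfX : ∀ᶠ u in 𝓝 x₀, ∀ k, f k u = fderiv ℝ j u (X k u))
    (hcr : ∀ k, ∀ᶠ u in 𝓝 x₀, ∀ v w, fderiv ℝ j u w = Complex.I • fderiv ℝ j u v →
      fderiv ℝ (f k) u w = Complex.I • fderiv ℝ (f k) u v)
    (hcommX : ∀ k l, ∀ᶠ u in 𝓝 x₀, fderiv ℝ (f k) u (X l u) = fderiv ℝ (f l) u (X k u))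
    {φ : F → Fin n → ℂ} (hφ : ContDiffAt ℝ ω φ x₀)
    (hjφ : ∀ᶠ u in 𝓝 x₀, LinearIndependent ℂ (fun k => f k u) ∧
        ∀ v, fderiv ℝ j u v = ∑ k, fderiv ℝ φ u v k • f k u)
    {Y : F → F} {g : F → E} (hY : ContDiffAt ℝ ω Y x₀)
    (hgY : ∀ᶠ u in 𝓝 x₀, g u = fderiv ℝ j u (Y u))
    (hcrg : ∀ᶠ u in 𝓝 x₀, ∀ v w, fderiv ℝ j u w = Complex.I • fderiv ℝ j u v →
      fderiv ℝ g u w = Complex.I • fderiv ℝ g u v)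
    (hcomm : ∀ k, ∀ᶠ u in 𝓝 x₀, fderiv ℝ (f k) u (Y u) = fderiv ℝ g u (X k u)) :
    ∃ c : Fin n → ℂ, ∀ᶠ u in 𝓝 x₀, fderiv ℝ φ u (Y u) = c := by
  set c : F → Fin n → ℂ := fun u => fderiv ℝ φ u (Y u) with hc
  have hcd : ContDiffAt ℝ ω c x₀ := (hφ.fderiv_right (m := ω) le_rfl).clm_apply hY
  have hTd : ContDiffAt ℝ ω (fun u => frameMap fun k => f k u) x₀ := contDiffAt_frameMap hf
  have hgT : ∀ᶠ u in 𝓝 x₀, g u = (frameMap fun k => f k u) (c u) := by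
    filter_upwards [hgY, hjφ] with u h1 h2
    rw [h1, h2.2, frameMap_apply]
  have hzero : ∀ᶠ u in 𝓝 x₀, DifferentiableAt ℝ c u ∧ fderiv ℝ c u = 0 := by
    filter_upwards [hgT.eventually_nhds, hgY, hfX, hjφ, eventually_all.2 hcr, hcrg,
      eventually_all.2 hcomm, hcd.eventually (by simp), hTd.eventually (by simp),
      eventually_all.2 fun k => (hf k).eventually (by simp),
      eventually_all.2 fun k => eventually_all.2 (hcommX k)]
      with u hgTu hgYu hfXu hjφu hcru hcrgu hcommu hcu hTu hfu hcommXu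
    refine ⟨hcu.differentiableAt (by simp), ContinuousLinearMap.ext fun v => ?_⟩
    set θ := fderiv ℝ φ u with hθ
    have hexp : ∀ v, fderiv ℝ j u v = ∑ k, θ v k • fderiv ℝ j u (X k u) := fun v => by
      rw [hjφu.2]
      exact Finset.sum_congr rfl fun k _ => by rw [hfXu k]
    have hprod : fderiv ℝ g u v =
        (∑ k, c u k • fderiv ℝ (f k) u v) + (frameMap fun k => f k u) (fderiv ℝ c u v) := by
      have h1 := ((hTu.differentiableAt (by simp)).hasFDerivAt.clm_apply
        (hcu.differentiableAt (by simp)).hasFDerivAt).congr_of_eventuallyEq (f₁ := g) hgTu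
      rw [h1.fderiv, ← fderiv_frameMap_apply (fun k => (hfu k).differentiableAt (by simp)) _ _
        (hTu.differentiableAt (by simp))]
      simp [add_comm]
    have hg1 : fderiv ℝ g u v = ∑ l, θ v l • fderiv ℝ g u (X l u) :=
      cr_linear_expansion (fderiv ℝ j u : F →ₗ[ℝ] E) (fderiv ℝ g u : F →ₗ[ℝ] E)
        hcrgu (fun l => X l u) (θ v) v (hexp v)
    have hf1 : ∀ k v, fderiv ℝ (f k) u v = ∑ l, θ v l • fderiv ℝ (f k) u (X l u) := fun k v =>
      cr_linear_expansion (fderiv ℝ j u : F →ₗ[ℝ] E) (fderiv ℝ (f k) u : F →ₗ[ℝ] E)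
        (hcru k) (fun l => X l u) (θ v) v (hexp v)
    -- Expand `v` along the frame, replace `dg(X_l)` by `df_l(Y)`, expand `Y = ∑ c_k X_k`, and
    -- exchange `k` and `l` by commutation of the frame. The Leibniz rule for `g = ∑ c_k f_k` then
    -- leaves `∑ dc_k(v) f_k = 0`.
    have hg2 : fderiv ℝ g u v = ∑ k, c u k • fderiv ℝ (f k) u v := by
      rw [hg1]
      simp only [← hcommu, hf1 _ (Y u), hf1 _ v, Finset.smul_sum, smul_smul]
      rw [Finset.sum_comm]
      refine Finset.sum_congr rfl fun k _ => Finset.sum_congr rfl fun l _ => ?_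
      rw [hcommXu, mul_comm]
    rw [hg2, left_eq_add] at hprod
    exact frameMap_injective hjφu.1 (hprod.trans (map_zero _).symm)
  obtain ⟨ε, hε, hball⟩ := Metric.eventually_nhds_iff_ball.1 hzero
  refine ⟨c x₀, ?_⟩
  filter_upwards [Metric.ball_mem_nhds x₀ hε] with u hu
  refine (convex_ball x₀ ε).is_const_of_fderivWithin_eq_zero (𝕜 := ℝ)
    (fun y hy => (hball y hy).1.differentiableWithinAt) (fun y hy => ?_) hu
    (Metric.mem_ball_self hε)
  rw [fderivWithin_of_isOpen Metric.isOpen_ball hy, (hball y hy).2]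

end Straightening

/-! ### From CR flows to CR velocity fields. -/

section Flow
variable {F : Type*} [NormedAddCommGroup F] [NormedSpace ℝ F]
  {E : Type*} [NormedAddCommGroup E] [NormedSpace ℂ E]

/-- If the maps `H t` all respect the partial complex structure induced by `j`, then so does
their initial velocity. -/
theorem cr_of_flow {j : F → E} {H : ℝ × F → E} {f : F → E} {u : F}
    (hH : ContDiffAt ℝ ω H (0, u))
    (hf : ∀ᶠ y in 𝓝 u, HasDerivAt (fun t => H (t, y)) (f y) 0)
    (hcr : ∀ᶠ t in 𝓝 (0 : ℝ), ∀ v w, fderiv ℝ j u w = Complex.I • fderiv ℝ j u v →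
      fderiv ℝ (fun y => H (t, y)) u w = Complex.I • fderiv ℝ (fun y => H (t, y)) u v)
    (v w : F) (hvw : fderiv ℝ j u w = Complex.I • fderiv ℝ j u v) :
    fderiv ℝ f u w = Complex.I • fderiv ℝ f u v := by
  have hD : DifferentiableAt ℝ (fderiv ℝ H) (0, u) :=
    (hH.fderiv_right (m := ω) le_rfl).differentiableAt (by simp)
  have hHd : ∀ᶠ q in 𝓝 ((0 : ℝ), u), DifferentiableAt ℝ H q :=
    (hH.eventually (by simp)).mono fun q hq => hq.differentiableAt (by simp)
  have hf' : f =ᶠ[𝓝 u] fun y => fderiv ℝ H (0, y) (1, 0) := by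
    have h0 : Tendsto (fun y : F => ((0 : ℝ), y)) (𝓝 u) (𝓝 (0, u)) :=
      (Continuous.prodMk_right (0 : ℝ)).tendsto u
    filter_upwards [hf, h0.eventually hHd] with y h1 h2
    refine h1.unique ?_
    exact h2.hasFDerivAt.comp_hasDerivAt (0 : ℝ) ((hasDerivAt_id (0 : ℝ)).prodMk
      (hasDerivAt_const (0 : ℝ) y))
  -- Mixed partial derivatives commute: the space derivative of the velocity is the time derivative
  -- of the space derivative. A relation valid for all small `t` can then be differentiated at `t =
  -- 0`.
  have key : ∀ v, HasDerivAt (fun t => fderiv ℝ (fun y => H (t, y)) u v) (fderiv ℝ f u v) 0 := by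
    intro v
    have h1 : HasFDerivAt (fun y : F => fderiv ℝ H (0, y) (1, 0))
        ((ContinuousLinearMap.apply ℝ E ((1 : ℝ), (0 : F))).comp
          ((fderiv ℝ (fderiv ℝ H) (0, u)).comp (ContinuousLinearMap.inr ℝ ℝ F))) u :=
      (ContinuousLinearMap.apply ℝ E ((1 : ℝ), (0 : F))).hasFDerivAt.comp u
        (hD.hasFDerivAt.comp u (hasFDerivAt_prodMk_right (0 : ℝ) u))
    rw [hf'.fderiv_eq, h1.fderiv]
    have h2 : HasDerivAt (fun t : ℝ => fderiv ℝ H (t, u) (0, v))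
        (fderiv ℝ (fderiv ℝ H) (0, u) (1, 0) (0, v)) 0 := by
      have := hD.hasFDerivAt.comp_hasDerivAt (0 : ℝ) ((hasDerivAt_id (0 : ℝ)).prodMk
        (hasDerivAt_const (0 : ℝ) u))
      exact (ContinuousLinearMap.apply ℝ E ((0 : ℝ), v)).hasFDerivAt.comp_hasDerivAt (0 : ℝ) this
    have h3 : fderiv ℝ (fderiv ℝ H) (0, u) (1, 0) (0, v) =
        fderiv ℝ (fderiv ℝ H) (0, u) (0, v) (1, 0) :=
      hH.isSymmSndFDerivAt_of_omega _ _
    rw [h3] at h2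
    refine h2.congr_of_eventuallyEq ?_
    have h0 : Tendsto (fun t : ℝ => (t, u)) (𝓝 0) (𝓝 ((0 : ℝ), u)) :=
      (Continuous.prodMk_left u).tendsto 0
    filter_upwards [h0.eventually hHd] with t ht
    have h4 : HasFDerivAt (fun y => H (t, y)) _ u :=
      ht.hasFDerivAt.comp u (hasFDerivAt_prodMk_right t u)
    rw [h4.fderiv]
    rfl
  refine ((key w).unique (((key v).const_smul Complex.I).congr_of_eventuallyEq ?_))
  filter_upwards [hcr] with t ht using ht v w hvw

end Flow

/-! ### Level sets of submersions. -/

section Submersion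
variable {F : Type*} [NormedAddCommGroup F] [NormedSpace ℝ F] [FiniteDimensional ℝ F]
  {V : Type*} [NormedAddCommGroup V] [NormedSpace ℝ V] [FiniteDimensional ℝ V]

/-- A submersion is linearized by a local analytic diffeomorphism. -/
theorem exists_linearization {h : F → V} {x : F} (hh : ContDiffAt ℝ ω h x)
    (hsurj : Function.Surjective (fderiv ℝ h x)) :
    ∃ e : OpenPartialHomeomorph F F, x ∈ e.source ∧ ContDiffOn ℝ ω e e.source ∧
      ContDiffOn ℝ ω e.symm e.target ∧ ∀ u ∈ e.source, h u = h x ↔ e u ∈ (fderiv ℝ h x).ker := by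
  set A := fderiv ℝ h x with hA
  obtain ⟨s, hs⟩ := A.exists_rightInverse_of_surjective (LinearMap.range_eq_top.2 hsurj)
  have hs' : ∀ v, A (s v) = v := fun v => congrArg (fun B : V →L[ℝ] V => B v) hs
  -- The nonlinear part of `h` is added through the right inverse `s` of `A`. Thus `G` has
  -- derivative the identity at `x`, while `A (G u) = h u - h x` holds exactly.
  set G : F → F := fun u => (u - x) + s (h u - h x - A (u - x)) with hG
  have hGd : ContDiffAt ℝ ω G x := by
    refine (contDiffAt_id.sub contDiffAt_const).add (s.contDiff.contDiffAt.comp x ?_)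
    exact (hh.sub contDiffAt_const).sub
      (A.contDiff.contDiffAt.comp x (contDiffAt_id.sub contDiffAt_const))
  have hGf : HasFDerivAt G (ContinuousLinearEquiv.refl ℝ F : F →L[ℝ] F) x := by
    have h1 : HasFDerivAt (fun u => u - x) (ContinuousLinearMap.id ℝ F) x :=
      (hasFDerivAt_id x).sub_const x
    have h2 := h1.add (s.hasFDerivAt.comp x
      (((hh.differentiableAt (by simp)).hasFDerivAt.sub_const (h x)).sub
        (A.hasFDerivAt.comp x h1)))
    refine h2.congr_fderiv ?_
    ext v
    simp [hA]
  have hAG : ∀ u, A (G u) = h u - h x := fun u => by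
    simp [hG, hs']
  let e := hGd.toOpenPartialHomeomorph G hGf (by simp)
  -- The inverse must be analytic on the whole target, so the source is shrunk to points where the
  -- derivative of `G` is invertible.
  have hev : ∀ᶠ u in 𝓝 x, ContDiffAt ℝ ω G u ∧ (fderiv ℝ G u).IsInvertible := by
    refine (hGd.eventually (by simp)).and ?_
    have h0 : range ((↑) : (F ≃L[ℝ] F) → F →L[ℝ] F) ∈ 𝓝 (fderiv ℝ G x) := by
      rw [hGf.fderiv]; exact ContinuousLinearEquiv.nhds _
    exact (hGd.fderiv_right (m := ω) le_rfl).continuousAt.eventually h0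
  obtain ⟨O, hO, hOo, hxO⟩ := eventually_nhds_iff.1 hev
  refine ⟨e.restrOpen O hOo, ⟨hGd.mem_toOpenPartialHomeomorph_source hGf (by simp), hxO⟩,
    fun u hu => ?_, fun y hy => ?_, fun u _ => ?_⟩
  · exact (hO u hu.2).1.contDiffWithinAt
  · have hy1 : e.symm y ∈ e.source ∩ O := (e.restrOpen O hOo).map_target hy
    have hy2 := hy1.2
    have hye : e (e.symm y) = y := (e.restrOpen O hOo).right_inv hy
    have hy3 : y ∈ e.target := hye ▸ e.map_source hy1.1
    obtain ⟨B, hB⟩ := (hO _ hy2).2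
    refine ContDiffAt.contDiffWithinAt (e.contDiffAt_symm (f₀' := B) hy3 ?_ (hO _ hy2).1)
    rw [hB]
    exact ((hO _ hy2).1.differentiableAt (by simp)).hasFDerivAt
  · change _ ↔ A (G u) = 0
    rw [hAG, sub_eq_zero]

end Submersion

/-! ### Real matrices from complex ones. -/

section RealForm

/-- A complex matrix `P` can be replaced by a real one of the form `Re P + s Im P`. -/
theorem exists_real_invertible {n : ℕ} (P : Matrix (Fin n) (Fin n) ℂ) (hP : IsUnit P) :
    ∃ s : ℝ, IsUnit (P.map Complex.re + s • P.map Complex.im) := by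
  -- The polynomial `z ↦ det (Re P + z Im P)` takes the value `det P ≠ 0` at `z = i`, so it is not
  -- identically zero and cannot vanish at every real number.
  let A : Matrix (Fin n) (Fin n) (Polynomial ℂ) :=
    (P.map Complex.re).map (fun x => Polynomial.C (x : ℂ)) +
      (P.map Complex.im).map (fun x => Polynomial.X * Polynomial.C (x : ℂ))
  have heval : ∀ z : ℂ, A.det.eval z = ((P.map fun x => (x.re : ℂ) + z * x.im)).det := fun z => by
    rw [← Polynomial.coe_evalRingHom, RingHom.map_det]
    congr 1
    ext i k
    simp [A, mul_comm z]
  have hne : A.det ≠ 0 := fun h0 => by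
    have h1 := heval Complex.I
    rw [h0, Polynomial.eval_zero] at h1
    refine ((Matrix.isUnit_iff_isUnit_det P).1 hP).ne_zero ?_
    rw [h1]
    congr 1
    ext i k
    change P i k = ((P i k).re : ℂ) + Complex.I * (P i k).im
    rw [mul_comm, Complex.re_add_im]
  obtain ⟨s, hs⟩ : ∃ s : ℝ, A.det.eval (s : ℂ) ≠ 0 := by
    by_contra! hcon
    refine hne (Polynomial.eq_zero_of_infinite_isRoot _
      ((infinite_range_of_injective Complex.ofReal_injective).mono ?_))
    rintro _ ⟨s, rfl⟩
    exact hcon s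
  refine ⟨s, (Matrix.isUnit_iff_isUnit_det _).2 (isUnit_iff_ne_zero.2 fun h0 => hs ?_)⟩
  rw [heval]
  have h1 := congrArg Complex.ofRealHom h0
  rw [RingHom.map_det, map_zero] at h1
  rw [← h1]
  congr 1
  ext i k
  simp

end RealForm

/-! ### Real and imaginary parts on `ℂ^n`. -/

section Components

/-- The componentwise real part on `ℂ^n`. -/
def rePi (n : ℕ) : (Fin n → ℂ) →L[ℝ] (Fin n → ℝ) :=
  ContinuousLinearMap.pi fun k => Complex.reCLM.comp (ContinuousLinearMap.proj k)

/-- The componentwise imaginary part on `ℂ^n`. -/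
def imPi (n : ℕ) : (Fin n → ℂ) →L[ℝ] (Fin n → ℝ) :=
  ContinuousLinearMap.pi fun k => Complex.imCLM.comp (ContinuousLinearMap.proj k)

/-- The inclusion of `ℝ^n` in `ℂ^n`. -/
def ofRealPi (n : ℕ) : (Fin n → ℝ) →L[ℝ] (Fin n → ℂ) :=
  ContinuousLinearMap.pi fun k => Complex.ofRealCLM.comp (ContinuousLinearMap.proj k)

variable {n : ℕ}

@[simp] theorem rePi_apply (z : Fin n → ℂ) (k : Fin n) : rePi n z k = (z k).re := rfl
@[simp] theorem imPi_apply (z : Fin n → ℂ) (k : Fin n) : imPi n z k = (z k).im := rfl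
@[simp] theorem ofRealPi_apply (v : Fin n → ℝ) (k : Fin n) : ofRealPi n v k = (v k : ℂ) := rfl

@[simp] theorem rePi_ofRealPi (v : Fin n → ℝ) : rePi n (ofRealPi n v) = v := by ext; simp
@[simp] theorem imPi_ofRealPi (v : Fin n → ℝ) : imPi n (ofRealPi n v) = 0 := by ext; simp
@[simp] theorem rePi_I_smul (z : Fin n → ℂ) : rePi n (Complex.I • z) = -imPi n z := by ext; simp
@[simp] theorem imPi_I_smul (z : Fin n → ℂ) : imPi n (Complex.I • z) = rePi n z := by ext; simp

theorem re_add_I_im (z : Fin n → ℂ) :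
    ofRealPi n (rePi n z) + Complex.I • ofRealPi n (imPi n z) = z := by
  ext k
  simp only [Pi.add_apply, Pi.smul_apply, ofRealPi_apply, rePi_apply, imPi_apply, smul_eq_mul]
  rw [mul_comm, Complex.re_add_im]

theorem ext_re_im {z w : Fin n → ℂ} (h1 : rePi n z = rePi n w) (h2 : imPi n z = imPi n w) :
    z = w := by
  rw [← re_add_I_im z, ← re_add_I_im w, h1, h2]

theorem mem_tube_iff {B : Set (Fin n → ℝ)} {z : Fin n → ℂ} : z ∈ tube B ↔ imPi n z ∈ B := Iff.rfl

end Components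

/-! ### Graphs as analytic submanifolds. -/

section Graph
variable {n : ℕ}

/-- The graph-like set `η(ball)` over a ball in `W`, where `η` is a section of a projection onto
`W`, is a real-analytic submanifold. -/
theorem isAnalyticSubmanifoldAt_image {W : Submodule ℝ (Fin n → ℝ)} (π : (Fin n → ℝ) →L[ℝ] W)
    (hπ : ∀ w : W, π w = w) {O : Set W} (hO : IsOpen O) {η : W → Fin n → ℝ}
    (hη : ContDiffOn ℝ ω η O) (hπη : ∀ w ∈ O, π (η w) = w) {y : Fin n → ℝ} (hy : y ∈ η '' O) :
    IsAnalyticSubmanifoldAt (Fin n → ℝ) (η '' O) (Module.finrank ℝ W) y := by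
  have hO' : IsOpen (π ⁻¹' O) := hO.preimage π.continuous
  have hηπ : ContDiffOn ℝ ω (fun y => η (π y)) (π ⁻¹' O) :=
    hη.comp π.contDiff.contDiffOn fun y hy => hy
  have hπ1 : ContDiff ℝ ω (fun y : Fin n → ℝ => ((π y : W) : Fin n → ℝ)) :=
    (W.subtypeL.comp π).contDiff
  have hf : ContDiffOn ℝ ω (fun y : Fin n → ℝ => y - η (π y) + (π y : Fin n → ℝ)) (π ⁻¹' O) :=
    (contDiffOn_id.sub hηπ).add hπ1.contDiffOn
  have hg : ContDiffOn ℝ ω (fun y : Fin n → ℝ => y - (π y : Fin n → ℝ) + η (π y)) (π ⁻¹' O) :=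
    (contDiffOn_id.sub hπ1.contDiffOn).add hηπ
  have hπf : ∀ y ∈ π ⁻¹' O, π (y - η (π y) + (π y : Fin n → ℝ)) = π y := fun y hy => by
    rw [map_add, map_sub, hπη _ hy, hπ, sub_self, zero_add]
  have hπg : ∀ y ∈ π ⁻¹' O, π (y - (π y : Fin n → ℝ) + η (π y)) = π y := fun y hy => by
    rw [map_add, map_sub, hπη _ hy, hπ, sub_self, zero_add]
  -- A shear along the fibres of `π` taking `η w` to `w`. It preserves `π`, so it maps the preimage
  -- of `O` to itself and its inverse is the opposite shear.
  let e : OpenPartialHomeomorph (Fin n → ℝ) (Fin n → ℝ) :=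
    { toFun := fun y => y - η (π y) + (π y : Fin n → ℝ)
      invFun := fun y => y - (π y : Fin n → ℝ) + η (π y)
      source := π ⁻¹' O
      target := π ⁻¹' O
      map_source' := fun y hy => by
        change π _ ∈ O
        rw [hπf y hy]; exact hy
      map_target' := fun y hy => by
        change π _ ∈ O
        rw [hπg y hy]; exact hy
      left_inv' := fun y hy => by
        rw [hπf y hy]; abel
      right_inv' := fun y hy => by
        rw [hπg y hy]; abel
      open_source := hO'
      open_target := hO'
      continuousOn_toFun := hf.continuousOn
      continuousOn_invFun := hg.continuousOn }
  refine ⟨hy, e, ?_, ?_, W, rfl, fun p hp => ?_⟩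
  · exact e.mem_maximalAtlas_of_contMDiffOn (contMDiffOn_iff_contDiffOn.2 hf)
      (contMDiffOn_iff_contDiffOn.2 hg)
  · obtain ⟨w, hw, rfl⟩ := hy
    change π (η w) ∈ O
    rwa [hπη w hw]
  · change _ ↔ p - η (π p) + (π p : Fin n → ℝ) ∈ W
    constructor
    · rintro ⟨w, hw, rfl⟩
      rw [hπη w hw, sub_self, zero_add]
      exact w.2
    · intro h
      have h1 : p - η (π p) ∈ W := by
        simpa using W.sub_mem h (π p).2
      have h2 := hπ ⟨_, h1⟩
      simp only [map_sub, hπη _ hp, sub_self] at h2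
      have h3 := congrArg Subtype.val h2
      exact ⟨π p, hp, (sub_eq_zero.1 h3.symm).symm⟩

end Graph

/-! ### Immersions tangent to real translations are tubes. -/

section NormalForm
variable {F : Type*} [NormedAddCommGroup F] [NormedSpace ℝ F] [FiniteDimensional ℝ F] {n : ℕ}

/-- An immersion into `ℂ^n` whose image is tangent to all real translations is locally an
isomorphism onto a tube. -/
theorem exists_tube_of_immersion {φ : F → Fin n → ℂ} {X : Fin n → F → F} {x₀ : F}
    (hφ : ContDiffAt ℝ ω φ x₀) (hinj : Function.Injective (fderiv ℝ φ x₀))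
    (hX : ∀ᶠ u in 𝓝 x₀, ∀ k, fderiv ℝ φ u (X k u) = Pi.single k 1) :
    ∃ (B : Set (Fin n → ℝ)) (ψ : (Fin n → ℂ) → F), IsConnected B ∧
      (∃ d, ∀ y ∈ B, IsAnalyticSubmanifoldAt (Fin n → ℝ) B d y) ∧
      (∀ᶠ u in 𝓝 x₀, φ u ∈ tube B) ∧ ContDiffAt ℝ ω ψ (φ x₀) ∧
      (∀ᶠ u in 𝓝 x₀, ψ (φ u) = u) ∧ ∀ᶠ z in 𝓝[tube B] (φ x₀), φ (ψ z) = z := by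
  set D := fderiv ℝ φ x₀ with hD
  set W : Submodule ℝ (Fin n → ℝ) := LinearMap.range ((imPi n).comp D : F →ₗ[ℝ] Fin n → ℝ) with hW
  obtain ⟨π', hπ'⟩ := W.subtype.exists_leftInverse_of_injective
    (LinearMap.ker_eq_bot.2 W.injective_subtype)
  set π : (Fin n → ℝ) →L[ℝ] W := LinearMap.toContinuousLinearMap π' with hπdef
  have hπ : ∀ w : W, π w = w := fun w => congrArg (fun A : W →ₗ[ℝ] W => A w) hπ'
  -- Coordinates on the image: the full real part, and the imaginary part projected to the space `W`
  -- of imaginary parts of tangent vectors. Since the range of `D` contains all real vectors, it is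
  -- mapped isomorphically.
  let S : (Fin n → ℂ) →L[ℝ] (Fin n → ℝ) × W := (rePi n).prod (π.comp (imPi n))
  have hsum : ∀ (u : F) (hu : ∀ k, fderiv ℝ φ u (X k u) = Pi.single k 1) (α : Fin n → ℝ),
      fderiv ℝ φ u (∑ k, α k • X k u) = ofRealPi n α := fun u hu α => by
    rw [map_sum]
    simp only [map_smul, hu]
    ext k
    simp [Finset.sum_apply, Pi.single_apply]
  have hbij : Function.Bijective (S.comp D) := by
    constructor
    · refine (injective_iff_map_eq_zero _).2 fun v hv => ?_
      have h1 : rePi n (D v) = 0 := congrArg Prod.fst hv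
      have h2 : π (imPi n (D v)) = 0 := congrArg Prod.snd hv
      have h3 := hπ ⟨imPi n (D v), ⟨v, rfl⟩⟩
      rw [h2] at h3
      have h4 : imPi n (D v) = 0 := (congrArg Subtype.val h3).symm
      exact hinj ((ext_re_im (by rw [h1, map_zero]) (by rw [h4, map_zero])).trans
        (map_zero D).symm)
    · rintro ⟨α, w⟩
      obtain ⟨v, hv⟩ := w.2
      have hv' : imPi n (D v) = w := hv
      refine ⟨v + ∑ k, (α - rePi n (D v)) k • X k x₀, ?_⟩
      rw [ContinuousLinearMap.comp_apply, map_add, hsum x₀ hX.self_of_nhds]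
      refine Prod.ext ?_ ?_
      · change rePi n _ = α
        simp
      · change π (imPi n _) = w
        rw [map_add, imPi_ofRealPi, add_zero, hv', hπ]
  let eq : F ≃L[ℝ] (Fin n → ℝ) × W :=
    (LinearEquiv.ofBijective (S.comp D : F →ₗ[ℝ] (Fin n → ℝ) × W) hbij).toContinuousLinearEquiv
  set G : F → (Fin n → ℝ) × W := fun u => S (φ u) with hG
  have hGd : ContDiffAt ℝ ω G x₀ := S.contDiff.contDiffAt.comp x₀ hφ
  have hGf : HasFDerivAt G (eq : F →L[ℝ] (Fin n → ℝ) × W) x₀ :=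
    S.hasFDerivAt.comp x₀ (hφ.differentiableAt (by simp)).hasFDerivAt
  let e := hGd.toOpenPartialHomeomorph G hGf (by simp)
  set K : (Fin n → ℝ) × W → F := ⇑e.symm with hK
  have hx₀ : x₀ ∈ e.source := hGd.mem_toOpenPartialHomeomorph_source hGf (by simp)
  have hKG : ∀ᶠ u in 𝓝 x₀, K (G u) = u := e.eventually_left_inverse hx₀
  have hGK : ∀ᶠ q in 𝓝 (G x₀), G (K q) = q := e.eventually_right_inverse (e.map_source hx₀)
  have hKd : ContDiffAt ℝ ω K (G x₀) :=
    e.contDiffAt_symm (f₀' := eq) (e.map_source hx₀)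
      (by rw [show e.symm (G x₀) = x₀ from e.left_inv hx₀]; exact hGf)
      (by rw [show e.symm (G x₀) = x₀ from e.left_inv hx₀]; exact hGd)
  have hK0 : K (G x₀) = x₀ := e.left_inv hx₀
  have hKt : Tendsto K (𝓝 (G x₀)) (𝓝 x₀) := by
    have := hKd.continuousAt.tendsto
    rwa [hK0] at this
  set Y : (Fin n → ℝ) × W → Fin n → ℝ := fun q => imPi n (φ (K q)) with hY
  -- In these coordinates a displacement by `(α, 0)` is a displacement along `∑ α_k X_k`, which `φ`
  -- maps to a real vector. So the imaginary part `Y` has no derivative in the real coordinate.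
  have hall : ∀ᶠ q in 𝓝 (G x₀), G (K q) = q ∧ ContDiffAt ℝ ω Y q ∧
      ∀ α, fderiv ℝ Y q (α, 0) = 0 := by
    filter_upwards [hGK, hKt.eventually (hφ.eventually (by simp)), hKd.eventually (by simp),
      hKt.eventually hX, hKt.eventually hKG.eventually_nhds,
      hKt.eventually (hGd.eventually (by simp))] with q h1 h2 h3 h4 h5 h6
    refine ⟨h1, (imPi n).contDiff.contDiffAt.comp q (h2.comp q h3), fun α => ?_⟩
    have hKd' : HasFDerivAt K (fderiv ℝ K q) (G (K q)) := by
      rw [h1]; exact (h3.differentiableAt (by simp)).hasFDerivAt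
    have e1 := (hKd'.comp (K q) (h6.differentiableAt (by simp)).hasFDerivAt).congr_of_eventuallyEq
      (f₁ := id) (h5.mono fun y hy => hy.symm)
    have e2 := e1.unique (hasFDerivAt_id (K q))
    have e3 : fderiv ℝ G (K q) = S.comp (fderiv ℝ φ (K q)) :=
      (S.hasFDerivAt.comp (K q) (h2.differentiableAt (by simp)).hasFDerivAt).fderiv
    have e4 : fderiv ℝ G (K q) (∑ k, α k • X k (K q)) = (α, 0) := by
      rw [e3, ContinuousLinearMap.comp_apply, hsum _ h4]
      refine Prod.ext ?_ ?_
      · change rePi n _ = α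
        simp
      · change π (imPi n _) = 0
        simp
    have e5 : fderiv ℝ K q (α, 0) = ∑ k, α k • X k (K q) := by
      rw [← e4, ← ContinuousLinearMap.comp_apply, e2]
      rfl
    have e6 : HasFDerivAt Y ((imPi n).comp ((fderiv ℝ φ (K q)).comp (fderiv ℝ K q))) q :=
      (imPi n).hasFDerivAt.comp q ((h2.differentiableAt (by simp)).hasFDerivAt.comp q
        (h3.differentiableAt (by simp)).hasFDerivAt)
    rw [e6.fderiv, ContinuousLinearMap.comp_apply, ContinuousLinearMap.comp_apply, e5, hsum _ h4,
      imPi_ofRealPi]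
  obtain ⟨ε, hε, hball⟩ := Metric.eventually_nhds_iff_ball.1 hall
  set p₀ := (G x₀).1 with hp₀
  set w₀ := (G x₀).2 with hw₀
  have hmem : ∀ {p w}, p ∈ Metric.ball p₀ ε → w ∈ Metric.ball w₀ ε →
      (p, w) ∈ Metric.ball (G x₀) ε := fun {p w} hp hw => by
    have : (p, w) ∈ Metric.ball p₀ ε ×ˢ Metric.ball w₀ ε := ⟨hp, hw⟩
    rwa [ball_prod_same] at this
  have hp₀m : p₀ ∈ Metric.ball p₀ ε := Metric.mem_ball_self hε
  -- `Y` depends on `w` alone over a ball, hence the base of the tube is parametrized by this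
  -- section of `π`.
  set η : W → Fin n → ℝ := fun w => Y (p₀, w) with hη
  have hYη : ∀ p ∈ Metric.ball p₀ ε, ∀ w ∈ Metric.ball w₀ ε, Y (p, w) = η w := by
    intro p hp w hw
    have hder : ∀ p ∈ Metric.ball p₀ ε, HasFDerivAt (fun p => Y (p, w))
        (0 : (Fin n → ℝ) →L[ℝ] Fin n → ℝ) p := fun p hp => by
      obtain ⟨-, h2, h3⟩ := hball _ (hmem hp hw)
      refine (HasFDerivAt.comp (g := Y) p (h2.differentiableAt (by simp)).hasFDerivAt
        (hasFDerivAt_prodMk_left p w)).congr_fderiv ?_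
      ext1 α
      exact h3 α
    exact (convex_ball p₀ ε).is_const_of_fderivWithin_eq_zero (𝕜 := ℝ)
      (fun y hy => (hder y hy).differentiableAt.differentiableWithinAt)
      (fun y hy => by rw [fderivWithin_of_isOpen Metric.isOpen_ball hy, (hder y hy).fderiv])
      hp hp₀m
  have hφK : ∀ p ∈ Metric.ball p₀ ε, ∀ w ∈ Metric.ball w₀ ε,
      rePi n (φ (K (p, w))) = p ∧ imPi n (φ (K (p, w))) = η w ∧ π (η w) = w := by
    intro p hp w hw
    have h1 := (hball _ (hmem hp hw)).1
    refine ⟨congrArg Prod.fst h1, hYη p hp w hw, ?_⟩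
    rw [← hYη p hp w hw]
    exact congrArg Prod.snd h1
  have hηd : ContDiffOn ℝ ω η (Metric.ball w₀ ε) := fun w hw =>
    (((hball _ (hmem hp₀m hw)).2.1).comp w
      (contDiffAt_const.prodMk contDiffAt_id)).contDiffWithinAt
  have hGS : ContinuousAt S (φ x₀) := S.continuous.continuousAt
  have hSnear : ∀ᶠ z in 𝓝 (φ x₀), S z ∈ Metric.ball (G x₀) ε :=
    hGS.eventually (Metric.ball_mem_nhds _ hε)
  have hsplit : ∀ {q}, q ∈ Metric.ball (G x₀) ε → q.1 ∈ Metric.ball p₀ ε ∧ q.2 ∈ Metric.ball w₀ ε :=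
    fun {q} hq => by
      rw [← ball_prod_same] at hq
      exact hq
  refine ⟨η '' Metric.ball w₀ ε, fun z => K (S z), ?_, ⟨Module.finrank ℝ W, fun y hy => ?_⟩,
    ?_, hKd.comp (φ x₀) S.contDiff.contDiffAt, hKG, ?_⟩
  · exact ((convex_ball w₀ ε).isConnected (Metric.nonempty_ball.2 hε)).image η hηd.continuousOn
  · exact isAnalyticSubmanifoldAt_image π hπ Metric.isOpen_ball hηd
      (fun w hw => (hφK p₀ hp₀m w hw).2.2) hy
  · filter_upwards [hKG, hφ.continuousAt.eventually hSnear] with u h1 h2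
    obtain ⟨h3, h4⟩ := hsplit h2
    refine mem_tube_iff.2 ⟨(S (φ u)).2, h4, ?_⟩
    have := (hφK _ h3 _ h4).2.1
    rw [← this]
    change imPi n (φ (K (G u))) = _
    rw [h1]
  · filter_upwards [self_mem_nhdsWithin, nhdsWithin_le_nhds hSnear] with z hz h2
    obtain ⟨h3, h4⟩ := hsplit h2
    obtain ⟨w, hw, hwz⟩ := mem_tube_iff.1 hz
    have h5 : (S z).2 = w := by
      change π (imPi n z) = w
      rw [← hwz, (hφK p₀ hp₀m w hw).2.2]
    obtain ⟨h6, h7, -⟩ := hφK _ h3 _ h4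
    refine ext_re_im h6 (h7.trans ?_)
    rw [h5, hwz]

end NormalForm

/-! ### Differentials of vector-valued maps on `M`. -/

section Manifold
variable {F : Type*} [NormedAddCommGroup F] [NormedSpace ℝ F]
  {M : Type*} [TopologicalSpace M] [ChartedSpace F M]
  {V : Type*} [NormedAddCommGroup V] [NormedSpace ℂ V]

theorem eventually_mdifferentiableAt [IsManifold 𝓘(ℝ, F) ω M]
    {G : Type*} [NormedAddCommGroup G] [NormedSpace ℝ G]
    {N : Type*} [TopologicalSpace N] [ChartedSpace G N] [IsManifold 𝓘(ℝ, G) ω N]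
    {f : M → N} {a : M} (hf : ContMDiffAt 𝓘(ℝ, F) 𝓘(ℝ, G) ω f a) :
    ∀ᶠ p in 𝓝 a, MDifferentiableAt 𝓘(ℝ, F) 𝓘(ℝ, G) f p :=
  ((contMDiffAt_iff_contMDiffAt_nhds (by simp)).1 hf).mono fun _ hp =>
    hp.mdifferentiableAt (by simp)

theorem dEmb_comp {f : M → V} {g : M → M} {p : M}
    (hf : MDifferentiableAt 𝓘(ℝ, F) 𝓘(ℝ, V) f (g p))
    (hg : MDifferentiableAt 𝓘(ℝ, F) 𝓘(ℝ, F) g p) (u : TangentSpace 𝓘(ℝ, F) p) :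
    dEmb V F (f ∘ g) p u = dEmb V F f (g p) (mfderiv 𝓘(ℝ, F) 𝓘(ℝ, F) g p u) :=
  mfderiv_comp_apply p hf hg u

theorem dEmb_comp_left {V' : Type*} [NormedAddCommGroup V'] [NormedSpace ℂ V'] {S : V → V'}
    {f : M → V} {p : M} (hS : DifferentiableAt ℝ S (f p))
    (hf : MDifferentiableAt 𝓘(ℝ, F) 𝓘(ℝ, V) f p) (u : TangentSpace 𝓘(ℝ, F) p) :
    dEmb V' F (S ∘ f) p u = fderiv ℝ S (f p) (dEmb V F f p u) := by
  have := mfderiv_comp_apply p hS.mdifferentiableAt hf u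
  rw [mfderiv_eq_fderiv] at this
  exact this

theorem dEmb_congr {f f' : M → V} {p : M} (h : f =ᶠ[𝓝 p] f') (u : TangentSpace 𝓘(ℝ, F) p) :
    dEmb V F f p u = dEmb V F f' p u := by
  have h1 : (mfderiv 𝓘(ℝ, F) 𝓘(ℝ, V) f p : F →L[ℝ] V) = mfderiv 𝓘(ℝ, F) 𝓘(ℝ, V) f' p :=
    h.mfderiv_eq
  exact congrArg (fun A : F →L[ℝ] V => A u) h1

theorem eventually_eq_of_dEmb_eq_zero [IsManifold 𝓘(ℝ, F) ω M] {f : M → V} {a : M}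
    (hf : ∀ᶠ p in 𝓝 a, MDifferentiableAt 𝓘(ℝ, F) 𝓘(ℝ, V) f p ∧ ∀ u, dEmb V F f p u = 0) :
    ∀ᶠ p in 𝓝 a, f p = f a := by
  set κ := extChartAt 𝓘(ℝ, F) a with hκ
  have hx : κ a ∈ κ.target := mem_extChartAt_target a
  have hto : Tendsto κ.symm (𝓝 (κ a)) (𝓝 a) := by
    have := continuousAt_extChartAt_symm (I := 𝓘(ℝ, F)) a
    simpa [ContinuousAt, hκ] using this
  have hder : ∀ᶠ x in 𝓝 (κ a), HasFDerivAt (f ∘ κ.symm) (0 : F →L[ℝ] V) x := by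
    filter_upwards [hto.eventually hf, (isOpen_extChartAt_target a).mem_nhds hx] with x h1 h2
    have h3 : MDifferentiableAt 𝓘(ℝ, F) 𝓘(ℝ, F) κ.symm x :=
      (contMDiffOn_extChartAt_symm (n := ω) a).contMDiffAt
        ((isOpen_extChartAt_target a).mem_nhds h2) |>.mdifferentiableAt (by simp)
    have h4 := h1.1.hasMFDerivAt.comp x h3.hasMFDerivAt
    refine h4.hasFDerivAt.congr_fderiv ?_
    ext1 v
    exact h1.2 _
  obtain ⟨ε, hε, hball⟩ := Metric.eventually_nhds_iff_ball.1 hder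
  filter_upwards [(continuousAt_extChartAt (I := 𝓘(ℝ, F)) a).eventually
    (Metric.ball_mem_nhds _ hε), extChartAt_source_mem_nhds (I := 𝓘(ℝ, F)) a] with p h1 h2
  have := (convex_ball (κ a) ε).is_const_of_fderivWithin_eq_zero (𝕜 := ℝ) (f := f ∘ κ.symm)
      (fun y hy => (hball y hy).differentiableAt.differentiableWithinAt)
      (fun y hy => by rw [fderivWithin_of_isOpen Metric.isOpen_ball hy, (hball y hy).fderiv])
      h1 (Metric.mem_ball_self hε)
  simpa only [Function.comp_apply, hκ, extChartAt_to_inv, (extChartAt 𝓘(ℝ, F) a).left_inv h2]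
    using this

theorem eventually_eq_of_dEmb_eq [IsManifold 𝓘(ℝ, F) ω M] {f f' : M → V} {a : M}
    (hf : ∀ᶠ p in 𝓝 a, MDifferentiableAt 𝓘(ℝ, F) 𝓘(ℝ, V) f p)
    (hf' : ∀ᶠ p in 𝓝 a, MDifferentiableAt 𝓘(ℝ, F) 𝓘(ℝ, V) f' p)
    (h : ∀ᶠ p in 𝓝 a, ∀ u, dEmb V F f p u = dEmb V F f' p u) (ha : f a = f' a) :
    f =ᶠ[𝓝 a] f' := by
  have := eventually_eq_of_dEmb_eq_zero (F := F) (f := fun p => f p - f' p) (a := a) (by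
    filter_upwards [hf, hf', h] with p h1 h2 h3
    have h4 := h1.hasMFDerivAt.sub h2.hasMFDerivAt
    refine ⟨h4.mdifferentiableAt, fun u => ?_⟩
    have h5 : (dEmb V F (fun p => f p - f' p) p : F →L[ℝ] V) = dEmb V F f p - dEmb V F f' p :=
      h4.mfderiv
    refine (congrArg (fun A : F →L[ℝ] V => A u) h5).trans ?_
    exact sub_eq_zero.2 (h3 u))
  filter_upwards [this] with p hp
  rw [ha, sub_self, sub_eq_zero] at hp
  exact hp

end Manifold

/-! ### Tube frames and lifting maps between tubes. -/

section Frame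
variable {E : Type uE} [NormedAddCommGroup E] [NormedSpace ℂ E]
  {Z : Type uZ} [TopologicalSpace Z] [ChartedSpace E Z]
  {F : Type uF} [NormedAddCommGroup F] [NormedSpace ℝ F]
  {M : Type uM} [TopologicalSpace M] [ChartedSpace F M]
  {ι : GenericEmbedding E Z F M} {a : M} {r r' : ℕ}

/-- `φ` is an immersive CR-map at `p` whose image is tangent to all real translations. -/
structure IsTubeFrame (ι : GenericEmbedding E Z F M) (φ : M → Fin r → ℂ) (p : M) : Prop where
  mdiff : MDifferentiableAt 𝓘(ℝ, F) 𝓘(ℝ, Fin r → ℂ) φ p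
  inj : ∀ u v : TangentSpace 𝓘(ℝ, F) p,
    dEmb (Fin r → ℂ) F φ p u = dEmb (Fin r → ℂ) F φ p v → u = v
  exists_real : ∀ v : Fin r → ℝ, ∃ u : TangentSpace 𝓘(ℝ, F) p,
    dEmb (Fin r → ℂ) F φ p u = ofRealPi r v
  cr : ∀ v w : TangentSpace 𝓘(ℝ, F) p,
      IsJ ι p v w ↔ dEmb (Fin r → ℂ) F φ p w = Complex.I • dEmb (Fin r → ℂ) F φ p v

/-- The splitting of a tangent vector along a tube into a real translation and an imaginary part. -/
theorem IsTubeFrame.exists_split {φ : M → Fin r → ℂ} {p : M} (h : IsTubeFrame ι φ p)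
    (u : TangentSpace 𝓘(ℝ, F) p) : ∃ x y k : TangentSpace 𝓘(ℝ, F) p,
      dEmb (Fin r → ℂ) F φ p x = ofRealPi r (rePi r (dEmb (Fin r → ℂ) F φ p u)) ∧
      dEmb (Fin r → ℂ) F φ p y = ofRealPi r (imPi r (dEmb (Fin r → ℂ) F φ p u)) ∧
      u = x + k ∧ IsJ ι p y k := by
  obtain ⟨x, hx⟩ := h.exists_real (rePi r (dEmb (Fin r → ℂ) F φ p u))
  obtain ⟨y, hy⟩ := h.exists_real (imPi r (dEmb (Fin r → ℂ) F φ p u))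
  refine ⟨x, y, u - x, hx, hy, (add_sub_cancel x u).symm, (h.cr y (u - x)).2 ?_⟩
  rw [map_sub, hx, hy, sub_eq_iff_eq_add, add_comm]
  exact (re_add_I_im _).symm

/-- A real linear map compatible with the complex structure on `H_p M` is determined by its values
on real translations. -/
theorem IsTubeFrame.apply_eq {φ : M → Fin r → ℂ} {p : M} (h : IsTubeFrame ι φ p)
    {V : Type*} [AddCommGroup V] [Module ℂ V] (Q : TangentSpace 𝓘(ℝ, F) p →ₗ[ℝ] V)
    (hQ : ∀ v w, IsJ ι p v w → Q w = Complex.I • Q v) (A : (Fin r → ℂ) →ₗ[ℂ] V)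
    (hA : ∀ v u, dEmb (Fin r → ℂ) F φ p u = ofRealPi r v → Q u = A (ofRealPi r v))
    (u : TangentSpace 𝓘(ℝ, F) p) : Q u = A (dEmb (Fin r → ℂ) F φ p u) := by
  obtain ⟨x, y, k, hx, hy, rfl, hyk⟩ := h.exists_split u
  conv_rhs => rw [← re_add_I_im (dEmb (Fin r → ℂ) F φ p (x + k))]
  rw [map_add, map_add, map_smul, hQ y k hyk, hA _ x hx, hA _ y hy]

theorem IsCRIsoOnto.continuousAt {φ : M → Fin r → ℂ} {T : Set (Fin r → ℂ)}
    (H : IsCRIsoOnto ι a φ T) : ContinuousAt φ a :=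
  H.analytic.continuousAt

theorem IsCRIsoOnto.tendsto {φ : M → Fin r → ℂ} {T : Set (Fin r → ℂ)}
    (H : IsCRIsoOnto ι a φ T) : Tendsto φ (𝓝 a) (𝓝[T] (φ a)) :=
  tendsto_nhdsWithin_iff.2 ⟨H.continuousAt, H.mapsTo⟩

/-- Germs of maps into `M` are determined by their composition with a tube realization. -/
theorem IsCRIsoOnto.eventually_eq {φ : M → Fin r → ℂ} {T : Set (Fin r → ℂ)}
    (H : IsCRIsoOnto ι a φ T) {Y : Type*} {l : Filter Y} {f g : Y → M}
    (hf : Tendsto f l (𝓝 a)) (hg : Tendsto g l (𝓝 a))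
    (h : ∀ᶠ y in l, φ (f y) = φ (g y)) : f =ᶠ[l] g := by
  obtain ⟨ψ, -, hψφ, -⟩ := H.inverse
  filter_upwards [hf.eventually hψφ, hg.eventually hψφ, h] with y h1 h2 h3
  rw [← h1, h3, h2]

/-- Maps between tubes lift to maps between their realizations. -/
theorem IsCRIsoOnto.exists_lift {φ : M → Fin r → ℂ} {φ' : M → Fin r' → ℂ}
    {T : Set (Fin r → ℂ)} {T' : Set (Fin r' → ℂ)}
    (H : IsCRIsoOnto ι a φ T) (H' : IsCRIsoOnto ι a φ' T') {S : (Fin r → ℂ) → Fin r' → ℂ}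
    (hS : ContDiffAt ℝ ω S (φ a)) (hSa : S (φ a) = φ' a)
    (hST : ∀ᶠ z in 𝓝[T] (φ a), S z ∈ T') :
    ∃ g : M → M, g a = a ∧ ContMDiffAt 𝓘(ℝ, F) 𝓘(ℝ, F) ω g a ∧
      ∀ᶠ p in 𝓝 a, φ' (g p) = S (φ p) := by
  obtain ⟨ψ, hψ, hψφ, hφψ⟩ := H'.inverse
  refine ⟨fun p => ψ (S (φ p)), ?_, ?_, ?_⟩
  · simp only [hSa]
    exact hψφ.self_of_nhds
  · have h1 : ContMDiffAt 𝓘(ℝ, F) 𝓘(ℝ, Fin r' → ℂ) ω (S ∘ φ) a :=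
      hS.contMDiffAt.comp a H.analytic
    exact ContMDiffAt.comp_of_eq (g := ψ) (f := S ∘ φ) hψ h1 hSa
  · have h1 : Tendsto S (𝓝[T] (φ a)) (𝓝[T'] (φ' a)) := by
      refine tendsto_nhdsWithin_iff.2 ⟨?_, hST⟩
      rw [← hSa]
      exact hS.continuousAt.tendsto.mono_left nhdsWithin_le_nhds
    filter_upwards [(h1.comp H.tendsto).eventually hφψ] with p hp using hp

variable [IsManifold 𝓘(ℝ, F) ω M]

/-- The local vector field that is mapped to a real translation by a tube realization. -/
def translationField (F : Type uF) [NormedAddCommGroup F] [NormedSpace ℝ F] {M : Type uM}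
    [TopologicalSpace M] [ChartedSpace F M] (φ : M → Fin r → ℂ) (ψ : (Fin r → ℂ) → M)
    (v : Fin r → ℝ) (p : M) : F :=
  mfderiv 𝓘(ℝ, Fin r → ℂ) 𝓘(ℝ, F) ψ (φ p) (ofRealPi r v)

theorem tube_add_ofReal {B : Set (Fin r → ℝ)} {z : Fin r → ℂ} (v : Fin r → ℝ) :
    z + ofRealPi r v ∈ tube B ↔ z ∈ tube B := by
  rw [mem_tube_iff, mem_tube_iff, map_add, imPi_ofRealPi, add_zero]

/-- Along a tube, the inverse of a tube realization has the expected derivative in the real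
directions. -/
theorem IsCRIsoOnto.eventually_dEmb_translationField {φ : M → Fin r → ℂ} {B : Set (Fin r → ℝ)}
    (H : IsCRIsoOnto ι a φ (tube B)) {ψ : (Fin r → ℂ) → M}
    (hψ : ContMDiffAt 𝓘(ℝ, Fin r → ℂ) 𝓘(ℝ, F) ω ψ (φ a))
    (hψφ : ∀ᶠ p in 𝓝 a, ψ (φ p) = p) (hφψ : ∀ᶠ z in 𝓝[tube B] (φ a), φ (ψ z) = z) :
    ∀ᶠ p in 𝓝 a, ∀ v : Fin r → ℝ,
      dEmb (Fin r → ℂ) F φ p (translationField F φ ψ v p) = ofRealPi r v := by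
  have hφψ' : ∀ᶠ z in 𝓝 (φ a), ∀ᶠ y in 𝓝 z, y ∈ tube B → φ (ψ y) = y :=
    (eventually_nhdsWithin_iff.1 hφψ).eventually_nhds
  filter_upwards [H.mapsTo, hψφ, eventually_mdifferentiableAt H.analytic,
    H.continuousAt.eventually (eventually_mdifferentiableAt hψ), H.continuousAt.eventually hφψ']
    with p h1 h2 h3 h4 h5 v
  -- `φ ∘ ψ` is known to be the identity on the tube only. The tube contains the real line through
  -- `φ p` in the direction `v`, and the identity is differentiated along that line.
  have hline : HasDerivAt (fun t : ℝ => φ p + t • ofRealPi r v) (ofRealPi r v) 0 := by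
    simpa using ((hasDerivAt_id (0 : ℝ)).smul_const (ofRealPi r v)).const_add (φ p)
  have hψ0 : MDifferentiableAt 𝓘(ℝ, F) 𝓘(ℝ, Fin r → ℂ) φ (ψ (φ p)) := by rw [h2]; exact h3
  have hcomp : HasFDerivAt (fun z => φ (ψ z))
      ((mfderiv 𝓘(ℝ, F) 𝓘(ℝ, Fin r → ℂ) φ (ψ (φ p))).comp
        (mfderiv 𝓘(ℝ, Fin r → ℂ) 𝓘(ℝ, F) ψ (φ p)) : (Fin r → ℂ) →L[ℝ] (Fin r → ℂ)) (φ p) :=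
    (hψ0.hasMFDerivAt.comp (φ p) h4.hasMFDerivAt).hasFDerivAt
  have hc0 : HasDerivAt (fun t : ℝ => φ (ψ (φ p + t • ofRealPi r v))) _ 0 :=
    HasFDerivAt.comp_hasDerivAt_of_eq (l := fun z => φ (ψ z))
      (f := fun t : ℝ => φ p + t • ofRealPi r v) (0 : ℝ) hcomp hline (by simp)
  have heq : (fun t : ℝ => φ (ψ (φ p + t • ofRealPi r v))) =ᶠ[𝓝 0]
      fun t => φ p + t • ofRealPi r v := by
    have ht : Tendsto (fun t : ℝ => φ p + t • ofRealPi r v) (𝓝 0) (𝓝 (φ p)) := by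
      have := hline.continuousAt.tendsto
      simpa using this
    filter_upwards [ht.eventually h5] with t ht
    refine ht ?_
    rw [← map_smul]
    exact (tube_add_ofReal _).2 h1
  have := (hc0.congr_of_eventuallyEq heq.symm).unique hline
  rw [← this]
  change dEmb (Fin r → ℂ) F φ p (translationField F φ ψ v p) =
    dEmb (Fin r → ℂ) F φ (ψ (φ p)) (translationField F φ ψ v p)
  rw [h2]

theorem IsCRIsoOnto.eventually_isTubeFrame {φ : M → Fin r → ℂ} {B : Set (Fin r → ℝ)}
    (H : IsCRIsoOnto ι a φ (tube B)) : ∀ᶠ p in 𝓝 a, IsTubeFrame ι φ p := by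
  obtain ⟨ψ, hψ, hψφ, hφψ⟩ := H.inverse
  filter_upwards [hψφ.eventually_nhds, eventually_mdifferentiableAt H.analytic,
    H.continuousAt.eventually (eventually_mdifferentiableAt hψ), H.cr,
    H.eventually_dEmb_translationField hψ hψφ hφψ] with p h2 h3 h4 h5 h6
  refine ⟨h3, fun u v huv => ?_, fun v => ⟨_, h6 v⟩, h5⟩
  have h7 := (h4.hasMFDerivAt.comp p h3.hasMFDerivAt).congr_of_eventuallyEq
    (f₁ := id) (h2.mono fun y hy => hy.symm)
  have h8 := hasMFDerivAt_unique h7 (hasMFDerivAt_id p)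
  have h9 : ∀ w : F, (mfderiv 𝓘(ℝ, Fin r → ℂ) 𝓘(ℝ, F) ψ (φ p) : (Fin r → ℂ) →L[ℝ] F)
      (dEmb (Fin r → ℂ) F φ p w) = w := fun w =>
    congrArg (fun A : F →L[ℝ] F => A w) h8
  rw [← h9 u, ← h9 v, huv]

end Frame

/-! ### Vector fields and brackets in a chart. -/

section ChartField
variable {F : Type uF} [NormedAddCommGroup F] [NormedSpace ℝ F] 
  {M : Type uM} [TopologicalSpace M] [ChartedSpace F M]

/-- The expression of a vector field in the preferred chart at `a`. -/
def chartField (a : M) (X : ∀ p : M, TangentSpace 𝓘(ℝ, F) p) : F → F :=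
  VectorField.mpullback 𝓘(ℝ, F) 𝓘(ℝ, F) (extChartAt 𝓘(ℝ, F) a).symm X

theorem tendsto_extChartAt_symm (F : Type uF) [NormedAddCommGroup F] [NormedSpace ℝ F]
    {M : Type uM} [TopologicalSpace M] [ChartedSpace F M] (a : M) :
    Tendsto (extChartAt 𝓘(ℝ, F) a).symm (𝓝 (extChartAt 𝓘(ℝ, F) a a)) (𝓝 a) := by
  have := continuousAt_extChartAt_symm (I := 𝓘(ℝ, F)) a
  simpa [ContinuousAt] using this

theorem tendsto_extChartAt (F : Type uF) [NormedAddCommGroup F] [NormedSpace ℝ F]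
    {M : Type uM} [TopologicalSpace M] [ChartedSpace F M] (a : M) :
    Tendsto (extChartAt 𝓘(ℝ, F) a) (𝓝 a) (𝓝 (extChartAt 𝓘(ℝ, F) a a)) :=
  continuousAt_extChartAt (I := 𝓘(ℝ, F)) a

theorem eventually_extChartAt_symm_iff {a : M} {P : M → Prop} :
    (∀ᶠ x in 𝓝 (extChartAt 𝓘(ℝ, F) a a), P ((extChartAt 𝓘(ℝ, F) a).symm x)) ↔
      ∀ᶠ p in 𝓝 a, P p := by
  refine ⟨fun h => ?_, fun h => (tendsto_extChartAt_symm F a).eventually h⟩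
  filter_upwards [(tendsto_extChartAt F a).eventually h,
    extChartAt_source_mem_nhds (I := 𝓘(ℝ, F)) a] with p h1 h2
  rwa [(extChartAt 𝓘(ℝ, F) a).left_inv h2] at h1

theorem eventually_mem_extChartAt_target (F : Type uF) [NormedAddCommGroup F] [NormedSpace ℝ F]
    {M : Type uM} [TopologicalSpace M] [ChartedSpace F M] (a : M) :
    ∀ᶠ x in 𝓝 (extChartAt 𝓘(ℝ, F) a a), x ∈ (extChartAt 𝓘(ℝ, F) a).target :=
  (isOpen_extChartAt_target a).mem_nhds (mem_extChartAt_target a)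

variable [IsManifold 𝓘(ℝ, F) ω M]

theorem contMDiffAt_extChartAt_symm_of_mem {a : M} {x : F}
    (hx : x ∈ (extChartAt 𝓘(ℝ, F) a).target) :
    ContMDiffAt 𝓘(ℝ, F) 𝓘(ℝ, F) ω (extChartAt 𝓘(ℝ, F) a).symm x :=
  (contMDiffOn_extChartAt_symm (n := ω) a).contMDiffAt ((isOpen_extChartAt_target a).mem_nhds hx)

theorem mdifferentiableAt_extChartAt_symm_of_mem {a : M} {x : F}
    (hx : x ∈ (extChartAt 𝓘(ℝ, F) a).target) :
    MDifferentiableAt 𝓘(ℝ, F) 𝓘(ℝ, F) (extChartAt 𝓘(ℝ, F) a).symm x :=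
  (contMDiffAt_extChartAt_symm_of_mem hx).mdifferentiableAt (by simp)

theorem isInvertible_mfderiv_extChartAt_symm_of_mem {a : M} {x : F}
    (hx : x ∈ (extChartAt 𝓘(ℝ, F) a).target) :
    (mfderiv 𝓘(ℝ, F) 𝓘(ℝ, F) (extChartAt 𝓘(ℝ, F) a).symm x).IsInvertible := by
  have := isInvertible_mfderivWithin_extChartAt_symm (I := 𝓘(ℝ, F)) hx
  simpa [mfderivWithin_univ] using this

theorem mfderiv_chartField {a : M} {x : F} (hx : x ∈ (extChartAt 𝓘(ℝ, F) a).target)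
    (X : ∀ p : M, TangentSpace 𝓘(ℝ, F) p) :
    mfderiv 𝓘(ℝ, F) 𝓘(ℝ, F) (extChartAt 𝓘(ℝ, F) a).symm x (chartField (F := F) a X x) =
      X ((extChartAt 𝓘(ℝ, F) a).symm x) := by
  exact (isInvertible_mfderiv_extChartAt_symm_of_mem hx).self_apply_inverse _

variable [CompleteSpace F]

theorem contDiffAt_chartField {a : M} {X : ∀ p : M, TangentSpace 𝓘(ℝ, F) p}
    (hX : ContMDiffAt 𝓘(ℝ, F) (𝓘(ℝ, F)).tangent ω
      (fun p => (⟨p, X p⟩ : TangentBundle 𝓘(ℝ, F) M)) a) :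
    ContDiffAt ℝ ω (chartField a X) (extChartAt 𝓘(ℝ, F) a a) := by
  have h := ContMDiffAt.mpullback_vectorField_preimage (m := ω) (n := ω)
    (f := (extChartAt 𝓘(ℝ, F) a).symm) (V := X) (x₀ := extChartAt 𝓘(ℝ, F) a a)
    (by rw [extChartAt_to_inv]; exact hX)
    (contMDiffAt_extChartAt_symm_of_mem (mem_extChartAt_target a))
    (isInvertible_mfderiv_extChartAt_symm_of_mem (mem_extChartAt_target a)) le_rfl
  rw [← contMDiffWithinAt_univ] at h
  exact contDiffWithinAt_univ.1 (contMDiffWithinAt_vectorSpace_iff_contDiffWithinAt.1 h)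

theorem contMDiffAt_of_chartField {a : M} {X : ∀ p : M, TangentSpace 𝓘(ℝ, F) p} {Y : F → F}
    (hY : ContDiffAt ℝ ω Y (extChartAt 𝓘(ℝ, F) a a))
    (h : ∀ᶠ p in 𝓝 a, mfderiv 𝓘(ℝ, F) 𝓘(ℝ, F) (extChartAt 𝓘(ℝ, F) a) p (X p) =
      Y (extChartAt 𝓘(ℝ, F) a p)) :
    ContMDiffAt 𝓘(ℝ, F) (𝓘(ℝ, F)).tangent ω
      (fun p => (⟨p, X p⟩ : TangentBundle 𝓘(ℝ, F) M)) a := by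
  have hY' : ContMDiffAt 𝓘(ℝ, F) (𝓘(ℝ, F)).tangent ω
      (fun x => (⟨x, Y x⟩ : TangentBundle 𝓘(ℝ, F) F)) (extChartAt 𝓘(ℝ, F) a a) := by
    rw [← contMDiffWithinAt_univ]
    exact contMDiffWithinAt_vectorSpace_iff_contDiffWithinAt.2 (contDiffWithinAt_univ.2 hY)
  have h2 := ContMDiffAt.mpullback_vectorField_preimage (m := ω) (n := ω)
    (f := extChartAt 𝓘(ℝ, F) a) (V := Y) (x₀ := a) hY' contMDiffAt_extChartAt
    (isInvertible_mfderiv_extChartAt (mem_extChartAt_source a)) le_rfl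
  refine h2.congr_of_eventuallyEq ?_
  filter_upwards [h, extChartAt_source_mem_nhds (I := 𝓘(ℝ, F)) a] with p h3 h4
  have : X p = VectorField.mpullback 𝓘(ℝ, F) 𝓘(ℝ, F) (extChartAt 𝓘(ℝ, F) a) Y p := by
    change X p = (mfderiv 𝓘(ℝ, F) 𝓘(ℝ, F) (extChartAt 𝓘(ℝ, F) a) p).inverse
      (Y (extChartAt 𝓘(ℝ, F) a p))
    rw [← h3]
    exact ((isInvertible_mfderiv_extChartAt h4).inverse_apply_self _).symm
  rw [this]

/-- Brackets are natural under pullback by the chart, and the chart has invertible differential, so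
nothing is lost. Commutation becomes an identity between ordinary derivatives. -/
theorem mlieBracket_eq_zero_iff_chartField {a : M} {X Y : ∀ p : M, TangentSpace 𝓘(ℝ, F) p}
    (hX : ContMDiffAt 𝓘(ℝ, F) (𝓘(ℝ, F)).tangent ω
      (fun p => (⟨p, X p⟩ : TangentBundle 𝓘(ℝ, F) M)) a)
    (hY : ContMDiffAt 𝓘(ℝ, F) (𝓘(ℝ, F)).tangent ω
      (fun p => (⟨p, Y p⟩ : TangentBundle 𝓘(ℝ, F) M)) a) :
    (∀ᶠ p in 𝓝 a, VectorField.mlieBracket 𝓘(ℝ, F) X Y p = 0) ↔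
      ∀ᶠ x in 𝓝 (extChartAt 𝓘(ℝ, F) a a),
        VectorField.lieBracket ℝ (chartField a X) (chartField a Y) x = 0 := by
  rw [← eventually_extChartAt_symm_iff (F := F)]
  refine eventually_congr ?_
  have hX' : ∀ᶠ p in 𝓝 a, MDifferentiableAt 𝓘(ℝ, F) (𝓘(ℝ, F)).tangent
      (fun p => (⟨p, X p⟩ : TangentBundle 𝓘(ℝ, F) M)) p :=
    ((contMDiffAt_iff_contMDiffAt_nhds (by simp)).1 hX).mono
      fun _ hp => hp.mdifferentiableAt (by simp)
  have hY' : ∀ᶠ p in 𝓝 a, MDifferentiableAt 𝓘(ℝ, F) (𝓘(ℝ, F)).tangent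
      (fun p => (⟨p, Y p⟩ : TangentBundle 𝓘(ℝ, F) M)) p :=
    ((contMDiffAt_iff_contMDiffAt_nhds (by simp)).1 hY).mono
      fun _ hp => hp.mdifferentiableAt (by simp)
  filter_upwards [eventually_mem_extChartAt_target F a,
    (tendsto_extChartAt_symm F a).eventually hX',
    (tendsto_extChartAt_symm F a).eventually hY'] with x h1 h2 h3
  have h4 := VectorField.mpullback_mlieBracket (n := ω) h2 h3
    (contMDiffAt_extChartAt_symm_of_mem h1) (by simp)
  have h5 : VectorField.mlieBracket 𝓘(ℝ, F) (chartField a X) (chartField a Y) x =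
      VectorField.lieBracket ℝ (chartField a X) (chartField a Y) x :=
    (congrFun (VectorField.mlieBracketWithin_eq_lieBracketWithin (V := chartField a X)
      (W := chartField a Y) (s := univ)) x).trans (congrFun VectorField.lieBracketWithin_univ x)
  have h6 := isInvertible_mfderiv_extChartAt_symm_of_mem h1
  constructor
  · intro h
    rw [← h5]
    refine h4.symm.trans ?_
    rw [VectorField.mpullback_apply, h, map_zero]
    rfl
  · intro h
    rw [← h5] at h
    have h7 := h4.trans h
    rw [VectorField.mpullback_apply] at h7
    rw [← h6.self_apply_inverse (VectorField.mlieBracket 𝓘(ℝ, F) X Y _), h7]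
    exact ContinuousLinearMap.map_zero _

end ChartField

/-! ### The reflection of `ℂ^r` at a real part. -/

section Reflection
variable {r : ℕ}

/-- The linear map `z ↦ -conj z` on `ℂ^r`. -/
def negConj (r : ℕ) : (Fin r → ℂ) →L[ℝ] (Fin r → ℂ) :=
  -((ofRealPi r).comp (rePi r)) + (Complex.I • (ofRealPi r).comp (imPi r))

theorem negConj_apply (z : Fin r → ℂ) :
    negConj r z = -ofRealPi r (rePi r z) + Complex.I • ofRealPi r (imPi r z) := rfl

@[simp] theorem rePi_negConj (z : Fin r → ℂ) : rePi r (negConj r z) = -rePi r z := by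
  simp [negConj_apply]

@[simp] theorem imPi_negConj (z : Fin r → ℂ) : imPi r (negConj r z) = imPi r z := by
  simp [negConj_apply]

theorem negConj_I_smul (z : Fin r → ℂ) : negConj r (Complex.I • z) = -Complex.I • negConj r z :=
  ext_re_im (by simp) (by simp)

theorem negConj_ofRealPi (v : Fin r → ℝ) : negConj r (ofRealPi r v) = -ofRealPi r v :=
  ext_re_im (by simp) (by simp)

/-- The reflection `x + iy ↦ 2c - x + iy` of `ℂ^r`. -/
def reflect (c : Fin r → ℝ) (z : Fin r → ℂ) : Fin r → ℂ := negConj r z + ofRealPi r (c + c)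

@[simp] theorem rePi_reflect (c : Fin r → ℝ) (z : Fin r → ℂ) :
    rePi r (reflect c z) = -rePi r z + (c + c) := by
  simp only [reflect, map_add, rePi_negConj, rePi_ofRealPi]

@[simp] theorem imPi_reflect (c : Fin r → ℝ) (z : Fin r → ℂ) :
    imPi r (reflect c z) = imPi r z := by
  simp [reflect, map_add (imPi r)]

theorem reflect_reflect (c : Fin r → ℝ) (z : Fin r → ℂ) : reflect c (reflect c z) = z :=
  ext_re_im (by simp only [rePi_reflect, neg_add, neg_neg]; abel) (by simp)

theorem reflect_self (z : Fin r → ℂ) : reflect (rePi r z) z = z :=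
  ext_re_im (by simp) (by simp)

theorem reflect_eq_iff (c : Fin r → ℝ) (z : Fin r → ℂ) : reflect c z = z ↔ rePi r z - c = 0 := by
  constructor
  · intro h
    have h1 := congrArg (rePi r) h
    rw [rePi_reflect] at h1
    have h2 : (2 : ℝ) • (rePi r z - c) = 0 := by
      rw [two_smul]
      nth_rewrite 2 [← h1]
      abel
    exact (smul_eq_zero.1 h2).resolve_left two_ne_zero
  · intro h
    rw [sub_eq_zero] at h
    rw [← h, reflect_self]

theorem hasFDerivAt_reflect (c : Fin r → ℝ) (z : Fin r → ℂ) :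
    HasFDerivAt (reflect c) (negConj r) z :=
  (negConj r).hasFDerivAt.add_const _

theorem contDiff_reflect (c : Fin r → ℝ) : ContDiff ℝ ω (reflect c) :=
  (negConj r).contDiff.add contDiff_const

end Reflection

/-! ### Equality of germs of vector fields. -/

section Germ
variable {F : Type uF} [NormedAddCommGroup F] [NormedSpace ℝ F]
  {M : Type uM} [TopologicalSpace M] [ChartedSpace F M]

theorem germ_eq_iff {a : M} {X Y : ∀ p : M, TangentSpace 𝓘(ℝ, F) p} :
    germ a X = germ a Y ↔ ∀ᶠ p in 𝓝 a, X p = Y p := by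
  refine (Submodule.Quotient.eq _).trans ?_
  change (∀ᶠ p in 𝓝 a, X p - Y p = 0) ↔ _
  exact eventually_congr (Eventually.of_forall fun p => sub_eq_zero)

theorem germ_eq_zero_iff {a : M} {X : ∀ p : M, TangentSpace 𝓘(ℝ, F) p} :
    germ a X = 0 ↔ ∀ᶠ p in 𝓝 a, X p = 0 :=
  Submodule.Quotient.mk_eq_zero _

theorem exists_germ_eq {a : M} (ξ : VFGerm F a) :
    ∃ X : ∀ p : M, TangentSpace 𝓘(ℝ, F) p, germ a X = ξ :=
  Submodule.mkQ_surjective _ ξ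

end Germ

/-! ### The reflection involution and its uniqueness. -/

section Translation
variable {E : Type uE} [NormedAddCommGroup E] [NormedSpace ℂ E]
  {Z : Type uZ} [TopologicalSpace Z] [ChartedSpace E Z]
  {F : Type uF} [NormedAddCommGroup F] [NormedSpace ℝ F]
  {M : Type uM} [TopologicalSpace M] [ChartedSpace F M]
  {ι : GenericEmbedding E Z F M} {a : M}

theorem TubeRealization.germ_mem_iff (R : TubeRealization ι a)
    {X : ∀ p : M, TangentSpace 𝓘(ℝ, F) p} :
    germ a X ∈ R.translationAlgebra ↔
      ∃ v : Fin R.r → ℝ, ∀ᶠ p in 𝓝 a, dEmb (Fin R.r → ℂ) F R.toFun p (X p) = ofRealPi R.r v := by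
  constructor
  · rintro ⟨X', hX', v, hv⟩
    refine ⟨v, ?_⟩
    filter_upwards [hv, germ_eq_iff.1 hX'] with p h1 h2
    rw [← h2]; exact h1
  · rintro ⟨v, hv⟩
    exact ⟨X, rfl, v, hv⟩

variable [IsManifold 𝓘(ℝ, F) ω M] {r : ℕ} {φ : M → Fin r → ℂ} {B : Set (Fin r → ℝ)}

/-- If `φ ∘ g = S ∘ φ'` near `a` then the differentials correspond. -/
theorem eventually_dEmb_lift {r' : ℕ} {φ' : M → Fin r' → ℂ}
    (hφ : ContMDiffAt 𝓘(ℝ, F) 𝓘(ℝ, Fin r → ℂ) ω φ a)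
    (hφ' : ContMDiffAt 𝓘(ℝ, F) 𝓘(ℝ, Fin r' → ℂ) ω φ' a) {g : M → M} (hga : g a = a)
    (hg : ContMDiffAt 𝓘(ℝ, F) 𝓘(ℝ, F) ω g a) {S : (Fin r → ℂ) → Fin r' → ℂ}
    {S' : (Fin r → ℂ) →L[ℝ] Fin r' → ℂ} (hS : ∀ z, HasFDerivAt S S' z)
    (h : ∀ᶠ p in 𝓝 a, φ' (g p) = S (φ p)) :
    ∀ᶠ p in 𝓝 a, ∀ u : TangentSpace 𝓘(ℝ, F) p,
      dEmb (Fin r' → ℂ) F φ' (g p) (mfderiv 𝓘(ℝ, F) 𝓘(ℝ, F) g p u) =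
        S' (dEmb (Fin r → ℂ) F φ p u) := by
  have hgt : Tendsto g (𝓝 a) (𝓝 a) := by
    have := hg.continuousAt.tendsto
    rwa [hga] at this
  filter_upwards [h.eventually_nhds, eventually_mdifferentiableAt hφ,
    hgt.eventually (eventually_mdifferentiableAt hφ'), eventually_mdifferentiableAt hg]
    with p h1 h2 h3 h4 u
  rw [← dEmb_comp h3 h4, dEmb_congr (f := φ' ∘ g) (f' := S ∘ φ) h1,
    dEmb_comp_left (hS _).differentiableAt h2, (hS _).fderiv]

/-- The involution of a tube realization induced by `x + iy ↦ 2c - x + iy`. -/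
theorem IsCRIsoOnto.exists_reflection (H : IsCRIsoOnto ι a φ (tube B)) :
    ∃ τ : M → M, IsInvolution ι a τ ∧ ∀ᶠ p in 𝓝 a, φ (τ p) = reflect (rePi r (φ a)) (φ p) := by
  set c := rePi r (φ a) with hc
  -- The reflection leaves imaginary parts unchanged, so it maps the tube to itself; with `c` the
  -- real part of `φ a` it also fixes the base point.
  obtain ⟨τ, hτa, hτ, hφτ⟩ := H.exists_lift H (S := reflect c) (contDiff_reflect c).contDiffAt
    (reflect_self _) (by
      filter_upwards [self_mem_nhdsWithin] with z hz
      rw [mem_tube_iff, imPi_reflect]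
      exact hz)
  have hτt : Tendsto τ (𝓝 a) (𝓝 a) := by
    have := hτ.continuousAt.tendsto
    rwa [hτa] at this
  refine ⟨τ, ⟨hτa, hτ, ?_, ?_⟩, hφτ⟩
  · filter_upwards [H.eventually_isTubeFrame, hτt.eventually H.eventually_isTubeFrame,
      eventually_dEmb_lift H.analytic H.analytic hτa hτ (hasFDerivAt_reflect c) hφτ]
      with p h1 h2 h3 v w hvw
    rw [h2.cr, map_neg, h3, h3, (h1.cr v w).1 hvw, negConj_I_smul, neg_smul, neg_neg]
  · refine H.eventually_eq (hτt.comp hτt) tendsto_id ?_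
    filter_upwards [hφτ, hτt.eventually hφτ] with p h1 h2
    rw [h2, h1, reflect_reflect]

/-- `τ` reverses the real translations of the tube realization `φ`. -/
def ReversesTranslations (φ : M → Fin r → ℂ) (τ : M → M) (p : M) : Prop :=
  ∀ (v : Fin r → ℝ) (u : TangentSpace 𝓘(ℝ, F) p), dEmb (Fin r → ℂ) F φ p u = ofRealPi r v →
    dEmb (Fin r → ℂ) F φ (τ p) (mfderiv 𝓘(ℝ, F) 𝓘(ℝ, F) τ p u) = -ofRealPi r v

/-- An involution that reverses the real translations is the standard reflection. -/
theorem IsCRIsoOnto.eq_reflect (H : IsCRIsoOnto ι a φ (tube B)) {τ : M → M}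
    (hτ : IsInvolution ι a τ) (hneg : ∀ᶠ p in 𝓝 a, ReversesTranslations (F := F) φ τ p) :
    ∀ᶠ p in 𝓝 a, φ (τ p) = reflect (rePi r (φ a)) (φ p) := by
  set c := rePi r (φ a) with hc
  have hτt : Tendsto τ (𝓝 a) (𝓝 a) := by
    have := hτ.analytic.continuousAt.tendsto
    rwa [hτ.map_base] at this
  have hmd : ∀ᶠ p in 𝓝 a, MDifferentiableAt 𝓘(ℝ, F) 𝓘(ℝ, Fin r → ℂ) (φ ∘ τ) p := by
    filter_upwards [hτt.eventually (eventually_mdifferentiableAt H.analytic),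
      eventually_mdifferentiableAt hτ.analytic] with p h1 h2 using h1.comp p h2
  have hmd' : ∀ᶠ p in 𝓝 a, MDifferentiableAt 𝓘(ℝ, F) 𝓘(ℝ, Fin r → ℂ) (reflect c ∘ φ) p := by
    filter_upwards [eventually_mdifferentiableAt H.analytic] with p h1
    exact (hasFDerivAt_reflect c _).differentiableAt.mdifferentiableAt.comp p h1
  refine eventually_eq_of_dEmb_eq (F := F) hmd hmd' ?_ ?_
  · filter_upwards [H.eventually_isTubeFrame, hτt.eventually H.eventually_isTubeFrame, hneg,
      hτ.antiCR, eventually_mdifferentiableAt hτ.analytic] with p h1 h2 h3 h4 h5 u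
    change dEmb _ F (φ ∘ τ) p u = dEmb _ F (reflect c ∘ φ) p u
    rw [dEmb_comp h2.mdiff h5, dEmb_comp_left (hasFDerivAt_reflect c _).differentiableAt h1.mdiff,
      (hasFDerivAt_reflect c _).fderiv]
    -- Here `u = x + k` with `k = J y` and `x`, `y` mapped to real vectors. `τ` reverses `x` and
    -- `y`, and by antilinearity it preserves the image `i Im` of `k`. The total is `-Re + i Im`.
    obtain ⟨x, y, k, hx, hy, hu, hyk⟩ := h1.exists_split u
    have h6 := (h2.cr _ _).1 (h4 y k hyk)
    rw [map_neg, h3 _ y hy, smul_neg, neg_inj] at h6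
    rw [negConj_apply, ← h3 _ x hx, ← h6, ← map_add, ← map_add, ← hu]
  · simp only [hτ.map_base, hc, reflect_self]

end Translation

/-! ### Translation fields: analyticity, flows, brackets. -/

section TranslationFields
variable {E : Type uE} [NormedAddCommGroup E] [NormedSpace ℂ E]
  {Z : Type uZ} [TopologicalSpace Z] [ChartedSpace E Z]
  {F : Type uF} [NormedAddCommGroup F] [NormedSpace ℝ F]
  {M : Type uM} [TopologicalSpace M] [ChartedSpace F M]
  {ι : GenericEmbedding E Z F M} {a : M} {r : ℕ} {φ : M → Fin r → ℂ} {B : Set (Fin r → ℝ)}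
  {ψ : (Fin r → ℂ) → M}

theorem translationField_eq_sum (v : Fin r → ℝ) (p : M) :
    translationField F φ ψ v p = ∑ k, v k • translationField F φ ψ (Pi.single k 1) p := by
  have h : ofRealPi r v = ∑ k, v k • ofRealPi r (Pi.single k 1) := by
    ext j
    simp [Finset.sum_apply, Pi.single_apply, apply_ite]
  have h2 : ∀ A : (Fin r → ℂ) →L[ℝ] F,
      A (ofRealPi r v) = ∑ k, v k • A (ofRealPi r (Pi.single k 1)) := fun A => by
    rw [h, map_sum]
    simp only [map_smul]
  exact h2 (mfderiv 𝓘(ℝ, Fin r → ℂ) 𝓘(ℝ, F) ψ (φ p))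

variable [IsManifold 𝓘(ℝ, F) ω M]

/-- The flow of translations along a tube realization. -/
theorem IsCRIsoOnto.eventually_flow (H : IsCRIsoOnto ι a φ (tube B))
    (hψ : ContMDiffAt 𝓘(ℝ, Fin r → ℂ) 𝓘(ℝ, F) ω ψ (φ a))
    (hφψ : ∀ᶠ z in 𝓝[tube B] (φ a), φ (ψ z) = z)
    (hψφ : ∀ᶠ p in 𝓝 a, ψ (φ p) = p) (v : Fin r → ℝ) :
    ∀ᶠ q in 𝓝 ((0 : ℝ), a),
      ContMDiffAt 𝓘(ℝ, F) 𝓘(ℝ, Fin r → ℂ) ω φ q.2 ∧ IsTubeFrame ι φ q.2 ∧ ψ (φ q.2) = q.2 ∧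
      ContMDiffAt 𝓘(ℝ, Fin r → ℂ) 𝓘(ℝ, F) ω ψ (φ q.2 + q.1 • ofRealPi r v) ∧
      φ (ψ (φ q.2 + q.1 • ofRealPi r v)) = φ q.2 + q.1 • ofRealPi r v ∧
      IsTubeFrame ι φ (ψ (φ q.2 + q.1 • ofRealPi r v)) := by
  have hsnd : Tendsto (fun q : ℝ × M => q.2) (𝓝 ((0 : ℝ), a)) (𝓝 a) :=
    continuousAt_snd.tendsto
  have hG : Tendsto (fun q : ℝ × M => φ q.2 + q.1 • ofRealPi r v) (𝓝 ((0 : ℝ), a))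
      (𝓝 (φ a)) := by
    have h1 : ContinuousAt (fun q : ℝ × M => φ q.2 + q.1 • ofRealPi r v) ((0 : ℝ), a) :=
      (ContinuousAt.comp (f := fun q : ℝ × M => q.2) H.continuousAt continuousAt_snd).add
        (continuousAt_fst.smul continuousAt_const)
    simpa [ContinuousAt] using h1
  have hψt : Tendsto ψ (𝓝 (φ a)) (𝓝 a) := by
    have := hψ.continuousAt.tendsto
    rwa [hψφ.self_of_nhds] at this
  filter_upwards [hsnd.eventually ((contMDiffAt_iff_contMDiffAt_nhds (by simp)).1 H.analytic),
    hsnd.eventually H.eventually_isTubeFrame, hsnd.eventually hψφ,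
    hG.eventually ((contMDiffAt_iff_contMDiffAt_nhds (by simp)).1 hψ),
    hG.eventually (eventually_nhdsWithin_iff.1 hφψ), hsnd.eventually H.mapsTo,
    (hψt.comp hG).eventually H.eventually_isTubeFrame] with q h1 h2 h3 h4 h5 h6 h7
  refine ⟨h1, h2, h3, h4, h5 ?_, h7⟩
  rw [← map_smul]
  exact (tube_add_ofReal _).2 h6

theorem contMDiffAt_translationField [CompleteSpace F]
    (hφ : ContMDiffAt 𝓘(ℝ, F) 𝓘(ℝ, Fin r → ℂ) ω φ a)
    (hψ : ContMDiffAt 𝓘(ℝ, Fin r → ℂ) 𝓘(ℝ, F) ω ψ (φ a))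
    (hψφ : ∀ᶠ p in 𝓝 a, ψ (φ p) = p) (v : Fin r → ℝ) :
    ContMDiffAt 𝓘(ℝ, F) (𝓘(ℝ, F)).tangent ω
      (fun p => (⟨p, translationField F φ ψ v p⟩ : TangentBundle 𝓘(ℝ, F) M)) a := by
  have hψa : ψ (φ a) = a := hψφ.self_of_nhds
  set κ := extChartAt 𝓘(ℝ, F) a with hκ
  have hκψ : ContDiffAt ℝ ω (κ ∘ ψ) (φ a) := by
    refine ContMDiffAt.contDiffAt ?_
    exact ContMDiffAt.comp_of_eq (g := κ) (f := ψ) contMDiffAt_extChartAt hψ hψa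
  have hφκ : ContDiffAt ℝ ω (φ ∘ κ.symm) (κ a) := by
    refine ContMDiffAt.contDiffAt ?_
    exact ContMDiffAt.comp_of_eq (g := φ) (f := κ.symm) hφ
      (contMDiffAt_extChartAt_symm_of_mem (mem_extChartAt_target a)) (extChartAt_to_inv a)
  have hY : ContDiffAt ℝ ω (fun x => fderiv ℝ (κ ∘ ψ) (φ (κ.symm x)) (ofRealPi r v)) (κ a) := by
    refine ContDiffAt.clm_apply ?_ contDiffAt_const
    refine ContDiffAt.comp (g := fderiv ℝ (κ ∘ ψ)) (f := φ ∘ κ.symm) (κ a) ?_ hφκ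
    rw [Function.comp_apply, hκ, extChartAt_to_inv]
    exact hκψ.fderiv_right (m := ω) le_rfl
  refine contMDiffAt_of_chartField hY ?_
  filter_upwards [extChartAt_source_mem_nhds (I := 𝓘(ℝ, F)) a, hψφ,
    hφ.continuousAt.eventually (eventually_mdifferentiableAt hψ)] with p h1 h2 h3
  rw [κ.left_inv h1]
  have h4 : MDifferentiableAt 𝓘(ℝ, F) 𝓘(ℝ, F) κ (ψ (φ p)) := by
    rw [h2]; exact mdifferentiableAt_extChartAt (by simpa using h1)
  have h5 := mfderiv_comp (φ p) h4 h3
  rw [mfderiv_eq_fderiv] at h5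
  have h6 := congrArg (fun A : (Fin r → ℂ) →L[ℝ] F => A (ofRealPi r v)) h5
  refine Eq.trans ?_ h6.symm
  change mfderiv 𝓘(ℝ, F) 𝓘(ℝ, F) κ p (translationField F φ ψ v p) =
    mfderiv 𝓘(ℝ, F) 𝓘(ℝ, F) κ (ψ (φ p)) (translationField F φ ψ v p)
  rw [h2]

/-- Real translations of a tube realization are infinitesimal CR-transformations. -/
theorem IsCRIsoOnto.isInfinitesimalCR [CompleteSpace F] (H : IsCRIsoOnto ι a φ (tube B))
    (hψ : ContMDiffAt 𝓘(ℝ, Fin r → ℂ) 𝓘(ℝ, F) ω ψ (φ a))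
    (hφψ : ∀ᶠ z in 𝓝[tube B] (φ a), φ (ψ z) = z)
    (hψφ : ∀ᶠ p in 𝓝 a, ψ (φ p) = p) (v : Fin r → ℝ) :
    IsInfinitesimalCR ι a (translationField F φ ψ v) := by
  refine ⟨contMDiffAt_translationField H.analytic hψ hψφ v, ?_⟩
  obtain ⟨I, hI, U, hU, hIU⟩ := mem_nhds_prod_iff.1 (H.eventually_flow hψ hφψ hψφ v)
  obtain ⟨ε, hε, hεI⟩ := Metric.mem_nhds_iff.1 hI
  obtain ⟨U', hU'U, hU'o, haU'⟩ := mem_nhds_iff.1 hU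
  have hmem : ∀ t ∈ Ioo (-ε) ε, ∀ p ∈ U', _ := fun t ht p hp =>
    hIU (show (t, p) ∈ I ×ˢ U from
      ⟨hεI (by rw [Real.ball_eq_Ioo]; simpa using ht), hU'U hp⟩)
  refine ⟨fun t p => ψ (φ p + t • ofRealPi r v), U', ε, hU'o, haU', hε, fun p hp => ?_,
    fun p hp t ht => ?_, fun q hq => ?_, fun t ht p hp => ?_⟩
  · have := (hmem 0 (by simpa using hε) p hp).2.2.1
    simpa using this
  · obtain ⟨-, -, -, h4, h5, -⟩ := hmem t ht p hp
    refine HasMFDerivAt.hasMFDerivWithinAt ?_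
    have hline : HasFDerivAt (fun t : ℝ => φ p + t • ofRealPi r v)
        ((1 : ℝ →L[ℝ] ℝ).smulRight (ofRealPi r v)) t :=
      ((hasFDerivAt_id t).smul_const (ofRealPi r v)).const_add (φ p)
    have h6 := HasMFDerivAt.comp t (h4.mdifferentiableAt (by simp)).hasMFDerivAt
      hline.hasMFDerivAt
    refine h6.congr_mfderiv ?_
    ext
    have h7 : translationField F φ ψ v (ψ (φ p + t • ofRealPi r v)) =
        mfderiv 𝓘(ℝ, Fin r → ℂ) 𝓘(ℝ, F) ψ (φ p + t • ofRealPi r v) (ofRealPi r v) := by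
      change mfderiv 𝓘(ℝ, Fin r → ℂ) 𝓘(ℝ, F) ψ (φ (ψ (φ p + t • ofRealPi r v)))
        (ofRealPi r v) = _
      rw [show φ (ψ (φ p + t • ofRealPi r v)) = _ from h5]
    refine Eq.trans ?_ (congrArg (fun w : F => (1 : ℝ) • w) h7.symm)
    exact map_smul (mfderiv 𝓘(ℝ, Fin r → ℂ) 𝓘(ℝ, F) ψ (φ p + t • ofRealPi r v) :
      (Fin r → ℂ) →L[ℝ] F) (1 : ℝ) (ofRealPi r v)
  · obtain ⟨h1, -, -, h4, -, -⟩ := hmem q.1 hq.1 q.2 hq.2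
    refine ContMDiffAt.contMDiffWithinAt ?_
    refine ContMDiffAt.comp (g := ψ) (f := fun q : ℝ × M => φ q.2 + q.1 • ofRealPi r v) q h4 ?_
    refine ContMDiffAt.add (h1.comp q contMDiffAt_snd) ?_
    exact contMDiffAt_fst.smul contMDiffAt_const
  · obtain ⟨h1, h2, -, h4, h5, h6⟩ := hmem t ht p hp
    have hlin : MDifferentiableAt 𝓘(ℝ, F) 𝓘(ℝ, Fin r → ℂ)
        (fun p => φ p + t • ofRealPi r v) p :=
      (h1.add contMDiffAt_const).mdifferentiableAt (by simp)
    have hmd : MDifferentiableAt 𝓘(ℝ, F) 𝓘(ℝ, F) (fun p => ψ (φ p + t • ofRealPi r v)) p :=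
      MDifferentiableAt.comp p (h4.mdifferentiableAt (by simp)) hlin
    -- In tube coordinates the flow map is a translation near `p`, so it does not change `dφ`; the
    -- CR property follows from the tube frames at both points.
    have key : ∀ u, dEmb (Fin r → ℂ) F φ (ψ (φ p + t • ofRealPi r v))
        (mfderiv 𝓘(ℝ, F) 𝓘(ℝ, F) (fun p => ψ (φ p + t • ofRealPi r v)) p u) =
        dEmb (Fin r → ℂ) F φ p u := fun u => by
      have e1 := dEmb_comp (f := φ) (g := fun p => ψ (φ p + t • ofRealPi r v)) h6.mdiff hmd u
      rw [← e1, dEmb_congr (f' := (fun z => z + t • ofRealPi r v) ∘ φ),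
        dEmb_comp_left (S := fun z => z + t • ofRealPi r v) (by fun_prop) h2.mdiff]
      · rw [fderiv_add_const, fderiv_fun_id]
        rfl
      · filter_upwards [hU'o.mem_nhds hp] with y hy
        exact (hmem t ht y hy).2.2.2.2.1
    intro x y hxy
    rw [h6.cr, key, key]
    exact (h2.cr x y).1 hxy

theorem fderiv_comp_extChartAt_symm {V : Type*} [NormedAddCommGroup V] [NormedSpace ℂ V]
    {f : M → V} {x : F} (hx : x ∈ (extChartAt 𝓘(ℝ, F) a).target)
    (hf : MDifferentiableAt 𝓘(ℝ, F) 𝓘(ℝ, V) f ((extChartAt 𝓘(ℝ, F) a).symm x)) (u : F) :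
    fderiv ℝ (f ∘ (extChartAt 𝓘(ℝ, F) a).symm) x u =
      dEmb V F f ((extChartAt 𝓘(ℝ, F) a).symm x)
        (mfderiv 𝓘(ℝ, F) 𝓘(ℝ, F) (extChartAt 𝓘(ℝ, F) a).symm x u) := by
  have h := mfderiv_comp x hf (mdifferentiableAt_extChartAt_symm_of_mem hx)
  rw [mfderiv_eq_fderiv] at h
  exact congrArg (fun A : F →L[ℝ] V => A u) h

theorem contDiffAt_comp_extChartAt_symm {V : Type*} [NormedAddCommGroup V] [NormedSpace ℝ V]
    {f : M → V} (hf : ContMDiffAt 𝓘(ℝ, F) 𝓘(ℝ, V) ω f a) :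
    ContDiffAt ℝ ω (f ∘ (extChartAt 𝓘(ℝ, F) a).symm) (extChartAt 𝓘(ℝ, F) a a) := by
  refine ContMDiffAt.contDiffAt ?_
  exact ContMDiffAt.comp_of_eq (g := f) hf
    (contMDiffAt_extChartAt_symm_of_mem (mem_extChartAt_target a)) (extChartAt_to_inv a)

/-- The product rule produces two second-derivative terms of `g`, which cancel by symmetry.
Vanishing of the bracket thereby becomes a symmetry of the derivatives of the images `dg X` and `dg
Y`. -/
theorem fderiv_lieBracket_apply {V : Type*} [NormedAddCommGroup V] [NormedSpace ℝ V]
    {g : F → V} {X Y : F → F} {x : F} (hg : ContDiffAt ℝ ω g x) (hX : DifferentiableAt ℝ X x)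
    (hY : DifferentiableAt ℝ Y x) :
    fderiv ℝ g x (VectorField.lieBracket ℝ X Y x) =
      fderiv ℝ (fun y => fderiv ℝ g y (Y y)) x (X x) -
        fderiv ℝ (fun y => fderiv ℝ g y (X y)) x (Y x) := by
  have hd : DifferentiableAt ℝ (fderiv ℝ g) x :=
    (hg.fderiv_right (m := ω) le_rfl).differentiableAt (by simp)
  rw [fderiv_clm_apply hd hX, fderiv_clm_apply hd hY, VectorField.lieBracket]
  have := hg.isSymmSndFDerivAt_of_omega (X x) (Y x)
  simp [this]

/-- Vector fields that are mapped to constants by an immersion commute. -/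
theorem mlieBracket_eq_zero_of_const [CompleteSpace F] {V : Type*} [NormedAddCommGroup V]
    [NormedSpace ℂ V] {f : M → V}
    (hf : ContMDiffAt 𝓘(ℝ, F) 𝓘(ℝ, V) ω f a)
    (hinj : ∀ᶠ p in 𝓝 a, ∀ u v : TangentSpace 𝓘(ℝ, F) p, dEmb V F f p u = dEmb V F f p v → u = v)
    {X Y : ∀ p : M, TangentSpace 𝓘(ℝ, F) p}
    (hX : ContMDiffAt 𝓘(ℝ, F) (𝓘(ℝ, F)).tangent ω
      (fun p => (⟨p, X p⟩ : TangentBundle 𝓘(ℝ, F) M)) a)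
    (hY : ContMDiffAt 𝓘(ℝ, F) (𝓘(ℝ, F)).tangent ω
      (fun p => (⟨p, Y p⟩ : TangentBundle 𝓘(ℝ, F) M)) a) {v w : V}
    (hv : ∀ᶠ p in 𝓝 a, dEmb V F f p (X p) = v) (hw : ∀ᶠ p in 𝓝 a, dEmb V F f p (Y p) = w) :
    ∀ᶠ p in 𝓝 a, VectorField.mlieBracket 𝓘(ℝ, F) X Y p = 0 := by
  rw [mlieBracket_eq_zero_iff_chartField hX hY]
  have hconst : ∀ {X : ∀ p : M, TangentSpace 𝓘(ℝ, F) p} {v : V},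
      (∀ᶠ p in 𝓝 a, dEmb V F f p (X p) = v) → ∀ᶠ x in 𝓝 (extChartAt 𝓘(ℝ, F) a a),
        fderiv ℝ (f ∘ (extChartAt 𝓘(ℝ, F) a).symm) x (chartField a X x) = v := by
    intro X v hv
    filter_upwards [eventually_mem_extChartAt_target F a,
      (tendsto_extChartAt_symm F a).eventually hv,
      (tendsto_extChartAt_symm F a).eventually (eventually_mdifferentiableAt hf)] with x h1 h2 h3
    rw [fderiv_comp_extChartAt_symm h1 h3, mfderiv_chartField h1, h2]
  filter_upwards [(hconst hv).eventually_nhds, (hconst hw).eventually_nhds,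
    (contDiffAt_comp_extChartAt_symm hf).eventually (by simp),
    (contDiffAt_chartField hX).eventually (by simp),
    (contDiffAt_chartField hY).eventually (by simp), eventually_mem_extChartAt_target F a,
    (tendsto_extChartAt_symm F a).eventually hinj,
    (tendsto_extChartAt_symm F a).eventually (eventually_mdifferentiableAt hf)]
    with x h1 h2 h3 h4 h5 h6 h7 h8
  have h9 := fderiv_lieBracket_apply h3 (h4.differentiableAt (by simp))
    (h5.differentiableAt (by simp))
  rw [EventuallyEq.fderiv_eq (f := fun _ => w) h2, EventuallyEq.fderiv_eq (f := fun _ => v) h1,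
    fderiv_const_apply, fderiv_const_apply, fderiv_comp_extChartAt_symm h6 h8] at h9
  refine (isInvertible_mfderiv_extChartAt_symm_of_mem h6).injective (h7 _ _ (h9.trans ?_))
  refine Eq.trans (sub_self (0 : V)) ?_
  exact (map_zero (dEmb V F f ((extChartAt 𝓘(ℝ, F) a).symm x) ∘L
    mfderiv 𝓘(ℝ, F) 𝓘(ℝ, F) (extChartAt 𝓘(ℝ, F) a).symm x : F →L[ℝ] V)).symm

end TranslationFields

/-! ### Pointwise linear algebra of a tube frame. -/

section FrameLinear
variable {E : Type uE} [NormedAddCommGroup E] [NormedSpace ℂ E]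
  {Z : Type uZ} [TopologicalSpace Z] [ChartedSpace E Z]
  {F : Type uF} [NormedAddCommGroup F] [NormedSpace ℝ F]
  {M : Type uM} [TopologicalSpace M] [ChartedSpace F M]
  {ι : GenericEmbedding E Z F M} {p : M} {r : ℕ} {φ : M → Fin r → ℂ}

/-- A tube frame identifies `T_{ι p} Z` with `ℂ^r`. -/
theorem IsTubeFrame.exists_equiv (h : IsTubeFrame ι φ p) :
    ∃ A : (Fin r → ℂ) ≃ₗ[ℂ] E, ∀ u, ι.d p u = A (dEmb (Fin r → ℂ) F φ p u) := by
  choose x hx using fun k : Fin r => h.exists_real (Pi.single k 1)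
  set A : (Fin r → ℂ) →ₗ[ℂ] E := Fintype.linearCombination ℂ fun k => ι.d p (x k) with hA
  have hAι : ∀ u, ι.d p u = A (dEmb (Fin r → ℂ) F φ p u) := by
    refine h.apply_eq (ι.d p : TangentSpace 𝓘(ℝ, F) p →ₗ[ℝ] E) (fun v w hvw => hvw) A ?_
    intro v u hu
    have hu' : u = ∑ k, v k • x k := by
      refine h.inj _ _ (hu.trans ?_)
      rw [map_sum]
      simp only [map_smul, hx]
      ext j
      simp [Finset.sum_apply, Pi.single_apply, apply_ite]
    rw [hu', hA, Fintype.linearCombination_apply]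
    refine (map_sum (ι.d p) _ _).trans (Finset.sum_congr rfl fun k _ => ?_)
    rw [map_smul]
    simp
  refine ⟨LinearEquiv.ofBijective A ⟨?_, ?_⟩, hAι⟩
  · rw [injective_iff_map_eq_zero]
    intro z hz
    obtain ⟨s, hs⟩ := h.exists_real (rePi r z)
    obtain ⟨t, ht⟩ := h.exists_real (imPi r z)
    -- With `s` and `t` realizing the real and imaginary parts of `z`, `A z = 0` says `-s = J t`.
    -- The CR equivalence carries this relation to `ℂ^r`, where it reads `z = 0`.
    have h1 : IsJ ι p t (-s) := by
      change ι.d p (-s) = Complex.I • ι.d p t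
      rw [map_neg, hAι, hAι, hs, ht, ← map_smul, neg_eq_iff_add_eq_zero, ← map_add, re_add_I_im, hz]
    have h2 := (h.cr _ _).1 h1
    rw [map_neg, hs, ht, neg_eq_iff_add_eq_zero, re_add_I_im] at h2
    exact h2
  · rw [← LinearMap.range_eq_top, eq_top_iff, ← ι.generic p, Submodule.span_le]
    rintro _ ⟨u, rfl⟩
    exact ⟨_, (hAι u).symm⟩

/-- Consequently all tube realizations of one germ have the same number of coordinates. -/
theorem IsTubeFrame.finrank_eq (h : IsTubeFrame ι φ p) : Module.finrank ℂ E = r := by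
  obtain ⟨A, -⟩ := h.exists_equiv
  rw [← A.finrank_eq, Module.finrank_fin_fun]

/-- The CR-dimension is the dimension of the space of tangent vectors with vanishing real part. -/
theorem IsTubeFrame.finrank_ker (h : IsTubeFrame ι φ p) [FiniteDimensional ℝ F] :
    Module.finrank ℝ (((rePi r ∘L dEmb (Fin r → ℂ) F φ p : F →L[ℝ] Fin r → ℝ)).ker) =
      crDim ι p := by
  set D : F →L[ℝ] Fin r → ℂ := dEmb (Fin r → ℂ) F φ p with hD
  set L : F →L[ℝ] E := ι.d p with hL
  set K : Submodule ℝ F := (rePi r ∘L D).ker with hK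
  have hKmem : ∀ {k : F}, k ∈ K ↔ rePi r (D k) = 0 := Iff.rfl
  have hcr : ∀ v w : F, L w = Complex.I • L v ↔ D w = Complex.I • D v := h.cr
  have hreal : ∀ v, ∃ u : F, D u = ofRealPi r v := h.exists_real
  have hex : ∀ k ∈ K, ∃ x : F, D x = ofRealPi r (imPi r (D k)) ∧ L k = Complex.I • L x := by
    intro k hk
    obtain ⟨x, hx⟩ := hreal (imPi r (D k))
    refine ⟨x, hx, (hcr _ _).2 ?_⟩
    conv_lhs => rw [← re_add_I_im (D k), hKmem.1 hk, map_zero, zero_add, ← hx]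
  have hcomb : ∀ k ∈ K, ∀ k' ∈ K, L k + Complex.I • L k' ∈ holTangent ι p := by
    have h1 : ∀ k ∈ K, L k ∈ holTangent ι p := by
      intro k hk
      obtain ⟨x, -, hx⟩ := hex k hk
      refine ⟨⟨k, rfl⟩, ⟨-x, ?_⟩⟩
      change L (-x) = _
      rw [map_neg, hx, smul_smul, Complex.I_mul_I, neg_one_smul]
    exact fun k hk k' hk' => Submodule.add_mem _ (h1 k hk) (Submodule.smul_mem _ _ (h1 k' hk'))
  -- `K` embeds as a real form of the holomorphic tangent space: `(k, k') ↦ k + i k'` is a real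
  -- isomorphism, and comparing real dimensions gives the claim. It is injective since `dφ` is
  -- purely imaginary on `K`.
  let Ψ : K × K →ₗ[ℝ] (holTangent ι p) :=
    { toFun := fun q => ⟨L q.1 + Complex.I • L q.2, hcomb _ q.1.2 _ q.2.2⟩
      map_add' := fun q q' => by
        ext
        simp only [Prod.fst_add, Prod.snd_add, Submodule.coe_add, map_add, smul_add]
        abel
      map_smul' := fun c q => by
        refine Subtype.ext ?_
        change L (c • (q.1 : F)) + Complex.I • L (c • (q.2 : F)) =
          c • (L q.1 + Complex.I • L q.2)
        rw [map_smul, map_smul, smul_add, smul_comm Complex.I c] }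
  have hbij : Function.Bijective Ψ := by
    constructor
    · rw [injective_iff_map_eq_zero]
      rintro ⟨⟨k, hk⟩, ⟨k', hk'⟩⟩ hq
      have h1 : L k + Complex.I • L k' = 0 := congrArg Subtype.val hq
      have h2 : D (-k) = Complex.I • D k' := by
        rw [← hcr, map_neg, neg_eq_iff_add_eq_zero, h1]
      have h3 := hKmem.1 hk
      have h4 := hKmem.1 hk'
      have hre := congrArg (rePi r) h2
      have him := congrArg (imPi r) h2
      rw [map_neg, map_neg, h3, rePi_I_smul, neg_zero, eq_comm, neg_eq_zero] at hre
      rw [map_neg, map_neg, imPi_I_smul, h4, neg_eq_zero] at him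
      have h5 : k = 0 := h.inj _ _ (by
        change D k = D 0
        rw [map_zero]; exact ext_re_im (by rw [h3, map_zero]) (by rw [him, map_zero]))
      have h6 : k' = 0 := h.inj _ _ (by
        change D k' = D 0
        rw [map_zero]; exact ext_re_im (by rw [h4, map_zero]) (by rw [hre, map_zero]))
      subst h5 h6
      rfl
    · rintro ⟨_, ⟨⟨(u : F), rfl⟩, ⟨(u' : F), hu'⟩⟩⟩
      have hu'D : D u' = Complex.I • D u := (hcr _ _).1 hu'
      obtain ⟨x, hx⟩ := hreal (rePi r (D u))
      obtain ⟨y, hy⟩ := hreal (rePi r (D u'))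
      have hk : u - x ∈ K := hKmem.2 (by rw [map_sub, map_sub, hx, rePi_ofRealPi, sub_self])
      have hk' : y - u' ∈ K := hKmem.2 (by rw [map_sub, map_sub, hy, rePi_ofRealPi, sub_self])
      refine ⟨⟨⟨u - x, hk⟩, ⟨y - u', hk'⟩⟩, Subtype.ext ?_⟩
      -- From `u' = J u`, the imaginary part of `dφ u'` is the real part of `dφ u`, so `u' - y = J
      -- x`. Hence `i (y - u')` restores the part `x` that was removed from `u`.
      have h7 : L (u' - y) = Complex.I • L x := by
        rw [hcr, map_sub, sub_eq_iff_eq_add, hx, hy]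
        conv_lhs => rw [← re_add_I_im (D u'), add_comm]
        rw [hu'D, imPi_I_smul]
      change L (u - x) + Complex.I • L (y - u') = L u
      rw [← neg_sub u' y, map_neg, smul_neg, h7, smul_smul, Complex.I_mul_I, neg_one_smul, map_sub]
      simp
  have h8 := (LinearEquiv.ofBijective Ψ hbij).finrank_eq
  have h9 := finrank_real_of_complex (holTangent ι p)
  rw [Module.finrank_prod] at h8
  have h10 : Module.finrank ℝ K = Module.finrank ℂ (holTangent ι p) := by omega
  exact h10

end FrameLinear

/-! ### The translation algebra satisfies (i') and (ii). -/

section TranslationAlgebra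
variable {E : Type uE} [NormedAddCommGroup E] [NormedSpace ℂ E]
  {Z : Type uZ} [TopologicalSpace Z] [ChartedSpace E Z]
  {F : Type uF} [NormedAddCommGroup F] [NormedSpace ℝ F]
  {M : Type uM} [TopologicalSpace M] [ChartedSpace F M] [IsManifold 𝓘(ℝ, F) ω M]
  {ι : GenericEmbedding E Z F M} {a : M}

/-- The elements of the translation algebra are represented by infinitesimal
CR-transformations. -/
theorem TubeRealization.exists_isInfinitesimalCR [CompleteSpace F] (R : TubeRealization ι a)
    (v : Fin R.r → ℝ) : ∃ Y : ∀ p : M, TangentSpace 𝓘(ℝ, F) p, IsInfinitesimalCR ι a Y ∧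
      ∀ᶠ p in 𝓝 a, dEmb (Fin R.r → ℂ) F R.toFun p (Y p) = ofRealPi R.r v := by
  obtain ⟨ψ, hψ, hψφ, hφψ⟩ := R.isCRIsoOnto.inverse
  exact ⟨_, R.isCRIsoOnto.isInfinitesimalCR hψ hφψ hψφ v,
    (R.isCRIsoOnto.eventually_dEmb_translationField hψ hψφ hφψ).mono fun p hp => hp v⟩

theorem TubeRealization.eventually_eq_of_dEmb (R : TubeRealization ι a)
    {X Y : ∀ p : M, TangentSpace 𝓘(ℝ, F) p} {v : Fin R.r → ℝ}
    (hX : ∀ᶠ p in 𝓝 a, dEmb (Fin R.r → ℂ) F R.toFun p (X p) = ofRealPi R.r v)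
    (hY : ∀ᶠ p in 𝓝 a, dEmb (Fin R.r → ℂ) F R.toFun p (Y p) = ofRealPi R.r v) :
    ∀ᶠ p in 𝓝 a, X p = Y p := by
  filter_upwards [hX, hY, R.isCRIsoOnto.eventually_isTubeFrame] with p h1 h2 h3
  exact h3.inj _ _ (h1.trans h2.symm)

/-- Membership in the eigenspace allows a neighbourhood depending on the field. Finitely many
coordinate translations determine all of them linearly, so one neighbourhood serves every `v`. -/
theorem TubeRealization.inNegEigenspace_iff (R : TubeRealization ι a) {τ : M → M}
    (hτa : τ a = a) (hτ : ContinuousAt τ a) :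
    InNegEigenspace a τ R.translationAlgebra ↔
      ∀ᶠ p in 𝓝 a, ReversesTranslations (F := F) R.toFun τ p := by
  have hτt : Tendsto τ (𝓝 a) (𝓝 a) := by
    have := hτ.tendsto
    rwa [hτa] at this
  obtain ⟨ψ, hψ, hψφ, hφψ⟩ := R.isCRIsoOnto.inverse
  have htr := R.isCRIsoOnto.eventually_dEmb_translationField hψ hψφ hφψ
  have hfr := R.isCRIsoOnto.eventually_isTubeFrame
  constructor
  · intro h
    have h1 : ∀ᶠ p in 𝓝 a, ∀ k, mfderiv 𝓘(ℝ, F) 𝓘(ℝ, F) τ p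
        (translationField F R.toFun ψ (Pi.single k 1) p) =
        -translationField F R.toFun ψ (Pi.single k 1) (τ p) := by
      refine eventually_all.2 fun k => h _ ?_
      exact R.germ_mem_iff.2 ⟨Pi.single k 1, htr.mono fun p hp => hp _⟩
    filter_upwards [h1, htr, hτt.eventually htr, hfr] with p h1 h2 h3 h4 v u hu
    have h5 : u = translationField F R.toFun ψ v p := h4.inj _ _ (hu.trans (h2 v).symm)
    have h6 : ∀ A : F →L[ℝ] F, (∀ k, A (translationField F R.toFun ψ (Pi.single k 1) p) =
        -translationField F R.toFun ψ (Pi.single k 1) (τ p)) →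
        A (translationField F R.toFun ψ v p) = -translationField F R.toFun ψ v (τ p) := by
      intro A hA
      rw [translationField_eq_sum v p, translationField_eq_sum v (τ p), map_sum]
      simp only [map_smul, hA, smul_neg, Finset.sum_neg_distrib]
    have h7 := h6 (mfderiv 𝓘(ℝ, F) 𝓘(ℝ, F) τ p) h1
    rw [h5]
    refine (congrArg (dEmb (Fin R.r → ℂ) F R.toFun (τ p)) h7).trans ?_
    exact (map_neg (dEmb (Fin R.r → ℂ) F R.toFun (τ p) : F →L[ℝ] Fin R.r → ℂ) _).trans
      (congrArg Neg.neg (h3 v))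
  · intro h X hX
    obtain ⟨v, hv⟩ := R.germ_mem_iff.1 hX
    filter_upwards [h, hv, hτt.eventually hv, hτt.eventually hfr] with p h1 h2 h3 h4
    refine h4.inj _ _ ?_
    rw [h1 v _ h2, map_neg, h3]

/-- The translations of a tube realization form an abelian subalgebra with (i') and (ii). -/
theorem TubeRealization.isTubeSubalgebra [CompleteSpace F] (R : TubeRealization ι a) :
    IsTubeSubalgebra ι a R.translationAlgebra := by
  have hfr := R.isCRIsoOnto.eventually_isTubeFrame
  refine ⟨⟨?_, ?_⟩, ?_, ?_⟩
  · intro ξ hξ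
    obtain ⟨X, rfl⟩ := exists_germ_eq ξ
    obtain ⟨v, hv⟩ := R.germ_mem_iff.1 hξ
    obtain ⟨Y, hY, hYv⟩ := R.exists_isInfinitesimalCR v
    exact ⟨Y, germ_eq_iff.2 (R.eventually_eq_of_dEmb hYv hv), hY⟩
  · intro X Y hX hY
    obtain ⟨v, hv⟩ := R.germ_mem_iff.1 hX
    obtain ⟨w, hw⟩ := R.germ_mem_iff.1 hY
    have han : ∀ {X : ∀ p : M, TangentSpace 𝓘(ℝ, F) p} {v : Fin R.r → ℝ},
        (∀ᶠ p in 𝓝 a, dEmb (Fin R.r → ℂ) F R.toFun p (X p) = ofRealPi R.r v) →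
        ContMDiffAt 𝓘(ℝ, F) (𝓘(ℝ, F)).tangent ω
          (fun p => (⟨p, X p⟩ : TangentBundle 𝓘(ℝ, F) M)) a := by
      intro X v hv
      obtain ⟨Y, hY, hYv⟩ := R.exists_isInfinitesimalCR v
      refine hY.analytic.congr_of_eventuallyEq ?_
      filter_upwards [R.eventually_eq_of_dEmb hv hYv] with p hp
      rw [hp]
    exact mlieBracket_eq_zero_of_const R.isCRIsoOnto.analytic (hfr.mono fun p hp => hp.inj)
      (han hv) (han hw) hv hw
  · obtain ⟨τ, hτ, hφτ⟩ := R.isCRIsoOnto.exists_reflection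
    refine ⟨τ, hτ, (R.inNegEigenspace_iff hτ.map_base hτ.analytic.continuousAt).2 ?_⟩
    filter_upwards [eventually_dEmb_lift R.isCRIsoOnto.analytic R.isCRIsoOnto.analytic
      hτ.map_base hτ.analytic (hasFDerivAt_reflect _) hφτ] with p hp v u hu
    rw [hp, hu, negConj_ofRealPi]
  · obtain ⟨A, hA⟩ := hfr.self_of_nhds.exists_equiv
    have h1 : ∀ v : Fin R.r → ℝ, A (ofRealPi R.r v) ∈ Submodule.span ℂ {x : E |
        ∃ X : (∀ p : M, TangentSpace 𝓘(ℝ, F) p), germ a X ∈ R.translationAlgebra ∧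
          x = ι.d a (X a)} := by
      intro v
      obtain ⟨Y, -, hYv⟩ := R.exists_isInfinitesimalCR v
      refine Submodule.subset_span ⟨Y, R.germ_mem_iff.2 ⟨v, hYv⟩, ?_⟩
      rw [hA, hYv.self_of_nhds]
    refine eq_top_iff.2 fun x _ => ?_
    obtain ⟨z, rfl⟩ := A.surjective x
    rw [← re_add_I_im z, map_add, map_smul]
    exact Submodule.add_mem _ (h1 _) (Submodule.smul_mem _ _ (h1 _))

end TranslationAlgebra

/-! ### The embedding and its CR fields in charts. -/

section EmbeddingChart
variable {E : Type uE} [NormedAddCommGroup E] [NormedSpace ℂ E]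
  {Z : Type uZ} [TopologicalSpace Z] [ChartedSpace E Z]

/-- The differential of a holomorphic chart is a complex linear isomorphism. -/
theorem exists_hasMFDerivAt_chartAt [IsManifold 𝓘(ℂ, E) ω Z] {z₀ z : Z}
    (hz : z ∈ (chartAt E z₀).source) :
    ∃ C : E ≃L[ℂ] E, HasMFDerivAt 𝓘(ℝ, E) 𝓘(ℝ, E) (extChartAt 𝓘(ℝ, E) z₀) z
      ((C : E →L[ℂ] E).restrictScalars ℝ) := by
  have hz' : z ∈ (extChartAt 𝓘(ℂ, E) z₀).source := by rwa [extChartAt_source]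
  have h := (mdifferentiableAt_extChartAt (I := 𝓘(ℂ, E)) hz).hasMFDerivAt
  obtain ⟨C, hC⟩ := isInvertible_mfderiv_extChartAt (I := 𝓘(ℂ, E)) hz'
  rw [← hC] at h
  exact ⟨C, h.1, h.2.restrictScalars ℝ⟩

variable {F : Type uF} [NormedAddCommGroup F] [NormedSpace ℝ F]
  {M : Type uM} [TopologicalSpace M] [ChartedSpace F M]

/-- The embedding `M → Z` in a chart of `Z`. -/
def embChart (ι : GenericEmbedding E Z F M) (a : M) : M → E :=
  extChartAt 𝓘(ℝ, E) (ι.toFun a) ∘ ι.toFun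

variable (ι : GenericEmbedding E Z F M) (a : M)

theorem contMDiffAt_embChart : ContMDiffAt 𝓘(ℝ, F) 𝓘(ℝ, E) ω (embChart ι a) a :=
  (contMDiffAt_iff_target.1 (ι.analytic a)).2

/-- `ι.d p` is expressed in the preferred chart at `ι p`, which varies with `p`, whereas calculus
needs the fixed chart at `ι a`. The charts being holomorphic, the change is complex linear and
complex linear relations may be tested in either one. -/
theorem eventually_dEmb_embChart [IsManifold 𝓘(ℂ, E) ω Z] : ∀ᶠ p in 𝓝 a, ∃ C : E ≃L[ℂ] E,
    ∀ u, dEmb E F (embChart ι a) p u = C (ι.d p u) := by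
  have h : ∀ᶠ p in 𝓝 a, ι.toFun p ∈ (chartAt E (ι.toFun a)).source :=
    (ι.analytic a).continuousAt.eventually (chart_source_mem_nhds E (ι.toFun a))
  filter_upwards [h] with p hp
  obtain ⟨C, hC⟩ := exists_hasMFDerivAt_chartAt hp
  refine ⟨C, fun u => ?_⟩
  have h1 := (hC.comp p ((ι.analytic p).mdifferentiableAt (by simp)).hasMFDerivAt).mfderiv
  exact congrArg (fun A : F →L[ℝ] E => A u) h1

variable [IsManifold 𝓘(ℝ, F) ω M]

/-- The embedding `M → Z` in charts of `M` and `Z`. -/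
def localEmb (ι : GenericEmbedding E Z F M) (a : M) : F → E :=
  embChart ι a ∘ (extChartAt 𝓘(ℝ, F) a).symm

theorem contDiffAt_localEmb : ContDiffAt ℝ ω (localEmb ι a) (extChartAt 𝓘(ℝ, F) a a) :=
  contDiffAt_comp_extChartAt_symm (contMDiffAt_embChart ι a)

theorem eventually_fderiv_localEmb : ∀ᶠ x in 𝓝 (extChartAt 𝓘(ℝ, F) a a), ∀ u : F,
    fderiv ℝ (localEmb ι a) x u = dEmb E F (embChart ι a) ((extChartAt 𝓘(ℝ, F) a).symm x)
      (mfderiv 𝓘(ℝ, F) 𝓘(ℝ, F) (extChartAt 𝓘(ℝ, F) a).symm x u) := by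
  filter_upwards [eventually_mem_extChartAt_target F a, (tendsto_extChartAt_symm F a).eventually
    (eventually_mdifferentiableAt (contMDiffAt_embChart ι a))] with x h1 h2 u
  exact fderiv_comp_extChartAt_symm h1 h2 u

/-- A vector field along `M` as a map with values in the model space of `Z`. -/
def localField (ι : GenericEmbedding E Z F M) (a : M) (X : ∀ p : M, TangentSpace 𝓘(ℝ, F) p)
    (x : F) : E :=
  fderiv ℝ (localEmb ι a) x (chartField a X x)

theorem eventually_localField (X : ∀ p : M, TangentSpace 𝓘(ℝ, F) p) :
    ∀ᶠ x in 𝓝 (extChartAt 𝓘(ℝ, F) a a), localField ι a X x =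
      dEmb E F (embChart ι a) ((extChartAt 𝓘(ℝ, F) a).symm x)
        (X ((extChartAt 𝓘(ℝ, F) a).symm x)) := by
  filter_upwards [eventually_fderiv_localEmb ι a, eventually_mem_extChartAt_target F a]
    with x h1 h2
  refine (h1 _).trans ?_
  rw [mfderiv_chartField h2]

variable {ι a} {X Y : ∀ p : M, TangentSpace 𝓘(ℝ, F) p}

theorem contDiffAt_localField [CompleteSpace F]
    (hX : ContMDiffAt 𝓘(ℝ, F) (𝓘(ℝ, F)).tangent ω
      (fun p => (⟨p, X p⟩ : TangentBundle 𝓘(ℝ, F) M)) a) :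
    ContDiffAt ℝ ω (localField ι a X) (extChartAt 𝓘(ℝ, F) a a) :=
  ((contDiffAt_localEmb ι a).fderiv_right (m := ω) le_rfl).clm_apply (contDiffAt_chartField hX)

/-- The form in which `exists_straightening` and `eventually_const_of_commute` use a vanishing
bracket. -/
theorem eventually_fderiv_localField_comm [CompleteSpace F]
    (hX : ContMDiffAt 𝓘(ℝ, F) (𝓘(ℝ, F)).tangent ω
      (fun p => (⟨p, X p⟩ : TangentBundle 𝓘(ℝ, F) M)) a)
    (hY : ContMDiffAt 𝓘(ℝ, F) (𝓘(ℝ, F)).tangent ω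
      (fun p => (⟨p, Y p⟩ : TangentBundle 𝓘(ℝ, F) M)) a)
    (h : ∀ᶠ p in 𝓝 a, VectorField.mlieBracket 𝓘(ℝ, F) X Y p = 0) :
    ∀ᶠ x in 𝓝 (extChartAt 𝓘(ℝ, F) a a), fderiv ℝ (localField ι a X) x (chartField a Y x) =
      fderiv ℝ (localField ι a Y) x (chartField a X x) := by
  filter_upwards [(mlieBracket_eq_zero_iff_chartField hX hY).1 h,
    (contDiffAt_localEmb ι a).eventually (by simp),
    (contDiffAt_chartField hX).eventually (by simp),
    (contDiffAt_chartField hY).eventually (by simp)] with x h1 h2 h3 h4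
  have h5 := fderiv_lieBracket_apply h2 (h3.differentiableAt (by simp))
    (h4.differentiableAt (by simp))
  rw [h1, map_zero, eq_comm, sub_eq_zero] at h5
  exact h5.symm

/-- Infinitesimal CR-transformations are CR as maps into the model space of `Z`. -/
theorem IsInfinitesimalCR.eventually_cr [IsManifold 𝓘(ℂ, E) ω Z] (hX : IsInfinitesimalCR ι a X) :
    ∀ᶠ x in 𝓝 (extChartAt 𝓘(ℝ, F) a a), ∀ v w,
      fderiv ℝ (localEmb ι a) x w = Complex.I • fderiv ℝ (localEmb ι a) x v →
      fderiv ℝ (localField ι a X) x w = Complex.I • fderiv ℝ (localField ι a X) x v := by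
  obtain ⟨Φ, U, ε, hU, haU, hε, hΦ0, hΦX, hΦ, hΦcr⟩ := hX.flow
  set σ := (extChartAt 𝓘(ℝ, F) a).symm with hσ
  have hσt := tendsto_extChartAt_symm F a
  have hg := (contMDiffAt_iff_contMDiffAt_nhds (by simp)).1 (contMDiffAt_embChart ι a)
  filter_upwards [eventually_mem_extChartAt_target F a,
    hσt.eventually (hU.mem_nhds haU), (hσt.eventually (hU.mem_nhds haU)).eventually_nhds,
    (eventually_localField ι a X).eventually_nhds, eventually_fderiv_localEmb ι a,
    hσt.eventually hg.eventually_nhds, (hσt.eventually hg).eventually_nhds,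
    hσt.eventually (eventually_dEmb_embChart ι a),
    hσt.eventually (eventually_dEmb_embChart ι a).eventually_nhds]
    with x hx hxU hxU' hloc hemb hgx hgx' hC hC'
  have hIoo : ∀ {t : ℝ}, t ∈ Ioo (-ε) ε → Ioo (-ε) ε ∈ 𝓝 t := fun ht => isOpen_Ioo.mem_nhds ht
  have h0 : (0 : ℝ) ∈ Ioo (-ε) ε := by simpa using hε
  have hΦat : ∀ t ∈ Ioo (-ε) ε, ContMDiffAt (𝓘(ℝ, ℝ).prod 𝓘(ℝ, F)) 𝓘(ℝ, F) ω
      (fun q : ℝ × M => Φ q.1 q.2) (t, σ x) := fun t ht =>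
    hΦ.contMDiffAt (prod_mem_nhds (hIoo ht) (hU.mem_nhds hxU))
  have hΦx : Φ 0 (σ x) = σ x := hΦ0 _ hxU
  -- The flow read in charts: its initial velocity is `localField ι a X`, and each time-`t` map is
  -- CR by hypothesis.
  refine cr_of_flow (H := fun q : ℝ × F => embChart ι a (Φ q.1 (σ q.2))) ?_ ?_ ?_
  · refine ContMDiffAt.contDiffAt ?_
    have h1 : ContMDiffAt 𝓘(ℝ, ℝ × F) (𝓘(ℝ, ℝ).prod 𝓘(ℝ, F)) ω
        (fun q : ℝ × F => (q.1, σ q.2)) (0, x) :=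
      contDiffAt_fst.contMDiffAt.prodMk (ContMDiffAt.comp (g := σ) (0, x)
        (contMDiffAt_extChartAt_symm_of_mem hx) contDiffAt_snd.contMDiffAt)
    exact ContMDiffAt.comp_of_eq (g := embChart ι a) hgx.self_of_nhds
      (ContMDiffAt.comp (g := fun q : ℝ × M => Φ q.1 q.2) (0, x) (hΦat 0 h0) h1) hΦx
  · filter_upwards [hxU', hloc, hgx'] with y hyU hy hgy
    have h1 : HasMFDerivAt 𝓘(ℝ, ℝ) 𝓘(ℝ, F) (fun t => Φ t (σ y)) 0
        ((1 : ℝ →L[ℝ] ℝ).smulRight (X (Φ 0 (σ y)))) :=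
      (hΦX _ hyU 0 h0).hasMFDerivAt (hIoo h0)
    rw [hy]
    have hΦy : Φ 0 (σ y) = σ y := hΦ0 _ hyU
    have h2 : MDifferentiableAt 𝓘(ℝ, F) 𝓘(ℝ, E) (embChart ι a) (Φ 0 (σ y)) := by
      rw [hΦy]; exact hgy.mdifferentiableAt (by simp)
    have h3 := (HasMFDerivAt.comp (0 : ℝ) (g := embChart ι a) h2.hasMFDerivAt h1)
    have h4 : HasFDerivAt (fun t => embChart ι a (Φ t (σ y)))
        ((dEmb E F (embChart ι a) (Φ 0 (σ y)) : F →L[ℝ] E) ∘L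
          ((1 : ℝ →L[ℝ] ℝ).smulRight (X (Φ 0 (σ y)) : F))) 0 :=
      h3.hasFDerivAt
    have h5 : HasDerivAt (fun t => embChart ι a (Φ t (σ y)))
        (dEmb E F (embChart ι a) (Φ 0 (σ y)) ((1 : ℝ) • X (Φ 0 (σ y)))) 0 := h4.hasDerivAt
    rw [one_smul, hΦy] at h5
    exact h5
  · have hcurve : Tendsto (fun t => Φ t (σ x)) (𝓝 0) (𝓝 (σ x)) := by
      have h1 : ContinuousAt (fun t => Φ t (σ x)) 0 :=
        ContinuousAt.comp (g := fun q : ℝ × M => Φ q.1 q.2) (f := fun t : ℝ => (t, σ x))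
          (hΦat 0 h0).continuousAt (by fun_prop)
      have h2 := h1.tendsto
      rwa [hΦx] at h2
    filter_upwards [hIoo h0, hcurve.eventually hgx, hcurve.eventually hC']
      with t ht hgt ⟨C', hC'⟩ v w hvw
    have hΦt : MDifferentiableAt 𝓘(ℝ, F) 𝓘(ℝ, F) (Φ t) (σ x) := by
      have h1 : ContMDiffAt 𝓘(ℝ, F) 𝓘(ℝ, F) ω (Φ t) (σ x) :=
        ContMDiffAt.comp (g := fun q : ℝ × M => Φ q.1 q.2) (σ x) (hΦat t ht)
          (contMDiffAt_const.prodMk contMDiffAt_id)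
      exact h1.mdifferentiableAt (by simp)
    have hgt' := hgt.mdifferentiableAt (by simp : (ω : WithTop ℕ∞) ≠ 0)
    have key : ∀ u : F, fderiv ℝ (fun y => embChart ι a (Φ t (σ y))) x u =
        C' (ι.d (Φ t (σ x)) (mfderiv 𝓘(ℝ, F) 𝓘(ℝ, F) (Φ t) (σ x)
          (mfderiv 𝓘(ℝ, F) 𝓘(ℝ, F) σ x u))) := fun u => by
      refine (fderiv_comp_extChartAt_symm (f := embChart ι a ∘ Φ t) hx
        (hgt'.comp (σ x) hΦt) u).trans ?_
      rw [dEmb_comp hgt' hΦt, hC']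
    obtain ⟨C, hC⟩ := hC
    have hJ : IsJ ι (σ x) (mfderiv 𝓘(ℝ, F) 𝓘(ℝ, F) σ x v) (mfderiv 𝓘(ℝ, F) 𝓘(ℝ, F) σ x w) := by
      rw [hemb, hemb, hC, hC, ← map_smul] at hvw
      exact C.injective hvw
    have hJ' : ι.d _ _ = Complex.I • ι.d _ _ := hΦcr t ht _ hxU _ _ hJ
    change fderiv ℝ (fun y => embChart ι a (Φ t (σ y))) x w =
      Complex.I • fderiv ℝ (fun y => embChart ι a (Φ t (σ y))) x v
    rw [key, key, hJ', map_smul]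

end EmbeddingChart

/-! ### From abelian subalgebras to tube realizations. -/

section Realization
variable {E : Type uE} [NormedAddCommGroup E] [NormedSpace ℂ E]
  {Z : Type uZ} [TopologicalSpace Z] [ChartedSpace E Z]
  {F : Type uF} [NormedAddCommGroup F] [NormedSpace ℝ F]
  {M : Type uM} [TopologicalSpace M] [ChartedSpace F M]
  {ι : GenericEmbedding E Z F M} {a : M} {𝔳 : Submodule ℝ (VFGerm F a)}

/-- A subalgebra that is reversed by an involution is totally real. -/
theorem isTotallyReal_of_isInvolutionFor {τ : M → M} (hτ : IsInvolutionFor ι a 𝔳 τ) :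
    IsTotallyReal ι a 𝔳 := by
  intro X Y hX hY hXY
  have hτt : Tendsto τ (𝓝 a) (𝓝 a) := by
    have := hτ.1.analytic.continuousAt.tendsto
    rwa [hτ.1.map_base] at this
  rw [germ_eq_zero_iff]
  -- At `τ p` the hypothesis gives `Y = iX`, while applying the antilinear `dτ` to the same relation
  -- at `p` gives `Y = -iX`. Hence `2iX = 0` there.
  have key : ∀ᶠ p in 𝓝 a, X (τ p) = 0 := by
    filter_upwards [hXY, hτt.eventually hXY, hτ.1.antiCR, hτ.2 X hX, hτ.2 Y hY]
      with p h1 h2 h3 h4 h5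
    have h6 : ι.d (τ p) _ = Complex.I • ι.d (τ p) _ := h3 _ _ h1
    rw [h4, h5, neg_neg, map_neg, h2, smul_neg, eq_neg_iff_add_eq_zero, ← two_smul ℂ,
      smul_smul] at h6
    have h7 : ι.d (τ p) (X (τ p)) = 0 := by
      refine (smul_eq_zero.1 h6).resolve_left ?_
      simp [Complex.I_ne_zero]
    exact ι.injective_dEmb _ (h7.trans (map_zero (ι.d (τ p))).symm)
  filter_upwards [hτt.eventually key, hτ.1.involutive] with p h1 h2
  rwa [h2] at h1

variable [IsManifold 𝓘(ℝ, F) ω M]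

/-- An abelian subalgebra that spans `T_a Z` contains a frame. -/
theorem IsAbelianSubalgebra.exists_frame [FiniteDimensional ℂ E]
    (h𝔳 : IsAbelianSubalgebra ι a 𝔳) (hspan : SpansTangent ι a 𝔳) :
    ∃ (n : ℕ) (X : Fin n → ∀ p : M, TangentSpace 𝓘(ℝ, F) p),
      (∀ k, germ a (X k) ∈ 𝔳) ∧ (∀ k, IsInfinitesimalCR ι a (X k)) ∧
      ∃ b : Module.Basis (Fin n) ℂ E, ∀ k, b k = ι.d a (X k a) := by
  set S : Set E := {x : E | ∃ X : (∀ p : M, TangentSpace 𝓘(ℝ, F) p),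
    germ a X ∈ 𝔳 ∧ x = ι.d a (X a)} with hS
  obtain ⟨f, hfS, hf, hli⟩ := Submodule.exists_fun_fin_finrank_span_eq ℂ S
  -- Representatives of germs in `𝔳` are traded for representatives witnessing membership in `hol`;
  -- equal germs have the same value at `a`.
  have hX : ∀ k, ∃ X : ∀ p : M, TangentSpace 𝓘(ℝ, F) p, germ a X ∈ 𝔳 ∧
      IsInfinitesimalCR ι a X ∧ f k = ι.d a (X a) := by
    intro k
    obtain ⟨X, hX, hk⟩ := hfS k
    obtain ⟨Y, hY, hYcr⟩ := h𝔳.subset_hol hX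
    refine ⟨Y, hY ▸ hX, hYcr, ?_⟩
    rw [hk, (germ_eq_iff.1 hY).self_of_nhds]
  choose X hX𝔳 hXcr hXf using hX
  refine ⟨_, X, hX𝔳, hXcr, Module.Basis.mk hli ?_, fun k => ?_⟩
  · rw [hf]
    exact hspan.ge
  · rw [Module.Basis.mk_apply, hXf]

/-- Frames of commuting infinitesimal CR-transformations are the coordinate fields of tube
realizations. -/
theorem exists_tube_of_frame [FiniteDimensional ℝ F] [IsManifold 𝓘(ℂ, E) ω Z] {n : ℕ}
    {X : Fin n → ∀ p : M, TangentSpace 𝓘(ℝ, F) p}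
    (hX : ∀ k, IsInfinitesimalCR ι a (X k)) (b : Module.Basis (Fin n) ℂ E)
    (hb : ∀ k, b k = ι.d a (X k a))
    (hcomm : ∀ k l, ∀ᶠ p in 𝓝 a, VectorField.mlieBracket 𝓘(ℝ, F) (X k) (X l) p = 0) :
    ∃ (B : Set (Fin n → ℝ)) (φ : M → Fin n → ℂ), IsConnected B ∧
      (∃ d, ∀ y ∈ B, IsAnalyticSubmanifoldAt (Fin n → ℝ) B d y) ∧
      IsCRIsoOnto ι a φ (tube B) ∧
      (∀ᶠ p in 𝓝 a, ∀ k, dEmb (Fin n → ℂ) F φ p (X k p) = Pi.single k 1) ∧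
      ∀ Y : ∀ p : M, TangentSpace 𝓘(ℝ, F) p, IsInfinitesimalCR ι a Y →
        (∀ k, ∀ᶠ p in 𝓝 a, VectorField.mlieBracket 𝓘(ℝ, F) (X k) Y p = 0) →
        ∃ c : Fin n → ℂ, ∀ᶠ p in 𝓝 a, dEmb (Fin n → ℂ) F φ p (Y p) = c := by
  have : CompleteSpace F := FiniteDimensional.complete ℝ F
  set κ := extChartAt 𝓘(ℝ, F) a with hκ
  have hκa : κ.symm (κ a) = a := extChartAt_to_inv a
  set x₀ := κ a with hx₀
  have hσt : Tendsto κ.symm (𝓝 x₀) (𝓝 a) := tendsto_extChartAt_symm F a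
  have hκt : Tendsto κ (𝓝 a) (𝓝 x₀) := tendsto_extChartAt F a
  have hj := contDiffAt_localEmb ι a
  have hf : ∀ k, ContDiffAt ℝ ω (localField ι a (X k)) x₀ :=
    fun k => contDiffAt_localField (hX k).analytic
  obtain ⟨C, hC⟩ := (eventually_dEmb_embChart ι a).self_of_nhds
  have hfb : ∀ k, localField ι a (X k) x₀ = b.map C.toLinearEquiv k := by
    intro k
    rw [(eventually_localField ι a (X k)).self_of_nhds, Module.Basis.map_apply, hb, ← hκ, hκa, hC]
    rfl
  have hcr := fun k => (hX k).eventually_cr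
  have hcommX := fun k l =>
    eventually_fderiv_localField_comm (ι := ι) (hX k).analytic (hX l).analytic (hcomm k l)
  have hfX : ∀ᶠ u in 𝓝 x₀, ∀ k, localField ι a (X k) u =
      fderiv ℝ (localEmb ι a) u (chartField a (X k) u) := Eventually.of_forall fun u k => rfl
  obtain ⟨φ, hφ, hjφ⟩ := exists_straightening hj hf hfX (b.map C.toLinearEquiv) hfb hcr hcommX
  have hφX : ∀ᶠ u in 𝓝 x₀, ∀ k, fderiv ℝ φ u (chartField a (X k) u) = Pi.single k 1 := by
    filter_upwards [hjφ] with u hu k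
    refine frameMap_injective hu.1 ?_
    rw [frameMap_apply, frameMap_apply, ← hu.2]
    simp [Pi.single_apply, ite_smul, localField]
  -- `dj` factors through `dφ`, so the kernel of `dφ` lies in that of the immersion `j`.
  have hinj : Function.Injective (fderiv ℝ φ x₀) := by
    refine (injective_iff_map_eq_zero _).2 fun v hv => ?_
    have h1 := hjφ.self_of_nhds.2 v
    obtain ⟨C', hC'⟩ := (hσt.eventually (eventually_dEmb_embChart ι a)).self_of_nhds
    rw [hv, (eventually_fderiv_localEmb ι a).self_of_nhds, hC'] at h1
    simp only [Pi.zero_apply, zero_smul, Finset.sum_const_zero, ← hκ] at h1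
    have h2 := (C'.map_eq_zero_iff).1 h1
    refine (isInvertible_mfderiv_extChartAt_symm_of_mem (mem_extChartAt_target a)).injective
      (ι.injective_dEmb _ (h2.trans ?_))
    exact (map_zero (ι.d (κ.symm x₀) ∘L
      mfderiv 𝓘(ℝ, F) 𝓘(ℝ, F) κ.symm x₀ : F →L[ℝ] E)).symm
  obtain ⟨B, ψ, hBc, hBs, hφB, hψ, hψφ, hφψ⟩ := exists_tube_of_immersion hφ hinj hφX
  have hsrc : ∀ᶠ p in 𝓝 a, p ∈ κ.source := extChartAt_source_mem_nhds a
  have htgt : ∀ᶠ x in 𝓝 x₀, x ∈ κ.target := eventually_mem_extChartAt_target F a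
  have hφκ : ContMDiffAt 𝓘(ℝ, F) 𝓘(ℝ, Fin n → ℂ) ω (φ ∘ κ) a :=
    ContMDiffAt.comp a hφ.contMDiffAt contMDiffAt_extChartAt
  have hψt : Tendsto ψ (𝓝 (φ x₀)) (𝓝 x₀) := by
    have := hψ.continuousAt.tendsto
    rwa [hψφ.self_of_nhds] at this
  have hd : ∀ᶠ x in 𝓝 x₀, ∀ u : F, dEmb (Fin n → ℂ) F (φ ∘ κ) (κ.symm x)
      (mfderiv 𝓘(ℝ, F) 𝓘(ℝ, F) κ.symm x u) = fderiv ℝ φ x u := by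
    filter_upwards [htgt, htgt.eventually_nhds,
      hσt.eventually (eventually_mdifferentiableAt hφκ)] with x h1 h2 h3 u
    rw [← fderiv_comp_extChartAt_symm h1 h3 u]
    refine congrArg (fun A : F →L[ℝ] Fin n → ℂ => A u) (EventuallyEq.fderiv_eq ?_)
    filter_upwards [h2] with y hy
    exact congrArg φ (κ.right_inv hy)
  have hframe : ∀ {Y : ∀ p : M, TangentSpace 𝓘(ℝ, F) p} {c : Fin n → ℂ},
      (∀ᶠ x in 𝓝 x₀, fderiv ℝ φ x (chartField a Y x) = c) →
      ∀ᶠ p in 𝓝 a, dEmb (Fin n → ℂ) F (φ ∘ κ) p (Y p) = c := by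
    intro Y c h
    rw [← eventually_extChartAt_symm_iff (F := F)]
    filter_upwards [h, hd, htgt] with x h1 h2 h3
    rw [← h1, ← h2, mfderiv_chartField h3]
  refine ⟨B, φ ∘ κ, hBc, hBs, ⟨hφκ, hκt.eventually hφB, ⟨κ.symm ∘ ψ, ?_, ?_, ?_⟩, ?_⟩, ?_, ?_⟩
  · refine ContMDiffAt.comp_of_eq (contMDiffAt_extChartAt_symm_of_mem
      (mem_extChartAt_target a)) hψ.contMDiffAt ?_
    exact hψφ.self_of_nhds
  · filter_upwards [hκt.eventually hψφ, hsrc] with p h1 h2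
    change κ.symm (ψ (φ (κ p))) = p
    rw [h1, κ.left_inv h2]
  · filter_upwards [hφψ, (hψt.eventually htgt).filter_mono nhdsWithin_le_nhds] with z h1 h2
    change φ (κ (κ.symm (ψ z))) = z
    rw [κ.right_inv h2, h1]
  · rw [← eventually_extChartAt_symm_iff (F := F)]
    filter_upwards [hd, htgt, hjφ, eventually_fderiv_localEmb ι a,
      hσt.eventually (eventually_dEmb_embChart ι a)] with x h1 h2 h3 h4 ⟨C, hC⟩ v w
    have hinv : (mfderiv 𝓘(ℝ, F) 𝓘(ℝ, F) κ.symm x).IsInvertible :=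
      isInvertible_mfderiv_extChartAt_symm_of_mem h2
    have h5 : ∀ u : F, C (ι.d (κ.symm x) (mfderiv 𝓘(ℝ, F) 𝓘(ℝ, F) κ.symm x u)) =
      fderiv ℝ (localEmb ι a) x u := fun u => (hC _).symm.trans (h4 u).symm
    -- `dj` is `dφ` followed by the frame map, which is complex linear and injective; this gives the
    -- CR condition in both directions.
    have h6 : ∀ v w : F, fderiv ℝ (localEmb ι a) x w = Complex.I • fderiv ℝ (localEmb ι a) x v ↔
        fderiv ℝ φ x w = Complex.I • fderiv ℝ φ x v := fun v w => by
      rw [h3.2, h3.2, Finset.smul_sum]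
      simp only [smul_smul]
      rw [← (frameMap_injective h3.1).eq_iff, frameMap_apply, frameMap_apply]
      rfl
    obtain ⟨v, rfl⟩ := hinv.surjective v
    obtain ⟨w, rfl⟩ := hinv.surjective w
    refine Iff.trans ?_
      (Iff.of_eq (congrArg₂ (fun s t : Fin n → ℂ => s = Complex.I • t) (h1 w) (h1 v)).symm)
    change ι.d _ _ = Complex.I • ι.d _ _ ↔ _
    rw [← C.injective.eq_iff, map_smul]
    refine (Iff.of_eq (congrArg₂ (fun s t : E => s = Complex.I • t) (h5 w) (h5 v))).trans ?_
    exact h6 v w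
  · exact eventually_all.2 fun k => hframe (hφX.mono fun u hu => hu k)
  · intro Y hY hcY
    obtain ⟨c, hc⟩ := eventually_const_of_commute hf hfX hcr hcommX hφ hjφ
      (contDiffAt_chartField hY.analytic) (Eventually.of_forall fun u => rfl) hY.eventually_cr
      fun k => eventually_fderiv_localField_comm (ι := ι) (hX k).analytic hY.analytic (hcY k)
    exact ⟨c, hframe hc⟩

/-- Totally real abelian subalgebras that span `T_a Z` come from tube realizations. -/
theorem IsAbelianSubalgebra.exists_tubeRealization [FiniteDimensional ℂ E] [FiniteDimensional ℝ F]
    [IsManifold 𝓘(ℂ, E) ω Z] (h𝔳 : IsAbelianSubalgebra ι a 𝔳) (hspan : SpansTangent ι a 𝔳)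
    (hreal : IsTotallyReal ι a 𝔳) : ∃ R : TubeRealization ι a, R.translationAlgebra = 𝔳 := by
  obtain ⟨n, X, hX𝔳, hX, b, hb⟩ := h𝔳.exists_frame hspan
  obtain ⟨B, φ, hBc, hBs, hφ, hφX, hφY⟩ := exists_tube_of_frame hX b hb
    fun k l => h𝔳.abelian _ _ (hX𝔳 k) (hX𝔳 l)
  let R : TubeRealization ι a := ⟨n, B, hBc, hBs, φ, hφ⟩
  have hsum : ∀ v : Fin n → ℝ, germ a (∑ k, v k • X k) ∈ 𝔳 ∧
      ∀ᶠ p in 𝓝 a, dEmb (Fin n → ℂ) F φ p ((∑ k, v k • X k) p) = ofRealPi n v := by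
    intro v
    refine ⟨?_, ?_⟩
    · change (nullFields F a).mkQ _ ∈ 𝔳
      rw [map_sum]
      refine Submodule.sum_mem _ fun k _ => ?_
      rw [map_smul]
      exact Submodule.smul_mem _ _ (hX𝔳 k)
    · filter_upwards [hφX] with p hp
      rw [Finset.sum_apply, map_sum]
      simp only [Pi.smul_apply, map_smul, hp]
      ext j
      simp [Finset.sum_apply, Pi.single_apply, apply_ite]
  refine ⟨R, le_antisymm ?_ ?_⟩
  · intro ξ hξ
    obtain ⟨Y, rfl⟩ := exists_germ_eq ξ
    obtain ⟨v, hv⟩ := R.germ_mem_iff.1 hξ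
    rw [germ_eq_iff.2 (R.eventually_eq_of_dEmb hv (hsum v).2)]
    exact (hsum v).1
  · intro ξ hξ
    obtain ⟨Y, rfl, hY⟩ := h𝔳.subset_hol hξ
    obtain ⟨c, hc⟩ := hφY Y hY fun k => h𝔳.abelian _ _ (hX𝔳 k) hξ
    have h1 : germ a (Y - ∑ k, rePi n c k • X k) ∈ 𝔳 := by
      change (nullFields F a).mkQ _ ∈ 𝔳
      rw [map_sub]
      exact Submodule.sub_mem _ hξ (hsum _).1
    -- Subtracting the real part of `c` from `Y` leaves `i` times the field with coefficients `Im
    -- c`. Both fields lie in `𝔳`, so total reality applies.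
    have h2 : germ a (∑ k, imPi n c k • X k) = 0 := by
      refine hreal _ _ (hsum _).1 h1 ?_
      filter_upwards [hc, (hsum (rePi n c)).2, (hsum (imPi n c)).2, hφ.cr] with p e1 e2 e3 e4
      refine (e4 _ _).2 ?_
      rw [e3, Pi.sub_apply, map_sub, e1, e2, sub_eq_iff_eq_add, add_comm]
      exact (re_add_I_im c).symm
    have h3 : imPi n c = 0 := by
      have e1 := (germ_eq_zero_iff.1 h2).self_of_nhds
      have e2 := (hsum (imPi n c)).2.self_of_nhds
      rw [e1, map_zero] at e2
      rw [← rePi_ofRealPi (imPi n c), ← e2, map_zero]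
    refine R.germ_mem_iff.2 ⟨rePi n c, hc.mono fun p hp => ?_⟩
    refine hp.trans ?_
    conv_lhs => rw [← re_add_I_im c, h3, map_zero, smul_zero, add_zero]

/-- Total reality yields a tube realization, and its reflection is the involution; the converse is
pointwise antilinearity. -/
theorem isTotallyReal_iff [FiniteDimensional ℂ E] [FiniteDimensional ℝ F]
    [IsManifold 𝓘(ℂ, E) ω Z] (h𝔳 : IsAbelianSubalgebra ι a 𝔳) (hspan : SpansTangent ι a 𝔳) :
    IsTotallyReal ι a 𝔳 ↔ ∃ τ, IsInvolutionFor ι a 𝔳 τ := by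
  have : CompleteSpace F := FiniteDimensional.complete ℝ F
  refine ⟨fun h => ?_, fun ⟨τ, hτ⟩ => isTotallyReal_of_isInvolutionFor hτ⟩
  obtain ⟨R, rfl⟩ := h𝔳.exists_tubeRealization hspan h
  exact R.isTubeSubalgebra.exists_involution

end Realization

/-! ### Uniqueness, fixed points and the `-1`-eigenspace. -/

section FixedPoints
variable {E : Type uE} [NormedAddCommGroup E] [NormedSpace ℂ E]
  {Z : Type uZ} [TopologicalSpace Z] [ChartedSpace E Z]
  {F : Type uF} [NormedAddCommGroup F] [NormedSpace ℝ F]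
  {M : Type uM} [TopologicalSpace M] [ChartedSpace F M]
  {ι : GenericEmbedding E Z F M} {a : M}

theorem IsInvolution.tendsto {τ : M → M} (hτ : IsInvolution ι a τ) : Tendsto τ (𝓝 a) (𝓝 a) := by
  have := hτ.analytic.continuousAt.tendsto
  rwa [hτ.map_base] at this

variable [IsManifold 𝓘(ℝ, F) ω M]

theorem TubeRealization.eq_reflect (R : TubeRealization ι a) {τ : M → M}
    (hτ : IsInvolutionFor ι a R.translationAlgebra τ) :
    ∀ᶠ p in 𝓝 a, R.toFun (τ p) = reflect (rePi R.r (R.toFun a)) (R.toFun p) :=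
  R.isCRIsoOnto.eq_reflect hτ.1
    ((R.inNegEigenspace_iff hτ.1.map_base hτ.1.analytic.continuousAt).1 hτ.2)

/-- Both involutions are the same reflection in tube coordinates, and those coordinates separate
points near `a`. -/
theorem TubeRealization.involution_unique (R : TubeRealization ι a) {τ τ' : M → M}
    (hτ : IsInvolutionFor ι a R.translationAlgebra τ)
    (hτ' : IsInvolutionFor ι a R.translationAlgebra τ') : τ' =ᶠ[𝓝 a] τ := by
  refine R.isCRIsoOnto.eventually_eq hτ'.1.tendsto hτ.1.tendsto ?_
  filter_upwards [R.eq_reflect hτ, R.eq_reflect hτ'] with p h1 h2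
  rw [h1, h2]

theorem TubeRealization.eventually_fixed_iff (R : TubeRealization ι a) {τ : M → M}
    (hτ : IsInvolutionFor ι a R.translationAlgebra τ) :
    ∀ᶠ p in 𝓝 a, τ p = p ↔ rePi R.r (R.toFun p) = rePi R.r (R.toFun a) := by
  obtain ⟨ψ, -, hψφ, -⟩ := R.isCRIsoOnto.inverse
  filter_upwards [R.eq_reflect hτ, hψφ, hτ.1.tendsto.eventually hψφ] with p h1 h2 h3
  rw [← sub_eq_zero (a := rePi R.r (R.toFun p)), ← reflect_eq_iff, ← h1]
  exact ⟨fun h => by rw [h], fun h => by rw [← h3, h, h2]⟩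

/-- The fixed point set of the involution is a submanifold. -/
theorem TubeRealization.isAnalyticSubmanifoldAt_fixed [FiniteDimensional ℝ F]
    (R : TubeRealization ι a) {τ : M → M}
    (hτ : IsInvolutionFor ι a R.translationAlgebra τ) :
    IsAnalyticSubmanifoldAt F {p : M | τ p = p} (crDim ι a) a := by
  set φ := R.toFun with hφdef
  set κ := extChartAt 𝓘(ℝ, F) a with hκ
  have hκa : κ.symm (κ a) = a := extChartAt_to_inv a
  have hφ : ContDiffAt ℝ ω (φ ∘ κ.symm) (κ a) :=
    contDiffAt_comp_extChartAt_symm R.isCRIsoOnto.analytic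
  -- Near `a` the fixed points are a level set of the real part of the coordinates. This map is a
  -- submersion because all real vectors are tangent to the tube, and `IsTubeFrame.finrank_ker`
  -- computes the dimension of its kernel.
  set h : F → Fin R.r → ℝ := fun x => rePi R.r (φ (κ.symm x)) with hh
  have hhan : ContDiffAt ℝ ω h (κ a) := (rePi R.r).contDiff.contDiffAt.comp (κ a) hφ
  have hfr : IsTubeFrame ι φ (κ.symm (κ a)) := by
    rw [hκa]; exact R.isCRIsoOnto.eventually_isTubeFrame.self_of_nhds
  obtain ⟨P, hP⟩ := isInvertible_mfderiv_extChartAt_symm_of_mem (mem_extChartAt_target a :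
    κ a ∈ κ.target)
  set L : F →L[ℝ] Fin R.r → ℝ := rePi R.r ∘L dEmb (Fin R.r → ℂ) F φ (κ.symm (κ a)) with hL
  let P' : F ≃L[ℝ] F := P
  have hfd : ∀ u, fderiv ℝ h (κ a) u = L (P' u) := by
    intro u
    have h1 : fderiv ℝ h (κ a) = rePi R.r ∘L fderiv ℝ (φ ∘ κ.symm) (κ a) :=
      ((rePi R.r).hasFDerivAt.comp (κ a) (hφ.differentiableAt (by simp)).hasFDerivAt).fderiv
    have h2 := fderiv_comp_extChartAt_symm (f := φ) (mem_extChartAt_target a) hfr.mdiff u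
    rw [h1]
    refine (congrArg (rePi R.r) h2).trans ?_
    exact congrArg (fun A : F →L[ℝ] F => L (A u)) hP.symm
  have hsurj : Function.Surjective (fderiv ℝ h (κ a)) := by
    intro v
    obtain ⟨u, hu⟩ := hfr.exists_real v
    obtain ⟨u', hu'⟩ := P'.surjective u
    refine ⟨u', ?_⟩
    rw [hfd, hu']
    exact (congrArg (rePi R.r) hu).trans (rePi_ofRealPi v)
  have hker : Module.finrank ℝ (fderiv ℝ h (κ a)).ker = crDim ι a := by
    have h1 : (fderiv ℝ h (κ a)).ker = L.ker.comap P'.toLinearEquiv.toLinearMap := by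
      ext u
      rw [Submodule.mem_comap, LinearMap.mem_ker, LinearMap.mem_ker]
      exact Eq.congr_left (hfd u)
    rw [h1, (P'.toLinearEquiv.ofSubmodule' L.ker).finrank_eq, hfr.finrank_ker, hκa]
  obtain ⟨e, hae, he, he', hek⟩ := exists_linearization hhan hsurj
  obtain ⟨U, hU, hUo, haU⟩ := eventually_nhds_iff.1 (R.eventually_fixed_iff hτ)
  set c : OpenPartialHomeomorph M F := ((chartAt F a) ≫ₕ e).restrOpen U hUo with hc
  have hcsrc : ∀ {p}, p ∈ c.source ↔
      (p ∈ (chartAt F a).source ∧ chartAt F a p ∈ e.source) ∧ p ∈ U := by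
    intro p
    simp [hc]
  refine ⟨hτ.1.map_base, c, c.mem_maximalAtlas_of_contMDiffOn ?_ ?_, ?_,
    (fderiv ℝ h (κ a)).ker, hker, ?_⟩
  · intro p hp
    obtain ⟨⟨hp1, hp2⟩, -⟩ := hcsrc.1 hp
    refine ContMDiffAt.contMDiffWithinAt ?_
    exact ContMDiffAt.comp (g := e) (f := chartAt F a) p
      (he.contDiffAt (e.open_source.mem_nhds hp2)).contMDiffAt
      (contMDiffAt_of_mem_maximalAtlas (IsManifold.chart_mem_maximalAtlas a) hp1)
  · intro x hx
    have h1 : x ∈ e.target ∧ e.symm x ∈ (chartAt F a).target := by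
      simp [hc] at hx
      exact hx.1
    refine ContMDiffAt.contMDiffWithinAt ?_
    exact ContMDiffAt.comp (g := (chartAt F a).symm) (f := e.symm) x
      (contMDiffAt_symm_of_mem_maximalAtlas (IsManifold.chart_mem_maximalAtlas a) h1.2)
      (he'.contDiffAt (e.open_target.mem_nhds h1.1)).contMDiffAt
  · exact hcsrc.2 ⟨⟨mem_chart_source F a, by simpa [hκ] using hae⟩, haU⟩
  · intro p hp
    obtain ⟨⟨hp1, hp2⟩, hp3⟩ := hcsrc.1 hp
    rw [mem_ofPred_eq, hU p hp3]
    have h1 := hek _ hp2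
    have h2 : κ.symm (chartAt F a p) = p := (chartAt F a).left_inv hp1
    rw [hh] at h1
    simp only [h2, hκa] at h1
    exact h1

/-- The `-1`-eigenspace of the involution on `T_a M` is totally real of maximal dimension. -/
theorem TubeRealization.finrank_negTangent [FiniteDimensional ℝ F]
    (R : TubeRealization ι a) {τ : M → M}
    (hτ : IsInvolutionFor ι a R.translationAlgebra τ) :
    Module.finrank ℝ (negTangent F a τ) = Module.finrank ℂ E := by
  have hfr := R.isCRIsoOnto.eventually_isTubeFrame.self_of_nhds
  rw [hfr.finrank_eq]
  set D : F →L[ℝ] Fin R.r → ℂ := dEmb (Fin R.r → ℂ) F R.toFun a with hD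
  set A : F →L[ℝ] F := mfderiv 𝓘(ℝ, F) 𝓘(ℝ, F) τ a with hA
  have hDA : ∀ u : F, D (A u) = negConj R.r (D u) := by
    intro u
    have h1 := (eventually_dEmb_lift R.isCRIsoOnto.analytic R.isCRIsoOnto.analytic
      hτ.1.map_base hτ.1.analytic (hasFDerivAt_reflect _) (R.eq_reflect hτ)).self_of_nhds u
    refine Eq.trans ?_ h1
    have h2 : ∀ q, q = a → ∀ w : F, D w = dEmb (Fin R.r → ℂ) F R.toFun q w := by
      rintro _ rfl w; rfl
    exact h2 _ hτ.1.map_base _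
  have hDinj : ∀ u v : F, D u = D v → u = v := hfr.inj
  -- `D` intertwines `dτ` with `z ↦ -conj z`, whose `-1`-eigenspace is `ℝ^r`.
  have hmem : ∀ u : F, u ∈ negTangent F a τ ↔ imPi R.r (D u) = 0 := by
    intro u
    have h1 : u ∈ negTangent F a τ ↔ A u = -u := by
      rw [← neg_one_smul ℝ u]
      exact Module.End.mem_eigenspace_iff
    rw [h1]
    have h2 : A u = -u ↔ negConj R.r (D u) = -D u := by
      rw [← hDA, ← map_neg]
      exact ⟨fun h => by rw [h], hDinj _ _⟩
    rw [h2, negConj_apply]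
    constructor
    · intro h
      have h3 := congrArg (imPi R.r) h
      rw [map_add, map_neg, map_neg, imPi_ofRealPi, imPi_I_smul, rePi_ofRealPi, neg_zero,
        zero_add] at h3
      exact self_eq_neg.1 h3
    · intro h
      conv_rhs => rw [← re_add_I_im (D u)]
      rw [h]
      simp
  let Ψ : negTangent F a τ →ₗ[ℝ] (Fin R.r → ℝ) :=
    ((rePi R.r ∘L D : F →L[ℝ] Fin R.r → ℝ) : F →ₗ[ℝ] Fin R.r → ℝ) ∘ₗ (negTangent F a τ).subtype
  have hbij : Function.Bijective Ψ := by
    constructor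
    · rintro ⟨u, hu⟩ ⟨v, hv⟩ huv
      refine Subtype.ext (hDinj _ _ (ext_re_im huv ?_))
      rw [(hmem u).1 hu, (hmem v).1 hv]
    · intro v
      obtain ⟨u, hu⟩ := hfr.exists_real v
      refine ⟨⟨u, (hmem u).2 ?_⟩, ?_⟩
      · exact (congrArg (imPi R.r) hu).trans (imPi_ofRealPi v)
      · exact (congrArg (rePi R.r) hu).trans (rePi_ofRealPi v)
  rw [(LinearEquiv.ofBijective Ψ hbij).finrank_eq, Module.finrank_fin_fun]

end FixedPoints

/-! ### Automorphisms, pushforwards and conjugation. -/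

section Automorphisms
variable {E : Type uE} [NormedAddCommGroup E] [NormedSpace ℂ E]
  {Z : Type uZ} [TopologicalSpace Z] [ChartedSpace E Z]
  {F : Type uF} [NormedAddCommGroup F] [NormedSpace ℝ F]
  {M : Type uM} [TopologicalSpace M] [ChartedSpace F M]
  {ι : GenericEmbedding E Z F M} {a : M} {g h g' h' : M → M}

theorem IsCRGerm.tendsto (H : IsCRGerm ι a g) : Tendsto g (𝓝 a) (𝓝 a) := by
  have := H.analytic.continuousAt.tendsto
  rwa [H.map_base] at this

theorem IsAutPair.symm (H : IsAutPair ι a g h) : IsAutPair ι a h g :=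
  ⟨H.right, H.left, H.right_inv, H.left_inv⟩

theorem isAutPair_id : IsAutPair ι a id id := by
  have h : IsCRGerm ι a id := by
    refine ⟨rfl, contMDiffAt_id, Eventually.of_forall fun p v w hvw => ?_⟩
    rw [mfderiv_id]
    exact hvw
  exact ⟨h, h, Eventually.of_forall fun _ => rfl, Eventually.of_forall fun _ => rfl⟩

/-- The vector fields `X` and `Y = g_* X` are related by `g` near `a`. -/
def Related (a : M) (g : M → M) (X Y : ∀ p : M, TangentSpace 𝓘(ℝ, F) p) : Prop :=
  ∀ᶠ p in 𝓝 a, mfderiv 𝓘(ℝ, F) 𝓘(ℝ, F) g p (X p) = Y (g p)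

variable {X X' Y : ∀ p : M, TangentSpace 𝓘(ℝ, F) p}

theorem exists_related (H : IsAutPair ι a g h) (X : ∀ p : M, TangentSpace 𝓘(ℝ, F) p) :
    ∃ Y, Related a g X Y := by
  refine ⟨fun p => (mfderiv 𝓘(ℝ, F) 𝓘(ℝ, F) g (h p) (X (h p)) : F), ?_⟩
  filter_upwards [H.left_inv] with p h1
  rw [h1]

variable {𝔳 𝔳' 𝔳'' : Submodule ℝ (VFGerm F a)}

theorem isPushforward_id : IsPushforward a id 𝔳 𝔳 := by
  intro Y
  have h : ∀ p, mfderiv 𝓘(ℝ, F) 𝓘(ℝ, F) (id : M → M) p = ContinuousLinearMap.id ℝ _ :=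
    fun p => mfderiv_id
  constructor
  · refine fun hY => ⟨Y, hY, Eventually.of_forall fun p => ?_⟩
    rw [h]
    rfl
  · rintro ⟨X, hX, hXY⟩
    rwa [← germ_eq_iff.2]
    filter_upwards [hXY] with p hp
    rw [h] at hp
    exact hp

/-- Used to recognize an arbitrary pushforward as the translation algebra of a modified realization.
-/
theorem IsPushforward.unique (hg : IsPushforward a g 𝔳 𝔳') (hg' : IsPushforward a g 𝔳 𝔳'') :
    𝔳' = 𝔳'' := by
  ext ξ
  obtain ⟨Y, rfl⟩ := exists_germ_eq ξ
  rw [hg Y, hg' Y]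

variable [IsManifold 𝓘(ℝ, F) ω M]

theorem IsCRGerm.eventually_mdifferentiableAt (H : IsCRGerm ι a g) :
    ∀ᶠ p in 𝓝 a, MDifferentiableAt 𝓘(ℝ, F) 𝓘(ℝ, F) g p :=
  CRTube.eventually_mdifferentiableAt H.analytic

theorem IsCRGerm.eventually_mfderiv_comp (H' : IsCRGerm ι a g') (H : IsCRGerm ι a g) :
    ∀ᶠ p in 𝓝 a, ∀ u : TangentSpace 𝓘(ℝ, F) p, mfderiv 𝓘(ℝ, F) 𝓘(ℝ, F) (g' ∘ g) p u =
      mfderiv 𝓘(ℝ, F) 𝓘(ℝ, F) g' (g p) (mfderiv 𝓘(ℝ, F) 𝓘(ℝ, F) g p u) := by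
  filter_upwards [H.eventually_mdifferentiableAt,
    H.tendsto.eventually H'.eventually_mdifferentiableAt] with p h1 h2 u
  rw [mfderiv_comp p h2 h1]
  rfl

theorem IsCRGerm.comp (H' : IsCRGerm ι a g') (H : IsCRGerm ι a g) : IsCRGerm ι a (g' ∘ g) := by
  refine ⟨by simp [H.map_base, H'.map_base],
    ContMDiffAt.comp_of_eq H'.analytic H.analytic H.map_base, ?_⟩
  filter_upwards [H.cr, H.tendsto.eventually H'.cr, H'.eventually_mfderiv_comp H]
    with p h1 h2 h3 v w hvw
  rw [h3, h3]
  exact h2 _ _ (h1 v w hvw)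

theorem IsAutPair.comp (H' : IsAutPair ι a g' h') (H : IsAutPair ι a g h) :
    IsAutPair ι a (g' ∘ g) (h ∘ h') := by
  refine ⟨H'.left.comp H.left, H.right.comp H'.right, ?_, ?_⟩
  · filter_upwards [H.left_inv, H.left.tendsto.eventually H'.left_inv] with p h1 h2
    simp [h1, h2]
  · filter_upwards [H'.right_inv, H'.right.tendsto.eventually H.right_inv] with p h1 h2
    simp [h1, h2]

theorem IsAutPair.eventually_mfderiv (H : IsAutPair ι a g h) :
    ∀ᶠ p in 𝓝 a, ∀ u : F,
      (mfderiv 𝓘(ℝ, F) 𝓘(ℝ, F) h (g p) (mfderiv 𝓘(ℝ, F) 𝓘(ℝ, F) g p u) : F) = u := by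
  filter_upwards [H.right.eventually_mfderiv_comp H.left, H.left_inv.eventually_nhds]
    with p h1 h2 u
  have h3 : HasMFDerivAt 𝓘(ℝ, F) 𝓘(ℝ, F) (h ∘ g) p
      (ContinuousLinearMap.id ℝ (TangentSpace 𝓘(ℝ, F) p)) :=
    (hasMFDerivAt_id p).congr_of_eventuallyEq h2
  refine (h1 u).symm.trans ?_
  exact congrArg (fun A : F →L[ℝ] F => A u) h3.mfderiv

theorem Related.symm (H : IsAutPair ι a g h) (hXY : Related a g X Y) : Related a h Y X := by
  filter_upwards [H.right.tendsto.eventually hXY, H.right_inv,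
    H.right.tendsto.eventually H.eventually_mfderiv] with p h1 h2 h3
  have h4 := h3 (X (h p))
  rw [h1] at h4
  refine Eq.trans ?_ h4
  rw [h2]

theorem Related.germ_eq (H : IsAutPair ι a g h) (hXY : Related a g X Y)
    (hXY' : Related a g X' Y) : germ a X = germ a X' := by
  rw [germ_eq_iff]
  filter_upwards [hXY, hXY', H.eventually_mfderiv] with p h1 h2 h3
  refine (h3 (X p)).symm.trans (Eq.trans ?_ (h3 (X' p)))
  rw [h1, h2]

/-- Every field has a related partner under an automorphism, and the partner on the source side is
unique as a germ, so the existential can be replaced by a condition on all related pairs. That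
condition is symmetric in `g` and its inverse. -/
theorem isPushforward_iff (H : IsAutPair ι a g h) : IsPushforward a g 𝔳 𝔳' ↔
    ∀ X Y : (∀ p : M, TangentSpace 𝓘(ℝ, F) p), Related a g X Y →
      (germ a X ∈ 𝔳 ↔ germ a Y ∈ 𝔳') := by
  constructor
  · intro hg X Y hXY
    refine ⟨fun hX => (hg Y).2 ⟨X, hX, hXY⟩, fun hY => ?_⟩
    obtain ⟨X', hX', hXY'⟩ := (hg Y).1 hY
    rwa [hXY.germ_eq H hXY']
  · intro hg Y
    refine ⟨fun hY => ?_, fun ⟨X, hX, hXY⟩ => (hg X Y hXY).1 hX⟩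
    obtain ⟨X, hX⟩ := exists_related H.symm Y
    exact ⟨X, (hg X Y (hX.symm H.symm)).2 hY, hX.symm H.symm⟩

theorem IsPushforward.symm (H : IsAutPair ι a g h) (hg : IsPushforward a g 𝔳 𝔳') :
    IsPushforward a h 𝔳' 𝔳 := by
  rw [isPushforward_iff H.symm]
  exact fun X Y hXY => ((isPushforward_iff H).1 hg Y X (hXY.symm H.symm)).symm

theorem IsPushforward.comp (H : IsAutPair ι a g h) (H' : IsAutPair ι a g' h')
    (hg : IsPushforward a g 𝔳 𝔳') (hg' : IsPushforward a g' 𝔳' 𝔳'') :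
    IsPushforward a (g' ∘ g) 𝔳 𝔳'' := by
  rw [isPushforward_iff (H'.comp H)]
  intro X W hXW
  obtain ⟨Y, hXY⟩ := exists_related H X
  rw [(isPushforward_iff H).1 hg X Y hXY]
  refine (isPushforward_iff H').1 hg' Y W ?_
  have h1 : ∀ᶠ p in 𝓝 a, mfderiv 𝓘(ℝ, F) 𝓘(ℝ, F) g' (g p) (Y (g p)) = W (g' (g p)) := by
    filter_upwards [hXW, hXY, H'.left.eventually_mfderiv_comp H.left] with p h1 h2 h3
    rw [← h2, ← h3, h1]
    rfl
  filter_upwards [H.right.tendsto.eventually h1, H.right_inv] with p h2 h3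
  rwa [h3] at h2

theorem TubeSubalgebra.equivalence_conjugate :
    Equivalence (TubeSubalgebra.Conjugate (ι := ι) (a := a)) where
  refl _ := ⟨id, ⟨id, isAutPair_id⟩, isPushforward_id⟩
  symm := fun ⟨_, ⟨h, H⟩, hg⟩ => ⟨h, ⟨_, H.symm⟩, hg.symm H⟩
  trans := fun ⟨_, ⟨_, H⟩, hg⟩ ⟨_, ⟨_, H'⟩, hg'⟩ => ⟨_, ⟨_, H'.comp H⟩, hg.comp H H' hg'⟩

/-- The composition of a tube realization with an automorphism. -/
def TubeRealization.compAut (R : TubeRealization ι a) (H : IsAutPair ι a g h) :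
    TubeRealization ι a where
  r := R.r
  base := R.base
  isConnected_base := R.isConnected_base
  submanifold_base := R.submanifold_base
  toFun := R.toFun ∘ h
  isCRIsoOnto := by
    have hR := R.isCRIsoOnto
    refine ⟨?_, H.right.tendsto.eventually hR.mapsTo, ?_, ?_⟩
    · exact ContMDiffAt.comp_of_eq hR.analytic H.right.analytic H.right.map_base
    · obtain ⟨ψ, hψ, hψφ, hφψ⟩ := hR.inverse
      have hψa : ψ (R.toFun a) = a := hψφ.self_of_nhds
      have hψt : Tendsto ψ (𝓝 (R.toFun a)) (𝓝 a) := by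
        have := hψ.continuousAt.tendsto
        rwa [hψa] at this
      rw [Function.comp_apply, H.right.map_base]
      refine ⟨g ∘ ψ, ContMDiffAt.comp_of_eq H.left.analytic hψ hψa, ?_, ?_⟩
      · filter_upwards [H.right_inv, H.right.tendsto.eventually hψφ] with p h1 h2
        simp [h1, h2]
      · filter_upwards [hφψ, (hψt.eventually H.left_inv).filter_mono nhdsWithin_le_nhds]
          with z h1 h2
        simp [h1, h2]
    · filter_upwards [H.right.cr, H.right.tendsto.eventually H.left.cr,
        H.right.tendsto.eventually hR.cr, H.right.eventually_mdifferentiableAt,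
        H.right.tendsto.eventually (CRTube.eventually_mdifferentiableAt hR.analytic),
        H.symm.eventually_mfderiv, H.right_inv] with p h1 h2 h3 h4 h5 h6 h7 v w
      rw [dEmb_comp h5 h4, dEmb_comp h5 h4, ← h3]
      refine ⟨h1 v w, fun hJ => ?_⟩
      -- For the converse, `dg` at `h p` carries the `J`-relation back to `p`; the remaining work is
      -- transport along `g (h p) = p`.
      have h8 := h2 _ _ hJ
      have h9 : ∀ q, q = p → ∀ v' w' : F, v' = v → w' = w → IsJ ι q v' w' → IsJ ι p v w := by
        rintro _ rfl _ _ rfl rfl h; exact h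
      exact h9 _ h7 _ _ (h6 v) (h6 w) h8

/-- If `Y = g_* X`, the composed coordinates see `Y` at `p` exactly as the old ones see `X` at `h
p`, so the constant vector is the same. Conditions (i') and (ii) for a pushforward of a translation
algebra thus need no separate check. -/
theorem TubeRealization.isPushforward_compAut (R : TubeRealization ι a) (H : IsAutPair ι a g h) :
    IsPushforward a g R.translationAlgebra (R.compAut H).translationAlgebra := by
  rw [isPushforward_iff H]
  intro X Y hXY
  rw [R.germ_mem_iff, (R.compAut H).germ_mem_iff]
  refine exists_congr fun v => ?_
  have h1 : ∀ᶠ p in 𝓝 a, dEmb (Fin R.r → ℂ) F (R.toFun ∘ h) p (Y p) =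
      dEmb (Fin R.r → ℂ) F R.toFun (h p) (X (h p)) := by
    filter_upwards [hXY.symm H, H.right.eventually_mdifferentiableAt,
      H.right.tendsto.eventually (CRTube.eventually_mdifferentiableAt R.isCRIsoOnto.analytic)]
      with p h1 h2 h3
    rw [dEmb_comp h3 h2, h1]
  constructor
  · intro h2
    filter_upwards [h1, H.right.tendsto.eventually h2] with p h3 h4
    exact h3.trans h4
  · intro h2
    filter_upwards [H.left.tendsto.eventually h1, H.left.tendsto.eventually h2, H.left_inv]
      with p h3 h4 h5
    rw [h5] at h3
    exact h3.symm.trans h4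

/-- By the chain rule, an antilinear differential between two CR ones remains antilinear, and the
sign on `X` passes to its related field. -/
theorem IsInvolutionFor.conj {τ : M → M} (H : IsAutPair ι a g h)
    (hg : IsPushforward a g 𝔳 𝔳') (hτ : IsInvolutionFor ι a 𝔳 τ) :
    IsInvolutionFor ι a 𝔳' (g ∘ τ ∘ h) := by
  have hτt := hτ.1.tendsto
  have hd : ∀ᶠ p in 𝓝 a, ∀ u : TangentSpace 𝓘(ℝ, F) p,
      mfderiv 𝓘(ℝ, F) 𝓘(ℝ, F) (g ∘ τ ∘ h) p u = mfderiv 𝓘(ℝ, F) 𝓘(ℝ, F) g (τ (h p))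
        (mfderiv 𝓘(ℝ, F) 𝓘(ℝ, F) τ (h p) (mfderiv 𝓘(ℝ, F) 𝓘(ℝ, F) h p u)) := by
    filter_upwards [H.right.eventually_mdifferentiableAt, H.right.tendsto.eventually
      (CRTube.eventually_mdifferentiableAt hτ.1.analytic), (hτt.comp H.right.tendsto).eventually
      H.left.eventually_mdifferentiableAt] with p h1 h2 h3 u
    rw [mfderiv_comp p (g := g) (f := τ ∘ h) h3 (h2.comp p h1), mfderiv_comp p h2 h1]
    rfl
  refine ⟨⟨?_, ?_, ?_, ?_⟩, ?_⟩
  · simp [H.right.map_base, hτ.1.map_base, H.left.map_base]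
  · refine ContMDiffAt.comp_of_eq H.left.analytic
      (ContMDiffAt.comp_of_eq hτ.1.analytic H.right.analytic H.right.map_base) ?_
    simp [H.right.map_base, hτ.1.map_base]
  · filter_upwards [hd, H.right.cr, H.right.tendsto.eventually hτ.1.antiCR,
      (hτt.comp H.right.tendsto).eventually H.left.cr] with p h1 h2 h3 h4 v w hvw
    have h5 := h4 _ _ (h3 _ _ (h2 v w hvw))
    rw [map_neg] at h5
    rw [h1, h1]
    exact h5
  · filter_upwards [H.right_inv, H.right.tendsto.eventually hτ.1.involutive,
      (hτt.comp H.right.tendsto).eventually H.left_inv] with p h1 h2 h3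
    simp only [Function.comp_apply] at h3 ⊢
    rw [h3, h2, h1]
  · intro Y hY
    obtain ⟨X, hX, hXY⟩ := (hg Y).1 hY
    filter_upwards [hd, Related.symm H hXY, H.right.tendsto.eventually (hτ.2 X hX),
      (hτt.comp H.right.tendsto).eventually hXY] with p h1 h2 h3 h4
    simp only [Function.comp_apply] at h4
    rw [h1, h2, h3, map_neg, h4]
    rfl

end Automorphisms

/-! ### Complexified real maps and real linear parts. -/

section Complexification
variable {r r' : ℕ}

/-- The complex linear extension of a real linear map. -/
def complexify (Q : (Fin r → ℝ) →ₗ[ℝ] (Fin r' → ℝ)) : (Fin r → ℂ) →ₗ[ℂ] (Fin r' → ℂ) where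
  toFun z := ofRealPi r' (Q (rePi r z)) + Complex.I • ofRealPi r' (Q (imPi r z))
  map_add' z w := by
    simp only [map_add, smul_add]
    abel
  map_smul' c z := by
    refine ext_re_im ?_ ?_
    · have h1 : rePi r (c • z) = c.re • rePi r z - c.im • imPi r z := by ext; simp
      have h2 : ∀ w : Fin r' → ℂ, rePi r' (c • w) = c.re • rePi r' w - c.im • imPi r' w := by
        intro w; ext; simp
      simp [h1, h2, sub_eq_add_neg]
    · have h1 : imPi r (c • z) = c.re • imPi r z + c.im • rePi r z := by ext; simp
      have h2 : ∀ w : Fin r' → ℂ, imPi r' (c • w) = c.re • imPi r' w + c.im • rePi r' w := by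
        intro w; ext; simp
      simp [h1, h2, add_comm]

variable (Q : (Fin r → ℝ) →ₗ[ℝ] (Fin r' → ℝ))

theorem complexify_apply (z : Fin r → ℂ) : complexify Q z =
    ofRealPi r' (Q (rePi r z)) + Complex.I • ofRealPi r' (Q (imPi r z)) := rfl

@[simp] theorem rePi_complexify (z : Fin r → ℂ) : rePi r' (complexify Q z) = Q (rePi r z) := by
  simp [complexify_apply]

@[simp] theorem imPi_complexify (z : Fin r → ℂ) : imPi r' (complexify Q z) = Q (imPi r z) := by
  simp [complexify_apply]

@[simp] theorem complexify_ofRealPi (v : Fin r → ℝ) :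
    complexify Q (ofRealPi r v) = ofRealPi r' (Q v) := by
  simp [complexify_apply]

theorem complexify_symm_apply (Q : (Fin r → ℝ) ≃ₗ[ℝ] (Fin r' → ℝ)) (z : Fin r → ℂ) :
    complexify Q.symm.toLinearMap (complexify Q.toLinearMap z) = z :=
  ext_re_im (by simp) (by simp)

/-- For a complex linear isomorphism `A` of `ℂ^r`, some real combination of the real and imaginary
parts of `A` is invertible. -/
theorem exists_real_equiv (A : (Fin r → ℂ) ≃ₗ[ℂ] (Fin r → ℂ)) :
    ∃ (s : ℝ) (Q : (Fin r → ℝ) ≃ₗ[ℝ] (Fin r → ℝ)), ∀ v,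
      Q v = rePi r (A (ofRealPi r v)) + s • imPi r (A (ofRealPi r v)) := by
  set P := LinearMap.toMatrix' A.toLinearMap with hP
  have hPu : IsUnit P := by
    refine IsUnit.of_mul_eq_one (LinearMap.toMatrix' A.symm.toLinearMap) ?_
    rw [hP, ← LinearMap.toMatrix'_comp, A.comp_symm, LinearMap.toMatrix'_id]
  obtain ⟨s, hs⟩ := exists_real_invertible P hPu
  refine ⟨s, Matrix.toLinearEquiv' _ hs.invertible, fun v => ?_⟩
  have hA : ∀ z, A z = P.mulVec z := fun z => by
    rw [hP, ← Matrix.toLin'_apply, Matrix.toLin'_toMatrix']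
    rfl
  ext k
  change ((P.map Complex.re + s • P.map Complex.im).mulVec v) k = _
  simp [hA, Matrix.mulVec, dotProduct, add_mul, Finset.sum_add_distrib, Finset.mul_sum, mul_assoc]

end Complexification

/-! ### Making affine maps of tubes real. -/

section TubeMaps
variable {r r' : ℕ} {B : Set (Fin r → ℝ)} {B' : Set (Fin r' → ℝ)}

/-- An affine isomorphism between germs of tubes can be replaced by one with a real linear
part. -/
theorem exists_real_affine (hr : r = r') (l : (Fin r → ℂ) ≃ᵃ[ℂ] (Fin r' → ℂ)) {c : Fin r → ℂ}
    {c' : Fin r' → ℂ} (hl : l c = c') (h : ∀ᶠ z in 𝓝 c, z ∈ tube B ↔ l z ∈ tube B') :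
    ∃ Q : (Fin r → ℝ) ≃ₗ[ℝ] (Fin r' → ℝ),
      ∀ᶠ z in 𝓝 c, z ∈ tube B ↔ c' + complexify Q.toLinearMap (z - c) ∈ tube B' := by
  subst hr
  obtain ⟨s, Q, hQ⟩ := exists_real_equiv l.linear
  refine ⟨Q, ?_⟩
  have hlz : ∀ z, l z = c' + l.linear (z - c) := by
    intro z
    have := l.map_vadd c (z - c)
    simp only [vadd_eq_add, sub_add_cancel] at this
    rw [this, hl, add_comm]
  -- A real shift does not affect membership in the tube. This one turns `z - c` into `(s + i) y`
  -- with `y = Im (z - c)`, and if `P` is the linear part of `l` then `Im P((s + i) y) = Re (P y) +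
  -- s Im (P y) = Q y`.
  set S : (Fin r → ℂ) → (Fin r → ℂ) := fun z =>
    z + ofRealPi r (s • imPi r (z - c) - rePi r (z - c)) with hS
  have hSc : Tendsto S (𝓝 c) (𝓝 c) := by
    have h1 : ContinuousAt S c := by
      rw [hS]; fun_prop
    have h2 := h1.tendsto
    rwa [show S c = c by simp [hS]] at h2
  filter_upwards [hSc.eventually h] with z hz
  rw [hS] at hz
  simp only [tube_add_ofReal] at hz
  rw [hz, mem_tube_iff, mem_tube_iff]
  have h1 : imPi r (l (z + ofRealPi r (s • imPi r (z - c) - rePi r (z - c)))) =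
      imPi r (c' + complexify Q.toLinearMap (z - c)) := by
    have h2 : imPi r (complexify Q.toLinearMap (z - c)) = Q (imPi r (z - c)) := imPi_complexify _ _
    rw [hlz, map_add, map_add, h2, hQ]
    congr 1
    have h3 : z + ofRealPi r (s • imPi r (z - c) - rePi r (z - c)) - c =
        ((s : ℂ) + Complex.I) • ofRealPi r (imPi r (z - c)) := by
      refine ext_re_im ?_ ?_
      · simp [add_smul]
        abel
      · simp [add_smul]
    rw [h3, map_smul, add_smul, map_add, imPi_I_smul, add_comm]
    congr 1
    ext k
    simp
  rw [h1]

end TubeMaps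

/-! ### Affine equivalence versus conjugacy. -/

section AffineEquivalence
variable {E : Type uE} [NormedAddCommGroup E] [NormedSpace ℂ E]
  {Z : Type uZ} [TopologicalSpace Z] [ChartedSpace E Z]
  {F : Type uF} [NormedAddCommGroup F] [NormedSpace ℝ F]
  {M : Type uM} [TopologicalSpace M] [ChartedSpace F M]
  {ι : GenericEmbedding E Z F M} {a : M}

theorem TubeRealization.equivalence_affinelyEquivalent :
    Equivalence (TubeRealization.AffinelyEquivalent (ι := ι) (a := a)) where
  refl R := ⟨AffineEquiv.refl ℂ _, rfl, Eventually.of_forall fun z => Iff.rfl⟩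
  symm := by
    rintro R R' ⟨l, hl, h⟩
    have hl' : l.symm (R'.toFun a) = R.toFun a := by rw [← hl, l.symm_apply_apply]
    refine ⟨l.symm, hl', ?_⟩
    have h1 : Tendsto l.symm (𝓝 (R'.toFun a)) (𝓝 (R.toFun a)) := by
      have := (AffineMap.continuous_of_finiteDimensional
        l.symm.toAffineMap).continuousAt.tendsto (x := R'.toFun a)
      rw [← hl']
      exact this
    filter_upwards [h1.eventually h] with z hz
    rw [hz, l.apply_symm_apply]
  trans := by
    rintro R R' R'' ⟨l, hl, h⟩ ⟨l', hl', h'⟩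
    refine ⟨l.trans l', by simp [hl, hl'], ?_⟩
    have h1 : Tendsto l (𝓝 (R.toFun a)) (𝓝 (R'.toFun a)) := by
      have := (AffineMap.continuous_of_finiteDimensional
        l.toAffineMap).continuousAt.tendsto (x := R.toFun a)
      rw [← hl]
      exact this
    filter_upwards [h, h1.eventually h'] with z h2 h3
    rw [h2, h3]
    rfl

/-- Complex linear maps that agree on a germ of a tube are equal. -/
theorem TubeRealization.linearMap_ext (R : TubeRealization ι a) {V : Type*} [AddCommGroup V]
    [Module ℂ V] {A A' : (Fin R.r → ℂ) →ₗ[ℂ] V}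
    (h : ∀ᶠ p in 𝓝 a, A (R.toFun p - R.toFun a) = A' (R.toFun p - R.toFun a)) : A = A' := by
  obtain ⟨ψ, hψ, hψφ, hφψ⟩ := R.isCRIsoOnto.inverse
  have hψt : Tendsto ψ (𝓝 (R.toFun a)) (𝓝 a) := by
    have := hψ.continuousAt.tendsto
    rwa [hψφ.self_of_nhds] at this
  have h1 : ∀ᶠ z in 𝓝[tube R.base] (R.toFun a), A (z - R.toFun a) = A' (z - R.toFun a) := by
    filter_upwards [hφψ, (hψt.eventually h).filter_mono nhdsWithin_le_nhds] with z h2 h3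
    rwa [h2] at h3
  have h2 : ∀ v, A (ofRealPi R.r v) = A' (ofRealPi R.r v) := by
    intro v
    -- The real line through the base point stays in the tube, so the two maps agree on `t v` for
    -- small `t ≠ 0`; real vectors span `ℂ^r` over `ℂ`.
    have h3 : Tendsto (fun t : ℝ => R.toFun a + t • ofRealPi R.r v) (𝓝[≠] 0)
        (𝓝[tube R.base] (R.toFun a)) := by
      refine tendsto_nhdsWithin_iff.2 ⟨?_, Eventually.of_forall fun t => ?_⟩
      · have h4 : Continuous (fun t : ℝ => R.toFun a + t • ofRealPi R.r v) := by fun_prop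
        have h5 := h4.tendsto 0
        simp only [zero_smul, add_zero] at h5
        exact h5.mono_left nhdsWithin_le_nhds
      · rw [← map_smul, tube_add_ofReal]
        exact R.isCRIsoOnto.mapsTo.self_of_nhds
    obtain ⟨t, ht, ht0⟩ := ((h3.eventually h1).and self_mem_nhdsWithin).exists
    have ht0' : (t : ℂ) ≠ 0 := Complex.ofReal_ne_zero.2 ht0
    rw [add_sub_cancel_left, ← Complex.coe_smul, map_smul, map_smul] at ht
    exact (smul_right_injective V ht0') ht
  refine LinearMap.ext fun z => ?_
  rw [← re_add_I_im z, map_add, map_add, map_smul, map_smul, h2, h2]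

variable [IsManifold 𝓘(ℝ, F) ω M]

/-- A real affine map between germs of tubes is induced by a CR-map. -/
theorem TubeRealization.exists_lift (R R' : TubeRealization ι a)
    (Q : (Fin R.r → ℝ) →ₗ[ℝ] (Fin R'.r → ℝ))
    (h : ∀ᶠ z in 𝓝[tube R.base] (R.toFun a),
      R'.toFun a + complexify Q (z - R.toFun a) ∈ tube R'.base) :
    ∃ g : M → M, IsCRGerm ι a g ∧
      (∀ᶠ p in 𝓝 a, R'.toFun (g p) = R'.toFun a + complexify Q (R.toFun p - R.toFun a)) ∧
      ∀ᶠ p in 𝓝 a, ∀ u : TangentSpace 𝓘(ℝ, F) p,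
        dEmb (Fin R'.r → ℂ) F R'.toFun (g p) (mfderiv 𝓘(ℝ, F) 𝓘(ℝ, F) g p u) =
          complexify Q (dEmb (Fin R.r → ℂ) F R.toFun p u) := by
  have hS : ∀ z, HasFDerivAt (fun z => R'.toFun a + complexify Q (z - R.toFun a))
      ((LinearMap.toContinuousLinearMap (complexify Q)).restrictScalars ℝ) z := by
    intro z
    exact (((LinearMap.toContinuousLinearMap (complexify Q)).restrictScalars ℝ).hasFDerivAt.comp z
      ((hasFDerivAt_id z).sub_const (R.toFun a))).const_add (R'.toFun a)
  have hSan : ContDiff ℝ ω (fun z => R'.toFun a + complexify Q (z - R.toFun a)) :=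
    contDiff_const.add
      (((LinearMap.toContinuousLinearMap (complexify Q)).restrictScalars ℝ).contDiff.comp
        (contDiff_id.sub contDiff_const))
  obtain ⟨g, hga, hg, hgφ⟩ := R.isCRIsoOnto.exists_lift R'.isCRIsoOnto hSan.contDiffAt
    (by simp) h
  have hd := eventually_dEmb_lift R.isCRIsoOnto.analytic R'.isCRIsoOnto.analytic hga hg hS hgφ
  have hgt : Tendsto g (𝓝 a) (𝓝 a) := by
    have := hg.continuousAt.tendsto
    rwa [hga] at this
  have hd' : ∀ᶠ p in 𝓝 a, ∀ u : TangentSpace 𝓘(ℝ, F) p,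
      dEmb (Fin R'.r → ℂ) F R'.toFun (g p) (mfderiv 𝓘(ℝ, F) 𝓘(ℝ, F) g p u) =
        complexify Q (dEmb (Fin R.r → ℂ) F R.toFun p u) := hd
  refine ⟨g, ⟨hga, hg, ?_⟩, hgφ, hd'⟩
  filter_upwards [hd', R.isCRIsoOnto.cr, hgt.eventually R'.isCRIsoOnto.cr] with p h1 h2 h3 v w hvw
  rw [h3, h1, h1, (h2 v w).1 hvw, map_smul]

/-- The affine maps given by `Q` and its inverse lift to CR germs, which are mutually inverse
because tube coordinates separate points. As `Q` is real, real translations go to real translations.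
-/
theorem TubeRealization.exists_conjugation (R R' : TubeRealization ι a)
    (Q : (Fin R.r → ℝ) ≃ₗ[ℝ] (Fin R'.r → ℝ))
    (h : ∀ᶠ z in 𝓝 (R.toFun a), z ∈ tube R.base ↔
      R'.toFun a + complexify Q.toLinearMap (z - R.toFun a) ∈ tube R'.base) :
    ∃ g, IsAut ι a g ∧ IsPushforward a g R.translationAlgebra R'.translationAlgebra := by
  have hS : Tendsto (fun z => R.toFun a + complexify Q.symm.toLinearMap (z - R'.toFun a))
      (𝓝 (R'.toFun a)) (𝓝 (R.toFun a)) := by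
    have h1 : Continuous (complexify Q.symm.toLinearMap) :=
      LinearMap.continuous_of_finiteDimensional _
    have h2 : Continuous (fun z => R.toFun a +
      complexify Q.symm.toLinearMap (z - R'.toFun a)) := by fun_prop
    have h3 := h2.tendsto (R'.toFun a)
    simpa using h3
  have hQ : ∀ z, complexify Q.toLinearMap (complexify Q.symm.toLinearMap z) = z :=
    complexify_symm_apply Q.symm
  obtain ⟨g, hg, hgφ, hgd⟩ := R.exists_lift R' Q.toLinearMap (by
    rw [eventually_nhdsWithin_iff]
    exact h.mono fun z hz => hz.1)
  obtain ⟨k, hk, hkφ, hkd⟩ := R'.exists_lift R Q.symm.toLinearMap (by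
    rw [eventually_nhdsWithin_iff]
    filter_upwards [hS.eventually h] with z hz hzB
    rw [hz, add_sub_cancel_left, hQ, add_sub_cancel]
    exact hzB)
  have H : IsAutPair ι a g k := by
    refine ⟨hg, hk, ?_, ?_⟩
    · refine R.isCRIsoOnto.eventually_eq (hk.tendsto.comp hg.tendsto) tendsto_id ?_
      filter_upwards [hgφ, hg.tendsto.eventually hkφ] with p h1 h2
      rw [h2, h1, add_sub_cancel_left, complexify_symm_apply, add_sub_cancel]
    · refine R'.isCRIsoOnto.eventually_eq (hg.tendsto.comp hk.tendsto) tendsto_id ?_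
      filter_upwards [hkφ, hk.tendsto.eventually hgφ] with p h1 h2
      rw [h2, h1, add_sub_cancel_left, hQ, add_sub_cancel]
  refine ⟨g, ⟨k, H⟩, (isPushforward_iff H).2 fun X Y hXY => ?_⟩
  rw [R.germ_mem_iff, R'.germ_mem_iff]
  constructor
  · rintro ⟨v, hv⟩
    refine ⟨Q v, ?_⟩
    have h1 : ∀ᶠ p in 𝓝 a, dEmb (Fin R'.r → ℂ) F R'.toFun (g p) (Y (g p)) =
        ofRealPi R'.r (Q v) := by
      filter_upwards [hXY, hgd, hv] with p h1 h2 h3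
      rw [← h1, h2, h3, complexify_ofRealPi]
      rfl
    filter_upwards [hk.tendsto.eventually h1, H.right_inv] with p h2 h3
    rwa [h3] at h2
  · rintro ⟨w, hw⟩
    refine ⟨Q.symm w, ?_⟩
    filter_upwards [hXY, hgd, hg.tendsto.eventually hw] with p h1 h2 h3
    rw [← h1, h2] at h3
    rw [← complexify_symm_apply Q (dEmb _ F R.toFun p (X p)), h3, complexify_ofRealPi]
    rfl

/-- The given isomorphism need not carry translations to translations: multiplication by `i`
preserves the tube `ℂ`. A conjugation is obtained from its real replacement. -/
theorem TubeRealization.AffinelyEquivalent.exists_conjugation {R R' : TubeRealization ι a}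
    (h : R.AffinelyEquivalent R') :
    ∃ g, IsAut ι a g ∧ IsPushforward a g R.translationAlgebra R'.translationAlgebra := by
  obtain ⟨l, hl, hlt⟩ := h
  have hr : R.r = R'.r := by
    rw [← R.isCRIsoOnto.eventually_isTubeFrame.self_of_nhds.finrank_eq,
      ← R'.isCRIsoOnto.eventually_isTubeFrame.self_of_nhds.finrank_eq]
  obtain ⟨Q, hQ⟩ := exists_real_affine hr l hl hlt
  exact R.exists_conjugation R' Q hQ

/-- A conjugation of translation algebras is affine in tube coordinates. -/
theorem TubeRealization.exists_affine_of_isPushforward [CompleteSpace F]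
    (R R' : TubeRealization ι a) {g h : M → M} (H : IsAutPair ι a g h)
    (hg : IsPushforward a g R.translationAlgebra R'.translationAlgebra) :
    ∃ A : (Fin R.r → ℂ) →ₗ[ℂ] (Fin R'.r → ℂ),
      ∀ᶠ p in 𝓝 a, R'.toFun (g p) = R'.toFun a + A (R.toFun p - R.toFun a) := by
  have hw : ∀ k : Fin R.r, ∃ (X : ∀ p : M, TangentSpace 𝓘(ℝ, F) p) (w : Fin R'.r → ℝ),
      (∀ᶠ p in 𝓝 a, dEmb (Fin R.r → ℂ) F R.toFun p (X p) = ofRealPi R.r (Pi.single k 1)) ∧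
      ∀ᶠ p in 𝓝 a, dEmb (Fin R'.r → ℂ) F R'.toFun (g p)
        (mfderiv 𝓘(ℝ, F) 𝓘(ℝ, F) g p (X p)) = ofRealPi R'.r w := by
    intro k
    obtain ⟨X, -, hX⟩ := R.exists_isInfinitesimalCR (Pi.single k 1)
    obtain ⟨Y, hXY⟩ := exists_related H X
    obtain ⟨w, hw⟩ := R'.germ_mem_iff.1
      (((isPushforward_iff H).1 hg X Y hXY).1 (R.germ_mem_iff.2 ⟨_, hX⟩))
    refine ⟨X, w, hX, ?_⟩
    filter_upwards [hXY, H.left.tendsto.eventually hw] with p h1 h2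
    rw [h1, h2]
  choose X w hX hXw using hw
  -- The columns are the constant real vectors to which `g` moves the coordinate translations. The
  -- differential of `R'.toFun ∘ g` is CR, so it agrees with `A` everywhere once it does on real
  -- translations.
  set A : (Fin R.r → ℂ) →ₗ[ℂ] (Fin R'.r → ℂ) :=
    Fintype.linearCombination ℂ fun k => ofRealPi R'.r (w k) with hA
  have hmd := CRTube.eventually_mdifferentiableAt R.isCRIsoOnto.analytic
  have hmd' := H.left.tendsto.eventually
    (CRTube.eventually_mdifferentiableAt R'.isCRIsoOnto.analytic)
  have hAd : ∀ z, HasFDerivAt (fun z => R'.toFun a + A (z - R.toFun a))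
      ((LinearMap.toContinuousLinearMap A).restrictScalars ℝ) z := fun z =>
    (((LinearMap.toContinuousLinearMap A).restrictScalars ℝ).hasFDerivAt.comp z
      ((hasFDerivAt_id z).sub_const (R.toFun a))).const_add (R'.toFun a)
  refine ⟨A, eventually_eq_of_dEmb_eq (F := F) (f := R'.toFun ∘ g)
    (f' := (fun z => R'.toFun a + A (z - R.toFun a)) ∘ R.toFun) ?_ ?_ ?_ ?_⟩
  · filter_upwards [hmd', H.left.eventually_mdifferentiableAt] with p h1 h2 using h1.comp p h2
  · filter_upwards [hmd] with p h1
    exact (hAd _).differentiableAt.mdifferentiableAt.comp p h1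
  · filter_upwards [hmd, hmd', H.left.eventually_mdifferentiableAt, H.left.cr,
      R.isCRIsoOnto.eventually_isTubeFrame, H.left.tendsto.eventually R'.isCRIsoOnto.cr,
      eventually_all.2 hX, eventually_all.2 hXw] with p h1 h2 h3 h4 h5 h6 h7 h8 u
    rw [dEmb_comp_left (hAd _).differentiableAt h1, (hAd _).fderiv]
    refine h5.apply_eq (dEmb (Fin R'.r → ℂ) F (R'.toFun ∘ g) p :
      TangentSpace 𝓘(ℝ, F) p →ₗ[ℝ] (Fin R'.r → ℂ)) ?_ A ?_ u
    · intro v w hvw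
      change dEmb (Fin R'.r → ℂ) F (R'.toFun ∘ g) p w =
        Complex.I • dEmb (Fin R'.r → ℂ) F (R'.toFun ∘ g) p v
      rw [dEmb_comp h2 h3, dEmb_comp h2 h3]
      exact (h6 _ _).1 (h4 v w hvw)
    · intro v u hu
      have hu' : u = ∑ k, v k • X k p := by
        refine h5.inj _ _ (hu.trans ?_)
        rw [map_sum]
        simp only [map_smul, h7]
        ext j
        simp [Finset.sum_apply, Pi.single_apply, apply_ite]
      rw [hu', hA, Fintype.linearCombination_apply, map_sum]
      refine Finset.sum_congr rfl fun k _ => ?_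
      rw [map_smul]
      change v k • dEmb (Fin R'.r → ℂ) F (R'.toFun ∘ g) p (X k p) = _
      rw [dEmb_comp h2 h3, h8]
      simp
  · simp [H.left.map_base]

/-- Tube realizations with conjugate translation algebras are affinely equivalent. -/
theorem TubeRealization.affinelyEquivalent_of_isPushforward [CompleteSpace F]
    {R R' : TubeRealization ι a} {g : M → M} (hgaut : IsAut ι a g)
    (hg : IsPushforward a g R.translationAlgebra R'.translationAlgebra) :
    R.AffinelyEquivalent R' := by
  obtain ⟨h, H⟩ := hgaut
  obtain ⟨A, hA⟩ := R.exists_affine_of_isPushforward R' H hg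
  obtain ⟨A', hA'⟩ := R'.exists_affine_of_isPushforward R H.symm (hg.symm H)
  have h1 : A' ∘ₗ A = LinearMap.id := by
    refine R.linearMap_ext ?_
    filter_upwards [hA, H.left.tendsto.eventually hA', H.left_inv] with p e1 e2 e3
    rw [e3, e1, add_sub_cancel_left] at e2
    rw [LinearMap.comp_apply, LinearMap.id_apply]
    exact (sub_eq_iff_eq_add'.2 e2).symm
  have h2 : A ∘ₗ A' = LinearMap.id := by
    refine R'.linearMap_ext ?_
    filter_upwards [hA', H.right.tendsto.eventually hA, H.right_inv] with p e1 e2 e3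
    rw [e3, e1, add_sub_cancel_left] at e2
    rw [LinearMap.comp_apply, LinearMap.id_apply]
    exact (sub_eq_iff_eq_add'.2 e2).symm
  -- Tube points near the base point come from points of `M`, which gives one inclusion; the same
  -- statement for the inverse automorphism gives the other.
  have hmaps : ∀ {R R' : TubeRealization ι a} {g h : M → M}
      {A : (Fin R.r → ℂ) →ₗ[ℂ] (Fin R'.r → ℂ)}, IsAutPair ι a g h →
      (∀ᶠ p in 𝓝 a, R'.toFun (g p) = R'.toFun a + A (R.toFun p - R.toFun a)) →
      ∀ᶠ z in 𝓝 (R.toFun a), z ∈ tube R.base →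
        R'.toFun a + A (z - R.toFun a) ∈ tube R'.base := by
    intro R R' g h A H hA
    obtain ⟨ψ, hψ, hψφ, hφψ⟩ := R.isCRIsoOnto.inverse
    have hψt : Tendsto ψ (𝓝 (R.toFun a)) (𝓝 a) := by
      have := hψ.continuousAt.tendsto
      rwa [hψφ.self_of_nhds] at this
    filter_upwards [eventually_nhdsWithin_iff.1 hφψ, hψt.eventually hA,
      hψt.eventually (H.left.tendsto.eventually R'.isCRIsoOnto.mapsTo)] with z e1 e2 e3 hz
    rw [e1 hz] at e2
    rwa [← e2]
  let e : (Fin R.r → ℂ) ≃ₗ[ℂ] (Fin R'.r → ℂ) := LinearEquiv.ofLinearMap A A' h2 h1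
  let l : (Fin R.r → ℂ) ≃ᵃ[ℂ] (Fin R'.r → ℂ) :=
    (AffineEquiv.constVAdd ℂ (Fin R.r → ℂ) (-R.toFun a)).trans
      (e.toAffineEquiv.trans (AffineEquiv.constVAdd ℂ (Fin R'.r → ℂ) (R'.toFun a)))
  have hl : ∀ z, l z = R'.toFun a + A (z - R.toFun a) := by
    intro z
    rw [sub_eq_neg_add]
    rfl
  have hla : l (R.toFun a) = R'.toFun a := by simp [hl]
  have hlt : Tendsto l (𝓝 (R.toFun a)) (𝓝 (R'.toFun a)) := by
    have := (AffineMap.continuous_of_finiteDimensional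
      l.toAffineMap).continuousAt.tendsto (x := R.toFun a)
    rw [← hla]
    exact this
  refine ⟨l, hla, ?_⟩
  filter_upwards [hmaps H hA, hlt.eventually (hmaps H.symm hA')] with z e1 e2
  rw [hl] at e2 ⊢
  refine ⟨e1, fun hz => ?_⟩
  have e3 := e2 hz
  have e4 : A' (A (z - R.toFun a)) = z - R.toFun a := LinearMap.congr_fun h1 _
  rwa [add_sub_cancel_left, e4, add_sub_cancel] at e3

end AffineEquivalence

/-! ### The bijection of classes. -/

section Correspondence
variable {E : Type uE} [NormedAddCommGroup E] [NormedSpace ℂ E] [FiniteDimensional ℂ E]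
  {Z : Type uZ} [TopologicalSpace Z] [ChartedSpace E Z] [IsManifold 𝓘(ℂ, E) ω Z]
  {F : Type uF} [NormedAddCommGroup F] [NormedSpace ℝ F] [FiniteDimensional ℝ F]
  {M : Type uM} [TopologicalSpace M] [ChartedSpace F M] [IsManifold 𝓘(ℝ, F) ω M]
  (ι : GenericEmbedding E Z F M) (a : M)

/-- Affine equivalence classes of tube realizations correspond to conjugacy classes of
subalgebras. -/
theorem exists_correspondence :
    ∃ C : Quot (TubeRealization.AffinelyEquivalent (ι := ι) (a := a)) ≃
        Quot (TubeSubalgebra.Conjugate (ι := ι) (a := a)),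
      ∀ R : TubeRealization ι a, ∃ h : IsTubeSubalgebra ι a R.translationAlgebra,
        C (Quot.mk _ R) = Quot.mk _ ⟨R.translationAlgebra, h⟩ := by
  have : CompleteSpace F := FiniteDimensional.complete ℝ F
  let f : Quot (TubeRealization.AffinelyEquivalent (ι := ι) (a := a)) →
      Quot (TubeSubalgebra.Conjugate (ι := ι) (a := a)) :=
    Quot.map (fun R => ⟨R.translationAlgebra, R.isTubeSubalgebra⟩)
      fun R R' h => h.exists_conjugation
  have hf : Function.Bijective f := by
    constructor
    · rintro ⟨R⟩ ⟨R'⟩ h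
      -- Since conjugacy is already an equivalence relation, equality in the quotient yields a
      -- single conjugating automorphism.
      obtain ⟨g, hgaut, hg⟩ :=
        (TubeSubalgebra.equivalence_conjugate.eqvGen_iff).1 (Quot.eqvGen_exact h)
      exact Quot.sound (TubeRealization.affinelyEquivalent_of_isPushforward hgaut hg)
    · rintro ⟨𝔳, h𝔳⟩
      obtain ⟨R, rfl⟩ := h𝔳.isAbelianSubalgebra.exists_tubeRealization h𝔳.spans
        ((isTotallyReal_iff h𝔳.isAbelianSubalgebra h𝔳.spans).2 h𝔳.exists_involution)
      exact ⟨Quot.mk _ R, rfl⟩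
  exact ⟨Equiv.ofBijective f hf, fun R => ⟨R.isTubeSubalgebra, rfl⟩⟩

variable {ι a}

/-- The involution of a tube subalgebra and its behaviour under conjugation. -/
theorem IsInvolutionFor.properties {𝔳 : Submodule ℝ (VFGerm F a)}
    (h𝔳 : IsAbelianSubalgebra ι a 𝔳) (hspan : SpansTangent ι a 𝔳) {τ : M → M}
    (hτ : IsInvolutionFor ι a 𝔳 τ) :
    (∀ τ' : M → M, IsInvolutionFor ι a 𝔳 τ' → τ' =ᶠ[𝓝 a] τ) ∧
      IsAnalyticSubmanifoldAt F {p : M | τ p = p} (crDim ι a) a ∧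
      Module.finrank ℝ (negTangent F a τ) = Module.finrank ℂ E ∧
      ∀ (g h : M → M) (𝔳' : Submodule ℝ (VFGerm F a)),
        IsAutPair ι a g h → IsPushforward a g 𝔳 𝔳' →
          IsAbelianSubalgebra ι a 𝔳' ∧ SpansTangent ι a 𝔳' ∧
          IsInvolutionFor ι a 𝔳' (g ∘ τ ∘ h) ∧
          ∀ τ' : M → M, IsInvolutionFor ι a 𝔳' τ' → τ' =ᶠ[𝓝 a] g ∘ τ ∘ h := by
  have : CompleteSpace F := FiniteDimensional.complete ℝ F
  obtain ⟨R, rfl⟩ := h𝔳.exists_tubeRealization hspan (isTotallyReal_of_isInvolutionFor hτ)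
  refine ⟨fun τ' hτ' => R.involution_unique hτ hτ', R.isAnalyticSubmanifoldAt_fixed hτ,
    R.finrank_negTangent hτ, fun g h 𝔳' H hg => ?_⟩
  -- The pushforward is the translation algebra of `R.compAut H`, so the results for translation
  -- algebras apply to it directly.
  obtain rfl := hg.unique (R.isPushforward_compAut H)
  have h1 := (R.compAut H).isTubeSubalgebra
  exact ⟨h1.isAbelianSubalgebra, h1.spans, hτ.conj H hg, fun τ' hτ' =>
    (R.compAut H).involution_unique (hτ.conj H hg) hτ'⟩

end Correspondence

end CRTube

end

theorem mainTheorem3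
    {E : Type*} [NormedAddCommGroup E] [NormedSpace ℂ E] [FiniteDimensional ℂ E]
    {Z : Type*} [TopologicalSpace Z] [T2Space Z] [ChartedSpace E Z] [IsManifold 𝓘(ℂ, E) ω Z]
    {F : Type*} [NormedAddCommGroup F] [NormedSpace ℝ F] [FiniteDimensional ℝ F]
    {M : Type*} [TopologicalSpace M] [T2Space M] [ChartedSpace F M] [IsManifold 𝓘(ℝ, F) ω M]
    (ι : CRTube.GenericEmbedding E Z F M) (a : M) :
    -- the correspondence between classes of tube realizations and classes of subalgebras
    (Equivalence (CRTube.TubeRealization.AffinelyEquivalent (ι := ι) (a := a)) ∧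
      Equivalence (CRTube.TubeSubalgebra.Conjugate (ι := ι) (a := a)) ∧
      ∃ C : Quot (CRTube.TubeRealization.AffinelyEquivalent (ι := ι) (a := a)) ≃
          Quot (CRTube.TubeSubalgebra.Conjugate (ι := ι) (a := a)),
        ∀ R : CRTube.TubeRealization ι a,
          ∃ h : CRTube.IsTubeSubalgebra ι a R.translationAlgebra,
            C (Quot.mk _ R) = Quot.mk _ ⟨R.translationAlgebra, h⟩) ∧
    -- (i') replaces (i)
    (∀ 𝔳 : Submodule ℝ (CRTube.VFGerm F a),
      CRTube.IsAbelianSubalgebra ι a 𝔳 → CRTube.SpansTangent ι a 𝔳 →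
        (CRTube.IsTotallyReal ι a 𝔳 ↔ ∃ τ, CRTube.IsInvolutionFor ι a 𝔳 τ)) ∧
    -- the involution: uniqueness, dimension of its fixed point set, behaviour under conjugation
    (∀ 𝔳 : Submodule ℝ (CRTube.VFGerm F a),
      CRTube.IsAbelianSubalgebra ι a 𝔳 → CRTube.SpansTangent ι a 𝔳 →
      ∀ τ : M → M, CRTube.IsInvolutionFor ι a 𝔳 τ →
        (∀ τ' : M → M, CRTube.IsInvolutionFor ι a 𝔳 τ' → τ' =ᶠ[𝓝 a] τ) ∧
        CRTube.IsAnalyticSubmanifoldAt F {p : M | τ p = p} (CRTube.crDim ι a) a ∧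
        Module.finrank ℝ (CRTube.negTangent F a τ) = Module.finrank ℂ E ∧
        ∀ (g h : M → M) (𝔳' : Submodule ℝ (CRTube.VFGerm F a)),
          CRTube.IsAutPair ι a g h → CRTube.IsPushforward a g 𝔳 𝔳' →
            CRTube.IsAbelianSubalgebra ι a 𝔳' ∧ CRTube.SpansTangent ι a 𝔳' ∧
            CRTube.IsInvolutionFor ι a 𝔳' (g ∘ τ ∘ h) ∧
            ∀ τ' : M → M, CRTube.IsInvolutionFor ι a 𝔳' τ' → τ' =ᶠ[𝓝 a] g ∘ τ ∘ h) := by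
  exact ⟨⟨CRTube.TubeRealization.equivalence_affinelyEquivalent,
      CRTube.TubeSubalgebra.equivalence_conjugate, CRTube.exists_correspondence ι a⟩,
    fun 𝔳 h𝔳 hspan => CRTube.isTotallyReal_iff h𝔳 hspan,
    fun 𝔳 h𝔳 hspan τ hτ => hτ.properties h𝔳 hspan⟩
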